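/- Let $F$ be a number field with ring of adeles $\mathbb{A}$, and let $\widetilde{\mathrm{GL}}_2(\mathbb{A})=\mathrm{GL}_2(\mathbb{A})\times\{\pm1\}$ be the metaplectic group, with product $(g,\epsilon_1)(h,\epsilon_2)=(gh,\epsilon_1\epsilon_2\prod_v\beta_v(g_v,h_v))$. Here $$\beta_v(g,h)=\Big[\tfrac{\ell(gh)}{\ell(g)},\tfrac{\ell(gh)}{\ell(h)}\det g\Big]_v s_v(g)s_v(h)s_v(gh),$$ $[\cdot,\cdot]_v$ is the quadratic Hilbert symbol of $F_v$, and for $g=\left(\begin{smallmatrix}a&b\\c&d\end{smallmatrix}\right)$ we put $\ell(g)=c$ if $c\ne0$, $\ell(g)=d$ if $c=0$, $s_v(g)=[c,d\det g]_v$ if $v$ is finite, $cd\neq0$ and $v(c)$ is odd, and $s_v(g)=1$ otherwise. Write $g^*=(g,1)$ for $g\in \mathrm{GL}_2(\mathbb{A})$ and $\gamma^\varsigma=(\gamma,\prod_v s_v(\gamma))$ for $\gamma\in\mathrm{GL}_2(F)$. Put $n(x)=\left(\begin{smallmatrix}1&x\\&1\end{smallmatrix}\right)$, $a(y)=\left(\begin{smallmatrix}y&\\&1\end{smallmatrix}\right)$,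 $z(\lambda)=\left(\begin{smallmatrix}\lambda&\\&\lambda\end{smallmatrix}\right)$, $w=\left(\begin{smallmatrix}&1\\-1&\end{smallmatrix}\right)$, and let $\widetilde Z(\mathbb{A})$ be the preimage of $Z(\mathbb{A})=\{z(\lambda):\lambda\in\mathbb{A}^\times\}$ and $\widetilde Z(\mathbb{A})^2$ the preimage of $\{z(\lambda^2):\lambda\in\mathbb{A}^\times\}$, which is the centre of $\widetilde{\mathrm{GL}}_2(\mathbb{A})$. Let $\pi$ be a genuine cuspidal automorphic representation of $\widetilde{\mathrm{GL}}_2(\mathbb{A})$, realised as an irreducible subspace of the space of genuine cuspidal automorphic forms (smooth, left $\mathrm{GL}_2(F)^\varsigma$-invariant, right $K$-finite, finite under the centre of the universal enveloping algebra, of moderate growth, cuspidal), with central character $\omega_\pi$ on $\widetilde Z(\mathbb{A})^2$. Let $\Omega(\omega_\pi)$ be the set of genuine continuous characters $\mu:\widetilde Z(\mathbb{A})\to\mathbb{C}^\times$ which are trivial on $Z(F)^\varsigma$ and whose restriction to $\widetilde Z(\mathbb{A})^2$ is $\omega_\pi$; for $\xi\in F^\times$ put $\mu^\xi(z)=\mu((a(\xi)^{-1})^*\,z\,a(\xi)^*)$.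 Let $\psi$ be a continuous unitary additive character of $\mathbb{A}/F$ with local components $\psi_v$, and for $\phi\in\pi$ put $$W_\phi^{\mu}(g)=\int_{Z(F)^\varsigma\widetilde Z(\mathbb{A})^2\backslash\widetilde Z(\mathbb{A})}\int_{F\backslash\mathbb{A}}\phi(z\,n(x)^*g)\,\overline{\psi(x)}\,\mu(z)^{-1}\,dx\,dz,$$ where both compact quotient groups carry the Haar probability measure. **Proposition.** Let $\phi\in\pi$ be right-invariant under $N(\hat{\mathfrak o})^*=\{n(x)^*:x\in\prod_{v<\infty}\mathfrak o_v\}$. Let $\zeta=(\zeta_v)\in\mathbb{A}$, and let $S$ be the set of archimedean places $v$ with $\zeta_v\ne0$ together with the non-archimedean places $v$ with $|\zeta_v|_v>1$. Let $h(\zeta)=(h_v)_v^{*}\in\widetilde{\mathrm{GL}}_2(\mathbb{A})$, where $h_v=\left(\begin{smallmatrix}1&\zeta_v\\-\zeta_v^{-1}&0\end{smallmatrix}\right)$ for $v\in S$ and $h_v=1$ for $v\notin S$. Then both double series below converge absolutely and $$\sum_{\mu\in\Omega(\omega_\pi)}\sum_{\xi\in F^\times}W_\phi^{\mu^\xi}(a(\xi)^*)\,\psi(\xi\zeta)=\sum_{\mu\in\Omega(\omega_\pi)}\sum_{\xi\in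 F^\times}W_\phi^{\mu^\xi}\big(a(\xi)^*w^\varsigma h(\zeta)\big)\prod_{v\in S}\psi_v(-\xi\zeta_v^{-1}).$$ -/

import Mathlib

open NumberField IsDedekindDomain MeasureTheory
open scoped NumberField.AdeleRing TensorProduct

noncomputable section

namespace Metaplectic

/-! ## Local theory: Hilbert symbol and Kubota cocycle -/

section Local

variable {K : Type*} [Field K]

open scoped Classical in
/-- The quadratic Hilbert symbol `[a, b]` of a field `K`, with values in `{±1} = ℤˣ`. -/
def hilbert (a b : K) : ℤˣ :=
  if ∃ x y z : K, (x, y, z) ≠ (0, 0, 0) ∧ z ^ 2 = a * x ^ 2 + b * y ^ 2 then 1 else -1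

open scoped Classical in
/-- `ℓ(a b; c d) = c` if `c ≠ 0`, and `d` otherwise. -/
def ell (g : GL (Fin 2) K) : K := if g 1 0 ≠ 0 then g 1 0 else g 1 1

/-- The factor `[ℓ(gh)/ℓ(g), ℓ(gh)/ℓ(h) · det g]` of the cocycle. -/
def betaCore (g h : GL (Fin 2) K) : ℤˣ :=
  hilbert (ell (g * h) / ell g) (ell (g * h) / ell h * (g : Matrix (Fin 2) (Fin 2) K).det)

end Local

variable (F : Type*) [Field F] [NumberField F]

/-- The finite places of `F`. -/
abbrev FinPl := HeightOneSpectrum (𝓞 F)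

/-- The ring of finite adeles. -/
abbrev FinAdele := FiniteAdeleRing (𝓞 F) F

variable {F}

open scoped Classical in
/-- The function `s_v` at a finite place: `s_v(a b; c d) = [c, d · det]` if `cd ≠ 0` and `v(c)`
is odd, and `1` otherwise. (At the infinite places `s_v` is identically `1`.) -/
def sLocal (v : FinPl F) (g : GL (Fin 2) (v.adicCompletion F)) : ℤˣ :=
  if g 1 0 ≠ 0 ∧ g 1 1 ≠ 0 ∧ ∃ n : ℤ, Odd n ∧ Valued.v (g 1 0) = WithZero.exp n then
    hilbert (g 1 0) (g 1 1 * (g : Matrix (Fin 2) (Fin 2) (v.adicCompletion F)).det)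
  else 1

/-- The local cocycle `β_v` at a finite place. -/
def betaFin (v : FinPl F) (g h : GL (Fin 2) (v.adicCompletion F)) : ℤˣ :=
  betaCore g h * sLocal v g * sLocal v h * sLocal v (g * h)

/-- The local cocycle `β_v` at an infinite place (where `s_v = 1`). -/
def betaInf (v : InfinitePlace F) (g h : GL (Fin 2) v.Completion) : ℤˣ := betaCore g h

/-! ## Components of adeles and of adelic matrices -/

/-- The component `𝔸 → F_v` at an infinite place. -/
def evInf (v : InfinitePlace F) : 𝔸[F] →+* v.Completion where
  toFun a := a.1 v
  map_one' := rfl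
  map_mul' _ _ := rfl
  map_zero' := rfl
  map_add' _ _ := rfl

/-- The component `𝔸 → F_v` at a finite place. -/
def evFin (v : FinPl F) : 𝔸[F] →+* v.adicCompletion F where
  toFun a := a.2 v
  map_one' := rfl
  map_mul' _ _ := rfl
  map_zero' := rfl
  map_add' _ _ := rfl

/-- The component `g_v` of `g ∈ GL₂(𝔸)` at an infinite place. -/
def gInf (v : InfinitePlace F) (g : GL (Fin 2) 𝔸[F]) : GL (Fin 2) v.Completion :=
  Matrix.GeneralLinearGroup.map (evInf v) g

/-- The component `g_v` of `g ∈ GL₂(𝔸)` at a finite place. -/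
def gFin (v : FinPl F) (g : GL (Fin 2) 𝔸[F]) : GL (Fin 2) (v.adicCompletion F) :=
  Matrix.GeneralLinearGroup.map (evFin v) g

/-- The diagonal embedding `GL₂(F) → GL₂(𝔸)`. -/
def diag (γ : GL (Fin 2) F) : GL (Fin 2) 𝔸[F] :=
  Matrix.GeneralLinearGroup.map (algebraMap F 𝔸[F]) γ

/-- The projection `𝔸 → F_∞ = ℝ^{r₁} × ℂ^{r₂}`. -/
def toMixed : 𝔸[F] →+* mixedEmbedding.mixedSpace F where
  toFun a := InfiniteAdeleRing.ringEquiv_mixedSpace F a.1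
  map_one' := map_one (InfiniteAdeleRing.ringEquiv_mixedSpace F)
  map_mul' a b := map_mul (InfiniteAdeleRing.ringEquiv_mixedSpace F) a.1 b.1
  map_zero' := map_zero (InfiniteAdeleRing.ringEquiv_mixedSpace F)
  map_add' a b := map_add (InfiniteAdeleRing.ringEquiv_mixedSpace F) a.1 b.1

/-- The matrix in `GL₂(𝔸)` with infinite part `g` and finite part `h`. -/
def glProd (g : GL (Fin 2) (InfiniteAdeleRing F)) (h : GL (Fin 2) (FinAdele F)) :
    GL (Fin 2) 𝔸[F] where
  val := Matrix.of fun i j => ((g i j, h i j) : InfiniteAdeleRing F × FinAdele F)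
  inv := Matrix.of fun i j =>
    ((g⁻¹ : GL (Fin 2) (InfiniteAdeleRing F)) i j, (h⁻¹ : GL (Fin 2) (FinAdele F)) i j)
  val_inv := by
    have hg := congrArg Units.val (mul_inv_cancel g)
    have hh := congrArg Units.val (mul_inv_cancel h)
    ext i j
    have hg' := congrFun (congrFun hg i) j
    have hh' := congrFun (congrFun hh i) j
    rw [Units.val_mul, Matrix.mul_apply, Fin.sum_univ_two, Units.val_one] at hg' hh'
    rw [Matrix.mul_apply, Fin.sum_univ_two]
    refine (Prod.ext (y := ((1 : Matrix (Fin 2) (Fin 2) (InfiniteAdeleRing F)) i j,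
      (1 : Matrix (Fin 2) (Fin 2) (FinAdele F)) i j)) hg' hh').trans ?_
    by_cases hij : i = j
    · subst hij; simp only [Matrix.one_apply_eq]; rfl
    · simp only [Matrix.one_apply_ne hij]; rfl
  inv_val := by
    have hg := congrArg Units.val (inv_mul_cancel g)
    have hh := congrArg Units.val (inv_mul_cancel h)
    ext i j
    have hg' := congrFun (congrFun hg i) j
    have hh' := congrFun (congrFun hh i) j
    rw [Units.val_mul, Matrix.mul_apply, Fin.sum_univ_two, Units.val_one] at hg' hh'
    rw [Matrix.mul_apply, Fin.sum_univ_two]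
    refine (Prod.ext (y := ((1 : Matrix (Fin 2) (Fin 2) (InfiniteAdeleRing F)) i j,
      (1 : Matrix (Fin 2) (Fin 2) (FinAdele F)) i j)) hg' hh').trans ?_
    by_cases hij : i = j
    · subst hij; simp only [Matrix.one_apply_eq]; rfl
    · simp only [Matrix.one_apply_ne hij]; rfl

/-- The embedding `GL₂(𝔸_f) → GL₂(𝔸)`. -/
def ofFin (h : GL (Fin 2) (FinAdele F)) : GL (Fin 2) 𝔸[F] := glProd 1 h

/-- The embedding `GL₂(F_∞) → GL₂(𝔸)`, with `F_∞ = ℝ^{r₁} × ℂ^{r₂}`. -/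
def ofMixed (g : GL (Fin 2) (mixedEmbedding.mixedSpace F)) : GL (Fin 2) 𝔸[F] :=
  glProd (Matrix.GeneralLinearGroup.map
    (InfiniteAdeleRing.ringEquiv_mixedSpace F).symm.toRingHom g) 1

/-! ## The adelic metaplectic group -/

/-- The global cocycle `∏_v β_v(g_v, h_v)`. -/
def beta (g h : GL (Fin 2) 𝔸[F]) : ℤˣ :=
  (∏ v : InfinitePlace F, betaInf v (gInf v g) (gInf v h)) *
    ∏ᶠ v : FinPl F, betaFin v (gFin v g) (gFin v h)

variable (F) in
/-- The metaplectic group over the adeles: pairs `(g, ε)` with `g ∈ GL₂(𝔸)` and `ε = ±1`. -/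
@[ext]
structure MetaGL2 where
  /-- the matrix `g` -/
  mat : GL (Fin 2) 𝔸[F]
  /-- the sign `ε` -/
  sgn : ℤˣ

/-- `(g, ε₁)(h, ε₂) = (gh, ε₁ ε₂ ∏_v β_v(g_v, h_v))`. -/
instance : Mul (MetaGL2 F) where
  mul x y := ⟨x.mat * y.mat, x.sgn * y.sgn * beta x.mat y.mat⟩

/-- `g^* = (g, 1)`. -/
def gstar (g : GL (Fin 2) 𝔸[F]) : MetaGL2 F := ⟨g, 1⟩

/-- The element `(1, ε)`. -/
def ofSign (ε : ℤˣ) : MetaGL2 F := ⟨1, ε⟩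

/-- `s(γ) = ∏_v s_v(γ)` for `γ ∈ GL₂(F)`. -/
def sGlobal (γ : GL (Fin 2) F) : ℤˣ := ∏ᶠ v : FinPl F, sLocal v (gFin v (diag γ))

/-- The lift `γ^ς = (γ, s(γ))` of `γ ∈ GL₂(F)`. -/
def varsigma (γ : GL (Fin 2) F) : MetaGL2 F := ⟨diag γ, sGlobal γ⟩

/-! ### Special matrices -/

section Matrices

variable {R : Type*} [CommRing R]

/-- `n(x) = (1 x; 0 1)`. -/
def nMat (x : R) : GL (Fin 2) R where
  val := !![1, x; 0, 1]
  inv := !![1, -x; 0, 1]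
  val_inv := by ext i j; fin_cases i <;> fin_cases j <;> simp [Matrix.mul_apply]
  inv_val := by ext i j; fin_cases i <;> fin_cases j <;> simp [Matrix.mul_apply]

/-- `a(y) = (y 0; 0 1)`. -/
def aMat (y : Rˣ) : GL (Fin 2) R where
  val := !![(y : R), 0; 0, 1]
  inv := !![((y⁻¹ : Rˣ) : R), 0; 0, 1]
  val_inv := by ext i j; fin_cases i <;> fin_cases j <;> simp [Matrix.mul_apply]
  inv_val := by ext i j; fin_cases i <;> fin_cases j <;> simp [Matrix.mul_apply]

/-- `z(λ) = (λ 0; 0 λ)`. -/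
def zMat (y : Rˣ) : GL (Fin 2) R where
  val := !![(y : R), 0; 0, (y : R)]
  inv := !![((y⁻¹ : Rˣ) : R), 0; 0, ((y⁻¹ : Rˣ) : R)]
  val_inv := by ext i j; fin_cases i <;> fin_cases j <;> simp [Matrix.mul_apply]
  inv_val := by ext i j; fin_cases i <;> fin_cases j <;> simp [Matrix.mul_apply]

variable (R) in
/-- `w = (0 1; -1 0)`. -/
def wMat : GL (Fin 2) R where
  val := !![0, 1; -1, 0]
  inv := !![0, -1; 1, 0]
  val_inv := by ext i j; fin_cases i <;> fin_cases j <;> simp [Matrix.mul_apply]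
  inv_val := by ext i j; fin_cases i <;> fin_cases j <;> simp [Matrix.mul_apply]

end Matrices

/-- The principal idele of `ξ ∈ F^×`. -/
def principal (ξ : Fˣ) : (𝔸[F])ˣ := Units.map (algebraMap F 𝔸[F]).toMonoidHom ξ

/-! ## Genuine cuspidal automorphic forms -/

/-- Right translation `(R(h) φ)(g) = φ(g h)`. -/
def rightTranslate (h : MetaGL2 F) (φ : MetaGL2 F → ℂ) : MetaGL2 F → ℂ := fun g => φ (g * h)

variable (F) in
/-- The real Lie algebra `𝔤 = M₂(F_∞)` of `GL₂(F_∞)`. -/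
abbrev LieG := Matrix (Fin 2) (Fin 2) (mixedEmbedding.mixedSpace F)

open scoped Classical in
/-- `exp(X) ∈ GL₂(F_∞)` for `X ∈ 𝔤`. -/
def expG (X : LieG F) : GL (Fin 2) (mixedEmbedding.mixedSpace F) :=
  (Matrix.isUnit_exp X).unit

/-- The element `exp(X)^*` of the metaplectic group. For `X` near `0` this is the exponential map of
the metaplectic group, since the infinite cocycles are trivial near the identity. -/
def expStar (X : LieG F) : MetaGL2 F := gstar (ofMixed (expG X))

/-- The derivative `(X φ)(g) = d/dt φ(g exp(tX)) |_{t = 0}`. -/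
def lieDeriv (X : LieG F) (φ : MetaGL2 F → ℂ) : MetaGL2 F → ℂ :=
  fun g => deriv (fun t : ℝ => φ (g * expStar (t • X))) 0

open scoped Classical in
/-- `φ` is smooth: it is invariant under right translation by (the lift of) an open subgroup of
`GL₂(𝔸_f)`, and it is infinitely differentiable in the infinite variables. -/
def IsSmooth (φ : MetaGL2 F → ℂ) : Prop :=
  (∃ U : Subgroup (GL (Fin 2) (FinAdele F)), IsOpen (U : Set (GL (Fin 2) (FinAdele F))) ∧
    ∀ u ∈ U, rightTranslate (gstar (ofFin u)) φ = φ) ∧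
  ∀ g : MetaGL2 F, ContDiffAt ℝ ((⊤ : ℕ∞) : WithTop ℕ∞)
    (fun X : Fin 2 → Fin 2 → mixedEmbedding.mixedSpace F => φ (g * expStar (Matrix.of X))) 0

variable (F) in
/-- The maximal compact subgroup `K_∞ = ∏ O(2) × ∏ U(2)` of `GL₂(F_∞)`. -/
def KInf : Set (GL (Fin 2) (mixedEmbedding.mixedSpace F)) :=
  {k | (k : LieG F) ∈ Matrix.unitaryGroup (Fin 2) (mixedEmbedding.mixedSpace F)}

variable (F) in
/-- The maximal compact subgroup `GL₂(Ô)` of `GL₂(𝔸_f)`. -/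
def KFin : Set (GL (Fin 2) (FinAdele F)) :=
  {k | ∀ (v : FinPl F) (i j : Fin 2), k i j v ∈ v.adicCompletionIntegers F ∧
    (k⁻¹ : GL (Fin 2) (FinAdele F)) i j v ∈ v.adicCompletionIntegers F}

/-- `φ` is right `K`-finite for `K = K_∞ × GL₂(Ô)`. -/
def IsKFinite (φ : MetaGL2 F → ℂ) : Prop :=
  FiniteDimensional ℂ (Submodule.span ℂ
    {f | ∃ k ∈ KInf F, ∃ k' ∈ KFin F, f = rightTranslate (gstar (ofMixed k * ofFin k')) φ})

attribute [local instance] LieRing.ofAssociativeRing LieAlgebra.ofAssociativeAlgebra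

variable (F) in
/-- The universal enveloping algebra of the complexification of `𝔤`. -/
abbrev UEA := UniversalEnvelopingAlgebra ℂ (ℂ ⊗[ℝ] LieG F)

/-- The iterated derivative `X₁ (X₂ (⋯ (Xₙ φ)))`. -/
def wordDeriv (φ : MetaGL2 F → ℂ) (l : List (LieG F)) : MetaGL2 F → ℂ := l.foldr lieDeriv φ

/-- The differential operator attached to a formal linear combination of words `X₁ ⋯ Xₙ`. -/
def diffOp (p : List (LieG F) →₀ ℂ) (φ : MetaGL2 F → ℂ) : MetaGL2 F → ℂ :=
  p.sum fun l c => c • wordDeriv φ l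

/-- The element of the universal enveloping algebra given by a formal linear combination of
words. -/
def toUEA (p : List (LieG F) →₀ ℂ) : UEA F :=
  p.sum fun l c => c • (l.map fun X => UniversalEnvelopingAlgebra.ι ℂ ((1 : ℂ) ⊗ₜ[ℝ] X)).prod

/-- `φ` is finite under the centre of the universal enveloping algebra. -/
def IsZFinite (φ : MetaGL2 F → ℂ) : Prop :=
  FiniteDimensional ℂ (Submodule.span ℂ
    {f | ∃ p, toUEA p ∈ Subalgebra.center ℂ (UEA F) ∧ f = diffOp p φ})

/-- `max |g_ij|, |(g⁻¹)_ij|` for a matrix over a normed field. -/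
def localHeight {K : Type*} [NormedField K] (g : GL (Fin 2) K) : ℝ :=
  ⨆ p : Fin 2 × Fin 2, max ‖g p.1 p.2‖ ‖(g⁻¹ : GL (Fin 2) K) p.1 p.2‖

/-- The height `‖g‖ = ∏_v max |g_ij|_v, |(g⁻¹)_ij|_v` on `GL₂(𝔸)`. -/
def height (g : GL (Fin 2) 𝔸[F]) : ℝ :=
  (∏ v : InfinitePlace F, localHeight (gInf v g)) * ∏ᶠ v : FinPl F, localHeight (gFin v g)

/-- `φ` has moderate growth. -/
def IsModerateGrowth (φ : MetaGL2 F → ℂ) : Prop :=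
  ∃ (C : ℝ) (N : ℕ), ∀ g, ‖φ g‖ ≤ C * height g.mat ^ N

variable (F) in
/-- The quotient `𝔸 / F`. -/
abbrev AdeleQuot := 𝔸[F] ⧸ AdeleRing.principalSubgroup (𝓞 F) F

instance : MeasurableSpace (AdeleQuot F) := borel _

open scoped Classical in
variable (F) in
/-- The Haar probability measure on the compact group `𝔸 / F`. -/
def adeleHaar : Measure (AdeleQuot F) :=
  if h : ∃ ν : Measure (AdeleQuot F), ν.IsAddHaarMeasure ∧ IsProbabilityMeasure ν
  then h.choose else 0

variable (F) in
/-- The subgroup `F^× (𝔸^×)²` of the idele group. -/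
def ratSquares : Subgroup (𝔸[F])ˣ :=
  (Units.map (algebraMap F 𝔸[F]).toMonoidHom).range ⊔ (powMonoidHom 2).range

variable (F) in
/-- The quotient `𝔸^× / F^× (𝔸^×)²`, which is `Z(F) Z(𝔸)² \ Z(𝔸)` for the centre `Z` of `GL₂`. -/
abbrev IdeleQuot := (𝔸[F])ˣ ⧸ ratSquares F

instance : MeasurableSpace (IdeleQuot F) := borel _

open scoped Classical in
variable (F) in
/-- The Haar probability measure on the compact group `𝔸^× / F^× (𝔸^×)²`. -/
def ideleHaar : Measure (IdeleQuot F) :=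
  if h : ∃ ν : Measure (IdeleQuot F), ν.IsHaarMeasure ∧ IsProbabilityMeasure ν
  then h.choose else 0

/-- `φ` is cuspidal: `∫_{F \ 𝔸} φ(n(x)^* g) dx = 0` for all `g`. -/
def IsCuspidal (φ : MetaGL2 F → ℂ) : Prop :=
  ∀ g : MetaGL2 F, ∫ x : AdeleQuot F, φ (gstar (nMat x.out) * g) ∂(adeleHaar F) = 0

/-- Genuine cuspidal automorphic forms on the metaplectic group. -/
structure IsGenuineCuspForm (φ : MetaGL2 F → ℂ) : Prop where
  genuine : ∀ (g : MetaGL2 F) (ε : ℤˣ), φ (g * ofSign ε) = ((ε : ℤ) : ℂ) * φ g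
  automorphic : ∀ (γ : GL (Fin 2) F) (g : MetaGL2 F), φ (varsigma γ * g) = φ g
  smooth : IsSmooth φ
  kFinite : IsKFinite φ
  zFinite : IsZFinite φ
  moderateGrowth : IsModerateGrowth φ
  cuspidal : IsCuspidal φ

/-! ## Genuine cuspidal automorphic representations -/

/-- A space of functions stable under the actions (by right translation) of the metaplectic cover of
`GL₂(𝔸_f)`, of the cover of `K_∞`, and of the Lie algebra `𝔤`. -/
structure IsStable (V : Submodule ℂ (MetaGL2 F → ℂ)) : Prop where
  fin : ∀ h : GL (Fin 2) (FinAdele F), ∀ ε : ℤˣ, ∀ φ ∈ V, rightTranslate ⟨ofFin h, ε⟩ φ ∈ V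
  inf : ∀ k ∈ KInf F, ∀ ε : ℤˣ, ∀ φ ∈ V, rightTranslate ⟨ofMixed k, ε⟩ φ ∈ V
  lie : ∀ X : LieG F, ∀ φ ∈ V, lieDeriv X φ ∈ V

/-- `V` is (the space of) a genuine cuspidal automorphic representation: an irreducible stable
subspace of the space of genuine cuspidal automorphic forms. -/
structure IsCuspidalRep (V : Submodule ℂ (MetaGL2 F → ℂ)) : Prop where
  cuspForm : ∀ φ ∈ V, IsGenuineCuspForm φ
  stable : IsStable V
  ne_bot : V ≠ ⊥
  irreducible : ∀ W : Submodule ℂ (MetaGL2 F → ℂ), W ≤ V → IsStable W → W = ⊥ ∨ W = V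

/-! ## Characters of the preimage of the centre -/

variable (F) in
/-- `Z̃(𝔸)`, the preimage in the metaplectic group of the centre `Z(𝔸)` of `GL₂(𝔸)`. -/
abbrev MetaZ := {g : MetaGL2 F // ∃ y : (𝔸[F])ˣ, g.mat = zMat y}

theorem zMat_mul {R : Type*} [CommRing R] (x y : Rˣ) : zMat x * zMat y = zMat (x * y) := by
  ext i j
  fin_cases i <;> fin_cases j <;> simp [zMat, Matrix.mul_apply]

instance : Mul (MetaZ F) where
  mul a b := ⟨a.1 * b.1, by
    obtain ⟨x, hx⟩ := a.2
    obtain ⟨y, hy⟩ := b.2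
    refine ⟨x * y, ?_⟩
    change a.1.mat * b.1.mat = _
    rw [hx, hy, zMat_mul]⟩

/-- The element `(z(y), ε)` of `Z̃(𝔸)`. -/
def zEl (y : (𝔸[F])ˣ) (ε : ℤˣ) : MetaZ F := ⟨⟨zMat y, ε⟩, y, rfl⟩

/-- The element `z(y)^*` of `Z̃(𝔸)`. -/
def zStar (y : (𝔸[F])ˣ) : MetaZ F := zEl y 1

variable (F) in
/-- A genuine (continuous) character `Z̃(𝔸) → ℂ^×`. -/
structure GenuineChar where
  toFun : MetaZ F → ℂˣ
  map_mul' : ∀ a b, toFun (a * b) = toFun a * toFun b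
  genuine' : ∀ (a : MetaZ F) (ε : ℤˣ),
    toFun (a * zEl 1 ε) = Units.map (Int.castRingHom ℂ).toMonoidHom ε * toFun a
  continuous' : Continuous fun y : (𝔸[F])ˣ => toFun (zStar y)

/-- `μ^δ(z) = μ((a(δ)⁻¹)^* z a(δ)^*)` for `δ ∈ F^×`. -/
def twist (μ : MetaZ F → ℂˣ) (δ : Fˣ) : MetaZ F → ℂˣ := fun z =>
  μ ⟨gstar (aMat (principal δ))⁻¹ * z.1 * gstar (aMat (principal δ)), by
    obtain ⟨y, hy⟩ := z.2
    refine ⟨y, ?_⟩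
    change (aMat (principal δ))⁻¹ * z.1.mat * aMat (principal δ) = _
    rw [hy, mul_assoc, inv_mul_eq_iff_eq_mul]
    ext i j
    fin_cases i <;> fin_cases j <;> simp [zMat, aMat, Matrix.mul_apply, mul_comm]⟩

/-- The set `Ω(ω_π)` for the representation `π` with space `V`: the genuine characters `μ` of
`Z̃(𝔸)`, trivial on the rational points `Z(F)`, whose restriction to the centre
`Z̃² = {(z(y²), ε)}` of the metaplectic group is the central character `ω_π` of `π`, that is, the
character by which the centre acts on `V`. -/
def Omega (V : Submodule ℂ (MetaGL2 F → ℂ)) : Set (GenuineChar F) :=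
  {μ | (∀ q : Fˣ, μ.toFun (zStar (principal q)) = 1) ∧
    ∀ (y : (𝔸[F])ˣ) (ε : ℤˣ), ∀ φ ∈ V,
      rightTranslate (zEl (y ^ 2) ε).1 φ = ((μ.toFun (zEl (y ^ 2) ε) : ℂˣ) : ℂ) • φ}

/-! ## Whittaker functions -/

/-- The `(ψ, μ)`-Whittaker function
`W_φ^μ(g) = ∫_{Z(F) Z̃(𝔸)² \ Z̃(𝔸)} ∫_{F \ 𝔸} φ(z n(x)^* g) conj(ψ(x)) μ(z)⁻¹ dx dz`. -/
def whittaker (ψ : AddChar 𝔸[F] Circle) (φ : MetaGL2 F → ℂ) (μ : MetaZ F → ℂˣ)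
    (g : MetaGL2 F) : ℂ :=
  ∫ y : IdeleQuot F, (∫ x : AdeleQuot F,
    φ ((zStar y.out).1 * gstar (nMat x.out) * g) * (starRingEnd ℂ) (ψ x.out : ℂ)
      * (((μ (zStar y.out))⁻¹ : ℂˣ) : ℂ) ∂(adeleHaar F)) ∂(ideleHaar F)

/-! ## The set `S`, the local characters and the element `h(ζ)` -/

/-- The infinite places in `S`. -/
def SInf (ζ : 𝔸[F]) : Set (InfinitePlace F) := {v | evInf v ζ ≠ 0}

/-- The finite places in `S`. -/
def SFin (ζ : 𝔸[F]) : Set (FinPl F) := {v | 1 < Valued.v (evFin v ζ)}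

open scoped Classical in
/-- The local component `ψ_v` at an infinite place. -/
def psiInf (ψ : AddChar 𝔸[F] Circle) (v : InfinitePlace F) (x : v.Completion) : Circle :=
  ψ ((Pi.single v x : (w : InfinitePlace F) → w.Completion), (0 : FinAdele F))

open scoped Classical in
/-- The local component `ψ_v` at a finite place. -/
def psiFin (ψ : AddChar 𝔸[F] Circle) (v : FinPl F) (x : v.adicCompletion F) : Circle :=
  ψ ((0 : InfiniteAdeleRing F),
    RestrictedProduct.single (fun w : FinPl F => w.adicCompletionIntegers F) v x)

/-- `∏_{v ∈ S} ψ_v(-ξ ζ_v⁻¹)`. -/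
def psiS (ψ : AddChar 𝔸[F] Circle) (ζ : 𝔸[F]) (ξ : F) : Circle :=
  (∏ᶠ v ∈ SInf ζ, psiInf ψ v (-(algebraMap F v.Completion ξ) * (evInf v ζ)⁻¹)) *
    ∏ᶠ v ∈ SFin ζ, psiFin ψ v (-(algebraMap F (v.adicCompletion F) ξ) * (evFin v ζ)⁻¹)

open scoped Classical in
/-- The adele which is `1` at the places in `S` and `0` elsewhere. -/
def indS (ζ : 𝔸[F]) : 𝔸[F] :=
  ((fun v => if v ∈ SInf ζ then 1 else 0 : InfiniteAdeleRing F),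
    (⟨fun v => if v ∈ SFin ζ then 1 else 0, Filter.Eventually.of_forall fun v => by
      dsimp only
      split_ifs
      · exact one_mem (v.adicCompletionIntegers F)
      · exact zero_mem (v.adicCompletionIntegers F)⟩ : FinAdele F))

open scoped Classical in
/-- The adele which is `ζ_v⁻¹` at the places in `S` and `0` elsewhere. -/
def invS (ζ : 𝔸[F]) : 𝔸[F] :=
  ((fun v => if v ∈ SInf ζ then (evInf v ζ)⁻¹ else 0 : InfiniteAdeleRing F),
    (⟨fun v => if v ∈ SFin ζ then (evFin v ζ)⁻¹ else 0, Filter.Eventually.of_forall fun v => by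
      dsimp only
      split_ifs with h
      · change Valued.v ((evFin v ζ)⁻¹) ≤ 1
        rw [map_inv₀]
        exact inv_le_one_of_one_le₀ (le_of_lt h)
      · exact zero_mem (v.adicCompletionIntegers F)⟩ : FinAdele F))

open scoped Classical in
theorem mul_invS (ζ : 𝔸[F]) : ζ * invS ζ = indS ζ := by
  refine Prod.ext (funext fun v => ?_) (FiniteAdeleRing.ext _ fun v => ?_)
  · change evInf v ζ * (if v ∈ SInf ζ then (evInf v ζ)⁻¹ else 0) = if v ∈ SInf ζ then 1 else 0
    split_ifs with h
    · exact mul_inv_cancel₀ h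
    · exact mul_zero _
  · change evFin v ζ * (if v ∈ SFin ζ then (evFin v ζ)⁻¹ else 0) = if v ∈ SFin ζ then 1 else 0
    split_ifs with h
    · refine mul_inv_cancel₀ fun h0 => ?_
      change 1 < Valued.v (evFin v ζ) at h
      rw [h0, map_zero] at h
      exact absurd h (by simp)
    · exact mul_zero _

open scoped Classical in
theorem indS_mul_invS (ζ : 𝔸[F]) : indS ζ * invS ζ = invS ζ := by
  refine Prod.ext (funext fun v => ?_) (FiniteAdeleRing.ext _ fun v => ?_)
  · change (if v ∈ SInf ζ then 1 else 0) * (if v ∈ SInf ζ then (evInf v ζ)⁻¹ else 0) =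
      if v ∈ SInf ζ then (evInf v ζ)⁻¹ else 0
    split_ifs <;> simp
  · change (if v ∈ SFin ζ then 1 else 0) * (if v ∈ SFin ζ then (evFin v ζ)⁻¹ else 0) =
      if v ∈ SFin ζ then (evFin v ζ)⁻¹ else 0
    split_ifs <;> simp

/-- The matrix in `GL₂(𝔸)` whose component is `(1 ζ_v; -ζ_v⁻¹ 0)` at the places `v ∈ S` and the
identity at all other places. -/
def hMat (ζ : 𝔸[F]) : GL (Fin 2) 𝔸[F] :=
  Matrix.GeneralLinearGroup.mk'' !![1, indS ζ * ζ; -invS ζ, 1 - indS ζ] (by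
    have h1 := mul_invS ζ
    have h2 := indS_mul_invS ζ
    have : Matrix.det !![1, indS ζ * ζ; -invS ζ, 1 - indS ζ] = 1 := by
      rw [Matrix.det_fin_two_of]
      linear_combination ζ * h2 + h1
    rw [this]
    exact isUnit_one)

/-- `h(ζ) = hMat(ζ)^*`. -/
def hEl (ζ : 𝔸[F]) : MetaGL2 F := gstar (hMat ζ)

/-- `φ` is right-invariant under `N(ô)^*`, `ô = ∏_{v < ∞} 𝔬_v`. -/
def IsNInvariant (φ : MetaGL2 F → ℂ) : Prop :=
  ∀ x : FinAdele F, (∀ v, x v ∈ v.adicCompletionIntegers F) →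
    rightTranslate (gstar (ofFin (nMat x))) φ = φ

end Metaplectic

end

/-!
Both double series are expansions of values of `φ`. Write `g₀` for one of the base points `1` and
`w h(ζ)` (`IsBase`), and consider `φ(z(y)^* n(x)^* g₀^*)` (`elt g₀ y x`) as a function of an idele
`y` and an adele `x`.

* In `x` it is a function on the compact group `𝔸 / F`, smooth in the archimedean variable because
  the Lie algebra acts on `φ`, and invariant under `N · Ô` for some `N ≥ 1` (`IsNice`). For
  `ψ ≠ 1` the characters `x ↦ ψ(ξx)` with `ξ ∈ F` are orthonormal and separate the points of `𝔸 / F`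
  (`exists_rational_of_addChar_mul_eq_one`), so the function is the sum of an absolutely convergent
  Fourier series (`IsNice.summable_fourierCoef`, `hasSum_fourierCoef`), whose constant term vanishes
  as `φ` is cuspidal. For `ψ = 1` all Whittaker functions vanish.
* In `y`, after division by a fixed `μ₀ ∈ Ω(ω_π)`, it is a function on `𝔸ˣ / Fˣ (𝔸ˣ)²` (`normForm`).
  This group is compact, by the finiteness of the class number, and the function is invariant
  under an open subgroup (`exists_isOpen_stabilizer`). As `Ω(ω_π)` is a torsor under the characters
  of this group, the sum over `μ` is Fourier inversion on a finite quotient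
  (`summable_and_tsum_integral_mul_inv`).

The number `W_φ^{μ^ξ}(a(ξ)^* g₀^*)` is the double Fourier coefficient at `(μ / μ₀, ξ)`, the twist
`μ ↦ μ^ξ` absorbing the sign by which `a(ξ)^*` fails to commute with `z(y)^*`
(`whittaker_eq_integral_fourierCoef`). Hence the two series converge absolutely, with sums
`φ(n(ζ)^*)` and `φ(n(-ζ_S⁻¹)^* (w h(ζ))^*)`, where `ζ_S⁻¹` has components `ζ_v⁻¹` at `v ∈ S` and `0`
elsewhere (`whittaker_expansion`, `psiS_eq`). Since `n(-ζ_S⁻¹) w h(ζ) = w n(ζ_S)`, where `ζ - ζ_S`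
lies in the product of the rings of integers, these values agree by invariance under `w^ς` and
under `N(ô)^*` (`IsGenuineCuspForm.elt_wMat_mul_hMat`).

The bimultiplicativity of the Hilbert symbol is not needed, nor is the product formula. The
cocycle is evaluated only on products in which it reduces to a product of Hilbert symbols `hil` of
ideles, where the identities in use follow from the existence of a genuine character of the
preimage of the centre (`GenuineChar.hil_cocycle`). The only arithmetic input about the symbol is
that it is trivial on units at almost all places (`hilbert_eq_one_of_units`).
-/

noncomputable section

namespace Metaplectic

variable {F : Type*} [Field F] [NumberField F]

/-! ### Completions at the finite places -/

theorem valued_mem_nhds_zero {v : FinPl F} {s : Set (v.adicCompletion F)} :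
    s ∈ nhds 0 ↔ ∃ n : ℕ, {x | Valued.v x ≤ WithZero.exp (-(n : ℤ))} ⊆ s := by
  rw [Valued.mem_nhds_zero]
  constructor
  · rintro ⟨γ, hγ⟩
    obtain ⟨n, hn⟩ : ∃ n : ℕ, WithZero.exp (-(n : ℤ)) <
        MonoidWithZeroHom.ValueGroup₀.embedding γ.1 := by
      have h0 : MonoidWithZeroHom.ValueGroup₀.embedding γ.1 ≠ 0 := by simp
      obtain ⟨k, hk⟩ : ∃ k : ℤ, MonoidWithZeroHom.ValueGroup₀.embedding γ.1 = WithZero.exp k :=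
        ⟨_, (WithZero.exp_log h0).symm⟩
      refine ⟨(1 - k).toNat, ?_⟩
      rw [hk, WithZero.exp_lt_exp]
      omega
    refine ⟨n, fun x hx => hγ ?_⟩
    rw [Set.mem_ofPred_eq, Valuation.restrict_lt_iff_lt_embedding]
    exact lt_of_le_of_lt hx hn
  · rintro ⟨n, hn⟩
    obtain ⟨y, hy⟩ := v.valuedAdicCompletion_surjective F (WithZero.exp (-(n : ℤ)))
    have hy0 : Valued.v.restrict y ≠ 0 := by
      simp only [ne_eq, Valuation.restrict_eq_zero_iff]
      rw [hy]; exact WithZero.exp_ne_zero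
    refine ⟨Units.mk0 _ hy0, fun x hx => hn ?_⟩
    rw [Set.mem_ofPred_eq, Units.val_mk0, Valuation.restrict_lt_iff] at hx
    exact hx.le.trans_eq hy

theorem valued_add_le {v : FinPl F} {x y : v.adicCompletion F} {g : WithZero (Multiplicative ℤ)}
    (hx : Valued.v x ≤ g) (hy : Valued.v y ≤ g) : Valued.v (x + y) ≤ g :=
  Valuation.map_add_le _ hx hy

/-- Density of `F` in its completion at a finite place. -/
theorem exists_field_close (v : FinPl F) (x : v.adicCompletion F) (n : ℕ) :
    ∃ a : F, Valued.v (x - algebraMap F _ a) ≤ WithZero.exp (-(n : ℤ)) := by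
  have h : {y : v.adicCompletion F | Valued.v (x - y) ≤ WithZero.exp (-(n : ℤ))} ∈ nhds x := by
    have : Filter.Tendsto (fun y : v.adicCompletion F => x - y) (nhds x) (nhds 0) := by
      simpa using (tendsto_const_nhds (x := x)).sub (Filter.tendsto_id (x := nhds x))
    exact this (valued_mem_nhds_zero.2 ⟨n, subset_rfl⟩)
  obtain ⟨y, ⟨a, rfl⟩, hy⟩ := (HeightOneSpectrum.denseRange_algebraMap F v).inter_nhds_nonempty h
  exact ⟨a, hy⟩

/-- Density of `𝓞 F` in the ring of integers of the completion at a finite place. -/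
theorem exists_int_close (v : FinPl F) {x : v.adicCompletion F} (hx : Valued.v x ≤ 1) (n : ℕ) :
    ∃ r : 𝓞 F, Valued.v (x - algebraMap F _ (r : F)) ≤ WithZero.exp (-(n : ℤ)) := by
  obtain ⟨a, ha⟩ := exists_field_close v x n
  have hn : WithZero.exp (-(n : ℤ)) ≤ (1 : WithZero (Multiplicative ℤ)) := by
    rw [← WithZero.exp_zero, WithZero.exp_le_exp]; omega
  have ha1 : v.valuation F a ≤ 1 := by
    rw [← HeightOneSpectrum.valuedAdicCompletion_eq_valuation']
    have : (a : v.adicCompletion F) = x - (x - algebraMap F _ a) := by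
      rw [sub_sub_cancel]; rfl
    rw [this]
    exact Valuation.map_sub_le _ hx (ha.trans hn)
  obtain ⟨r, hr⟩ := v.exists_valuation_sub_lt_of_integer (K := F) ha1
    (Units.mk0 (WithZero.exp (-(n : ℤ))) WithZero.exp_ne_zero)
  refine ⟨r, ?_⟩
  have h2 : Valued.v (algebraMap F (v.adicCompletion F) (r - a)) ≤ WithZero.exp (-(n : ℤ)) :=
    (HeightOneSpectrum.valuedAdicCompletion_eq_valuation' v ((r : F) - a)).trans_le hr.le
  have h3 : x - algebraMap F (v.adicCompletion F) (r : F) =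
      (x - algebraMap F _ a) - algebraMap F (v.adicCompletion F) (r - a) := by
    rw [map_sub]; ring
  rw [h3]
  exact Valuation.map_sub_le _ ha h2

theorem valued_int_le_one (v : FinPl F) (r : 𝓞 F) :
    Valued.v (algebraMap F (v.adicCompletion F) (r : F)) ≤ 1 :=
  HeightOneSpectrum.coe_mem_adicCompletionIntegers v r

theorem valued_int_le_exp_iff (v : FinPl F) (r : 𝓞 F) (n : ℕ) :
    Valued.v (algebraMap F (v.adicCompletion F) (r : F)) ≤ WithZero.exp (-(n : ℤ)) ↔
      r ∈ v.asIdeal ^ n := by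
  rw [← HeightOneSpectrum.intValuation_le_pow_iff_mem, ← HeightOneSpectrum.valuation_of_algebraMap
    (K := F)]
  exact iff_of_eq (congrArg (· ≤ WithZero.exp (-(n : ℤ)))
    (HeightOneSpectrum.valuedAdicCompletion_eq_valuation' v (r : F)))

theorem isCompact_adicCompletionIntegers (v : FinPl F) :
    IsCompact (v.adicCompletionIntegers F : Set (v.adicCompletion F)) := by
  -- closed and totally bounded, since the quotients by powers of the prime are finite
  refine (?_ : TotallyBounded _).isCompact_of_isClosed
    (Valued.isClosed_valuationSubring (v.adicCompletion F))
  rw [totallyBounded_iff_subset_finite_iUnion_nhds_zero]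
  intro U hU
  obtain ⟨n, hn⟩ := valued_mem_nhds_zero.1 hU
  have : Finite (𝓞 F ⧸ v.asIdeal ^ n) :=
    Ideal.finiteQuotientOfFreeOfNeBot _ (pow_ne_zero _ v.ne_bot)
  refine ⟨Set.range fun q : 𝓞 F ⧸ v.asIdeal ^ n =>
    algebraMap F (v.adicCompletion F) (Quotient.out q : 𝓞 F), Set.finite_range _, ?_⟩
  intro x hx
  obtain ⟨r, hr⟩ := exists_int_close v hx n
  refine Set.mem_iUnion₂.2 ⟨_, ⟨Ideal.Quotient.mk _ r, rfl⟩, ?_⟩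
  rw [Set.mem_vadd_set_iff_neg_vadd_mem]
  refine hn ?_
  have h1 : r - (Quotient.out (Ideal.Quotient.mk (v.asIdeal ^ n) r) : 𝓞 F) ∈ v.asIdeal ^ n := by
    rw [← Ideal.Quotient.eq]
    exact (Quotient.out_eq (Ideal.Quotient.mk (v.asIdeal ^ n) r)).symm
  rw [← valued_int_le_exp_iff] at h1
  have h2 := valued_add_le hr h1
  rw [Set.mem_ofPred_eq]
  convert h2 using 2
  simp only [vadd_eq_add, map_sub]
  ring

/-- Hensel's lemma for the squares of the principal units at a place of odd residue
characteristic. -/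
theorem isSquare_of_valued_sub_one_lt (v : FinPl F)
    (h2 : Valued.v (2 : v.adicCompletion F) = 1) {u : v.adicCompletion F}
    (hu : Valued.v (u - 1) ≤ WithZero.exp (-((1 : ℕ) : ℤ))) :
    ∃ w : v.adicCompletion F, w ≠ 0 ∧ w ^ 2 = u := by
  have h20 : (2 : v.adicCompletion F) ≠ 0 := fun h => by simp [h] at h2
  set B : Set (v.adicCompletion F) := {w | Valued.v (w - 1) ≤ WithZero.exp (-((1 : ℕ) : ℤ))}
    with hB
  have hlt : WithZero.exp (-((1 : ℕ) : ℤ)) < (1 : WithZero (Multiplicative ℤ)) := by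
    rw [← WithZero.exp_zero, WithZero.exp_lt_exp]; simp
  have hB1 : ∀ w ∈ B, Valued.v w = 1 := fun w hw => by
    have h1 : Valued.v (w - 1) < Valued.v (1 : v.adicCompletion F) := by
      rw [map_one]; exact lt_of_le_of_lt hw hlt
    have := Valuation.map_add_eq_of_lt_left _ h1
    simpa using this
  -- Newton's method: `w + (u - w²) / 2` is a better approximation of a square root than `w`
  have key : ∀ n : ℕ, ∃ w ∈ B, Valued.v (u - w ^ 2) ≤ WithZero.exp (-((n + 1 : ℕ) : ℤ)) := by
    intro n
    induction n with
    | zero => exact ⟨1, by rw [hB]; simp, by simpa using hu⟩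
    | succ n ih =>
      obtain ⟨w, hw, hwn⟩ := ih
      set d := (u - w ^ 2) / 2 with hd
      have hdv : Valued.v d ≤ WithZero.exp (-((n + 1 : ℕ) : ℤ)) := by
        rw [hd, map_div₀, h2, div_one]; exact hwn
      have hd1 : Valued.v d ≤ WithZero.exp (-((1 : ℕ) : ℤ)) :=
        hdv.trans (WithZero.exp_le_exp.2 (by push_cast; omega))
      refine ⟨w + d, ?_, ?_⟩
      · have := valued_add_le hw hd1
        rwa [hB, Set.mem_ofPred_eq, show w + d - 1 = w - 1 + d by ring]
      · have h3 : u - (w + d) ^ 2 = (u - w ^ 2) * -(w - 1) + - (d * d) := by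
          have : u - w ^ 2 = 2 * d := (mul_div_cancel₀ _ h20).symm
          linear_combination w * this
        have h4 : WithZero.exp (-((n + 1 + 1 : ℕ) : ℤ)) =
            WithZero.exp (-((n + 1 : ℕ) : ℤ)) * WithZero.exp (-((1 : ℕ) : ℤ)) := by
          rw [← WithZero.exp_add]; congr 1
        rw [h3, h4]
        refine valued_add_le ?_ ?_
        · rw [map_mul, Valuation.map_neg]; exact mul_le_mul' hwn hw
        · rw [Valuation.map_neg, map_mul]; exact mul_le_mul' hdv hd1
  have hBc : IsCompact B := by
    have : IsClosed B := by
      have h0 : IsClosed {w : v.adicCompletion F | Valued.v w ≤ WithZero.exp (-((1 : ℕ) : ℤ))} := by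
        obtain ⟨y, hy⟩ := v.valuedAdicCompletion_surjective F (WithZero.exp (-((1 : ℕ) : ℤ)))
        have := Valued.isClosed_closedBall (v.adicCompletion F) (Valued.v.restrict y)
        simpa only [Valuation.restrict_le_iff, hy] using this
      exact h0.preimage (continuous_id.sub continuous_const)
    exact (isCompact_adicCompletionIntegers v).of_isClosed_subset this fun w hw => (hB1 w hw).le
  -- by compactness of `B`, approximate square roots yield an exact one
  have hcl : IsClosed ((fun w => w ^ 2) '' B) := (hBc.image (continuous_pow 2)).isClosed
  have hmem : u ∈ (fun w => w ^ 2) '' B := by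
    rw [← hcl.closure_eq, mem_closure_iff_nhds]
    intro t ht
    have ht' : (fun y => u - y) ⁻¹' t ∈ nhds (0 : v.adicCompletion F) := by
      have : Filter.Tendsto (fun y : v.adicCompletion F => u - y) (nhds 0) (nhds u) := by
        simpa using (tendsto_const_nhds (x := u)).sub (Filter.tendsto_id (x := nhds 0))
      exact this ht
    obtain ⟨n, hn⟩ := valued_mem_nhds_zero.1 ht'
    obtain ⟨w, hw, hwn⟩ := key n
    refine ⟨w ^ 2, ?_, w, hw, rfl⟩
    have := hn (show u - w ^ 2 ∈ _ from hwn.trans (WithZero.exp_le_exp.2 (by push_cast; omega)))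
    simpa using this
  obtain ⟨w, hw, rfl⟩ := hmem
  refine ⟨w, fun h => ?_, rfl⟩
  have := hB1 w hw
  simp [h] at this

/-- The Hilbert symbol of two units is trivial at a place of odd residue characteristic. -/
theorem hilbert_eq_one_of_units (v : FinPl F) (h2 : Valued.v (2 : v.adicCompletion F) = 1)
    {a b : v.adicCompletion F} (ha : Valued.v a = 1) (hb : Valued.v b = 1) : hilbert a b = 1 := by
  obtain ⟨r, hr⟩ := exists_int_close v ha.le 1
  obtain ⟨s, hs⟩ := exists_int_close v hb.le 1
  have hlt : WithZero.exp (-((1 : ℕ) : ℤ)) < (1 : WithZero (Multiplicative ℤ)) := by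
    rw [← WithZero.exp_zero, WithZero.exp_lt_exp]; simp
  have hmem : ∀ t : 𝓞 F, Valued.v (algebraMap F (v.adicCompletion F) (t : F)) = 1 →
      t ∉ v.asIdeal := fun t ht hm => by
    rw [← pow_one v.asIdeal, ← valued_int_le_exp_iff, ht] at hm
    exact absurd hm (not_le.2 hlt)
  have hval : ∀ (x : v.adicCompletion F) (t : 𝓞 F), Valued.v x = 1 →
      Valued.v (x - algebraMap F (v.adicCompletion F) (t : F)) ≤ WithZero.exp (-((1 : ℕ) : ℤ)) →
      Valued.v (algebraMap F (v.adicCompletion F) (t : F)) = 1 := fun x t hx ht => by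
    have : Valued.v (x - (x - algebraMap F (v.adicCompletion F) (t : F))) = Valued.v x :=
      Valuation.map_sub_eq_of_lt_left _ (by rw [hx]; exact lt_of_le_of_lt ht hlt)
    rw [sub_sub_cancel, hx] at this
    exact this
  let k := 𝓞 F ⧸ v.asIdeal
  let _ : Field k := Ideal.Quotient.field v.asIdeal
  have : Finite k := Ideal.finiteQuotientOfFreeOfNeBot _ v.ne_bot
  let _ : Fintype k := Fintype.ofFinite k
  let π : 𝓞 F →+* k := Ideal.Quotient.mk v.asIdeal
  have hπ : ∀ t : 𝓞 F, π t = 0 ↔ t ∈ v.asIdeal := fun t => Ideal.Quotient.eq_zero_iff_mem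
  have hr0 : π r ≠ 0 := fun h => hmem r (hval a r ha hr) ((hπ r).1 h)
  have hs0 : π s ≠ 0 := fun h => hmem s (hval b s hb hs) ((hπ s).1 h)
  have hchar : ringChar k ≠ 2 := fun h => by
    have h2k : (2 : k) = 0 := by
      have := ringChar.Nat.cast_ringChar (R := k)
      rw [h] at this; exact_mod_cast this
    have h2F : algebraMap F (v.adicCompletion F) ((2 : 𝓞 F) : F) = 2 := by
      exact map_ofNat ((algebraMap F (v.adicCompletion F)).comp (algebraMap (𝓞 F) F)) 2
    exact hmem 2 (by rw [h2F]; exact h2) ((hπ 2).1 (by rw [map_ofNat]; exact h2k))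
  -- the equation `r x² + s y² = 1` has a solution in the residue field
  obtain ⟨x, y, hxy⟩ := FiniteField.exists_root_sum_quadratic
    (f := Polynomial.C (π r) * Polynomial.X ^ 2)
    (g := Polynomial.C (π s) * Polynomial.X ^ 2 + Polynomial.C 0 * Polynomial.X +
      Polynomial.C (-1))
    (Polynomial.degree_C_mul_X_pow 2 hr0) (Polynomial.degree_quadratic hs0)
    (FiniteField.odd_card_of_char_ne_two hchar)
  obtain ⟨x, rfl⟩ := Ideal.Quotient.mk_surjective x
  obtain ⟨y, rfl⟩ := Ideal.Quotient.mk_surjective y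
  have hm : r * x ^ 2 + s * y ^ 2 - 1 ∈ v.asIdeal ^ 1 := by
    rw [pow_one, ← hπ]
    simpa [sub_eq_add_neg, add_assoc, π] using hxy
  rw [← valued_int_le_exp_iff] at hm
  set X := algebraMap F (v.adicCompletion F) (x : F) with hX
  set Y := algebraMap F (v.adicCompletion F) (y : F) with hY
  have hX1 : Valued.v X ≤ 1 := valued_int_le_one v x
  have hY1 : Valued.v Y ≤ 1 := valued_int_le_one v y
  have hu : Valued.v (a * X ^ 2 + b * Y ^ 2 - 1) ≤ WithZero.exp (-((1 : ℕ) : ℤ)) := by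
    have e : a * X ^ 2 + b * Y ^ 2 - 1 =
        ((a - algebraMap F _ (r : F)) * X ^ 2 + (b - algebraMap F _ (s : F)) * Y ^ 2) +
        algebraMap F _ ((r * x ^ 2 + s * y ^ 2 - 1 : 𝓞 F) : F) := by
      have h1 : algebraMap F (v.adicCompletion F) ((r * x ^ 2 + s * y ^ 2 - 1 : 𝓞 F) : F) =
          algebraMap F _ (r : F) * X ^ 2 + algebraMap F _ (s : F) * Y ^ 2 - 1 := by
        change ((algebraMap F (v.adicCompletion F)).comp (algebraMap (𝓞 F) F)) _ = _
        rw [map_sub, map_add, map_mul, map_mul, map_pow, map_pow, map_one]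
        rfl
      rw [h1]
      ring
    rw [e]
    refine valued_add_le (valued_add_le ?_ ?_) hm
    · rw [map_mul, map_pow]
      exact (mul_le_mul' hr (pow_le_one₀ zero_le hX1)).trans_eq (mul_one _)
    · rw [map_mul, map_pow]
      exact (mul_le_mul' hs (pow_le_one₀ zero_le hY1)).trans_eq (mul_one _)
  obtain ⟨w, hw0, hw⟩ := isSquare_of_valued_sub_one_lt v h2 hu
  rw [hilbert, if_pos]
  exact ⟨X, Y, w, by simp [hw0], hw⟩

/-! ### The quadratic Hilbert symbol -/

section HilbertSymbol

variable {K : Type*} [Field K]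

theorem hilbert_comm (a b : K) : hilbert a b = hilbert b a := by
  unfold hilbert
  congr 1
  refine propext ⟨?_, ?_⟩ <;> rintro ⟨x, y, z, h0, h⟩ <;>
    exact ⟨y, x, z, by simp only [ne_eq, Prod.mk.injEq] at h0 ⊢; tauto, by rw [h, add_comm]⟩

theorem hilbert_one_left (b : K) : hilbert 1 b = 1 := by
  rw [hilbert, if_pos]; exact ⟨1, 0, 1, by simp, by ring⟩

theorem hilbert_mul_sq (a b : K) {c : K} (hc : c ≠ 0) :
    hilbert a (b * c ^ 2) = hilbert a b := by
  unfold hilbert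
  congr 1
  refine propext ⟨?_, ?_⟩
  · rintro ⟨x, y, z, h0, h⟩
    refine ⟨x, c * y, z, ?_, by rw [h]; ring⟩
    simp only [ne_eq, Prod.mk.injEq, mul_eq_zero, hc, false_or] at h0 ⊢; exact h0
  · rintro ⟨x, y, z, h0, h⟩
    refine ⟨x, c⁻¹ * y, z, ?_, by rw [h]; field_simp⟩
    simp only [ne_eq, Prod.mk.injEq, mul_eq_zero, inv_eq_zero, hc, false_or] at h0 ⊢; exact h0

/-- The relation `[a, -ac] = [a, c]`, by the substitution `(x, y, z) ↦ (z, ay, ax)`. Only such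
formal properties of the Hilbert symbol are used, not its bimultiplicativity. -/
theorem hilbert_neg_mul {a : K} (c : K) (ha : a ≠ 0) : hilbert a (-(a * c)) = hilbert a c := by
  unfold hilbert
  congr 1
  refine propext ⟨?_, ?_⟩
  · rintro ⟨x, y, z, h0, h⟩
    refine ⟨z, a * y, a * x, ?_, by linear_combination (-a) * h⟩
    simp only [ne_eq, Prod.mk.injEq, mul_eq_zero, ha, false_or] at h0 ⊢; tauto
  · rintro ⟨x, y, z, h0, h⟩
    refine ⟨z, y, a * x, ?_, by linear_combination (-a) * h⟩
    simp only [ne_eq, Prod.mk.injEq, mul_eq_zero, ha, false_or] at h0 ⊢; tauto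

theorem ell_ne_zero (g : GL (Fin 2) K) : ell g ≠ 0 := by
  unfold ell
  split_ifs with h
  · exact h
  · intro h1
    have := g.isUnit.map Matrix.detMonoidHom
    rw [Matrix.coe_detMonoidHom, Matrix.det_fin_two] at this
    rw [not_not] at h
    rw [h, h1] at this
    simp at this

theorem ell_eq_of_row {g h : GL (Fin 2) K} (h0 : g 1 0 = h 1 0) (h1 : g 1 1 = h 1 1) :
    ell g = ell h := by
  unfold ell; rw [h0, h1]

theorem ell_of_row_smul {g h : GL (Fin 2) K} {c : K} (hc : c ≠ 0) (h0 : h 1 0 = c * g 1 0)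
    (h1 : h 1 1 = c * g 1 1) : ell h = c * ell g := by
  by_cases hg : g 1 0 = 0
  · rw [ell, ell, if_neg (by simp [h0, hg]), if_neg (by simp [hg]), h1]
  · rw [ell, ell, if_pos (by simp [h0, hg, hc]), if_pos hg, h0]

end HilbertSymbol

/-! ### Global symbols attached to ideles -/

theorem evInf_ne_zero (v : InfinitePlace F) (a : 𝔸[F]ˣ) : evInf v (a : 𝔸[F]) ≠ 0 :=
  (a.isUnit.map (evInf v)).ne_zero

theorem evFin_ne_zero (v : FinPl F) (a : 𝔸[F]ˣ) : evFin v (a : 𝔸[F]) ≠ 0 :=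
  (a.isUnit.map (evFin v)).ne_zero

theorem idele_finite_valued_ne_one (a : 𝔸[F]ˣ) :
    {v : FinPl F | Valued.v (evFin v (a : 𝔸[F])) ≠ 1}.Finite :=
  (FiniteAdeleRing.isUnit_iff.1 (a.isUnit.map (RingHom.snd (InfiniteAdeleRing F) (FinAdele F)))).2

theorem finite_valued_two_ne_one :
    {v : FinPl F | Valued.v (2 : v.adicCompletion F) ≠ 1}.Finite := by
  let u : 𝔸[F]ˣ := Units.map (algebraMap F 𝔸[F]).toMonoidHom (Units.mk0 2 two_ne_zero)
  refine (idele_finite_valued_ne_one u).subset fun v hv => ?_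
  have : evFin v (u : 𝔸[F]) = 2 := map_ofNat ((evFin v).comp (algebraMap F 𝔸[F])) 2
  rwa [Set.mem_ofPred_eq, this]

theorem finite_hilbert_ne_one (a b : 𝔸[F]ˣ) : {v : FinPl F |
    hilbert (evFin v (a : 𝔸[F])) (evFin v (b : 𝔸[F])) ≠ 1}.Finite := by
  refine ((finite_valued_two_ne_one.union (idele_finite_valued_ne_one a)).union
    (idele_finite_valued_ne_one b)).subset fun v hv => ?_
  simp only [Set.mem_union, Set.mem_ofPred_eq]
  by_contra! h
  exact hv (hilbert_eq_one_of_units v h.1.1 h.1.2 h.2)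

/-- The product `∏_v [a_v, b_v]_v` of the Hilbert symbols of two ideles over all places. -/
def hil (a b : 𝔸[F]ˣ) : ℤˣ :=
  (∏ v : InfinitePlace F, hilbert (evInf v (a : 𝔸[F])) (evInf v (b : 𝔸[F]))) *
    ∏ᶠ v : FinPl F, hilbert (evFin v (a : 𝔸[F])) (evFin v (b : 𝔸[F]))

theorem hil_comm (a b : 𝔸[F]ˣ) : hil a b = hil b a := by
  simp only [hil, hilbert_comm]

theorem hil_one_left (b : 𝔸[F]ˣ) : hil 1 b = 1 := by
  simp [hil, hilbert_one_left]

theorem hil_mul_sq (a b c : 𝔸[F]ˣ) : hil a (b * c ^ 2) = hil a b := by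
  simp only [hil, Units.val_mul, Units.val_pow_eq_pow_val, map_mul, map_pow,
    hilbert_mul_sq _ _ (evInf_ne_zero _ c), hilbert_mul_sq _ _ (evFin_ne_zero _ c)]

theorem hil_sq (a c : 𝔸[F]ˣ) : hil a (c ^ 2) = 1 := by
  rw [← one_mul (c ^ 2), hil_mul_sq, hil_comm, hil_one_left]

theorem hil_neg_mul (a c : 𝔸[F]ˣ) : hil a (-(a * c)) = hil a c := by
  simp only [hil, Units.val_mul, Units.val_neg, map_mul, map_neg,
    hilbert_neg_mul _ (evInf_ne_zero _ a), hilbert_neg_mul _ (evFin_ne_zero _ a)]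

theorem hil_inv (a b : 𝔸[F]ˣ) : hil a b⁻¹ = hil a b := by
  rw [← hil_mul_sq a b⁻¹ b, pow_two, inv_mul_cancel_left]

/-- If the symbol `∏_v [a_v, b_v]_v` is a `2`-cocycle, then it is multiplicative with respect to
the sign of one of its arguments. -/
theorem hil_neg_of_cocycle
    (hc : ∀ a b d : 𝔸[F]ˣ, hil a b * hil (a * b) d = hil a (b * d) * hil b d) (a b : 𝔸[F]ˣ) :
    hil a (-b) = hil a (-1) * hil a b := by
  have h1 : hil a (a * b) = hil a (-b) := by
    have := hil_neg_mul a (-b)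
    rwa [mul_neg, neg_neg] at this
  have h2 : hil a a = hil a (-1) := by
    have := hil_neg_mul a (-1)
    rwa [mul_neg, mul_one, neg_neg] at this
  have h3 := hc a a b
  rw [← pow_two, hil_comm (a ^ 2) b, hil_sq, mul_one, h1, h2] at h3
  rw [h3, mul_assoc, ← pow_two, Int.units_sq, mul_one]

/-! ### The cocycle on matrices with invertible bottom rows -/

/-- The idele `l` has components `ℓ(g_v)`, for all places `v`. -/
structure HasEll (g : GL (Fin 2) 𝔸[F]) (l : 𝔸[F]ˣ) : Prop where
  inf : ∀ v : InfinitePlace F, ell (gInf v g) = evInf v (l : 𝔸[F])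
  fin : ∀ v : FinPl F, ell (gFin v g) = evFin v (l : 𝔸[F])

/-- The product of the signs `s_v(g_v)` over all finite places `v`. -/
def sAdele (g : GL (Fin 2) 𝔸[F]) : ℤˣ := ∏ᶠ v : FinPl F, sLocal v (gFin v g)

theorem HasEll.finite_sLocal {g : GL (Fin 2) 𝔸[F]} {l : 𝔸[F]ˣ} (h : HasEll g l) :
    {v : FinPl F | sLocal v (gFin v g) ≠ 1}.Finite := by
  refine (idele_finite_valued_ne_one l).subset fun v hv h1 => hv ?_
  rw [sLocal, if_neg]
  rintro ⟨hc, -, n, hn, hcn⟩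
  have : gFin v g 1 0 = evFin v (l : 𝔸[F]) := by
    rw [← h.fin v, ell, if_pos hc]
  rw [this, h1, ← WithZero.exp_zero, WithZero.exp_inj] at hcn
  simp [← hcn] at hn

theorem HasEll.of_lower {g : GL (Fin 2) 𝔸[F]} {l : 𝔸[F]ˣ} (h : g 1 0 = l) : HasEll g l where
  inf v := by
    have : gInf v g 1 0 = evInf v (l : 𝔸[F]) := congrArg (evInf v) h
    rw [ell, if_pos (by rw [this]; exact evInf_ne_zero v l), this]
  fin v := by
    have : gFin v g 1 0 = evFin v (l : 𝔸[F]) := congrArg (evFin v) h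
    rw [ell, if_pos (by rw [this]; exact evFin_ne_zero v l), this]

theorem HasEll.of_upper {g : GL (Fin 2) 𝔸[F]} {l : 𝔸[F]ˣ} (h : g 1 0 = 0) (h1 : g 1 1 = l) :
    HasEll g l where
  inf v := by
    have : gInf v g 1 0 = 0 := (congrArg (evInf v) h).trans (map_zero _)
    rw [ell, if_neg (by simp [this])]; exact congrArg (evInf v) h1
  fin v := by
    have : gFin v g 1 0 = 0 := (congrArg (evFin v) h).trans (map_zero _)
    rw [ell, if_neg (by simp [this])]; exact congrArg (evFin v) h1

theorem HasEll.of_row {g h : GL (Fin 2) 𝔸[F]} {l : 𝔸[F]ˣ} (hg : HasEll g l)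
    (h0 : h 1 0 = g 1 0) (h1 : h 1 1 = g 1 1) : HasEll h l where
  inf v := by
    rw [← hg.inf v]; exact ell_eq_of_row (congrArg (evInf v) h0) (congrArg (evInf v) h1)
  fin v := by
    rw [← hg.fin v]; exact ell_eq_of_row (congrArg (evFin v) h0) (congrArg (evFin v) h1)

theorem HasEll.of_row_smul {g h : GL (Fin 2) 𝔸[F]} {l c : 𝔸[F]ˣ} (hg : HasEll g l)
    (h0 : h 1 0 = c * g 1 0) (h1 : h 1 1 = c * g 1 1) : HasEll h (c * l) where
  inf v := by
    rw [Units.val_mul, map_mul, ← hg.inf v]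
    exact ell_of_row_smul (evInf_ne_zero v c) ((congrArg (evInf v) h0).trans (map_mul ..))
      ((congrArg (evInf v) h1).trans (map_mul ..))
  fin v := by
    rw [Units.val_mul, map_mul, ← hg.fin v]
    exact ell_of_row_smul (evFin_ne_zero v c) ((congrArg (evFin v) h0).trans (map_mul ..))
      ((congrArg (evFin v) h1).trans (map_mul ..))

/-- The determinant of an adelic matrix, as an idele. -/
abbrev detA (g : GL (Fin 2) 𝔸[F]) : 𝔸[F]ˣ := Matrix.GeneralLinearGroup.det g

theorem det_gInf (v : InfinitePlace F) (g : GL (Fin 2) 𝔸[F]) :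
    (gInf v g : Matrix (Fin 2) (Fin 2) v.Completion).det = evInf v (detA g : 𝔸[F]) :=
  (RingHom.map_det (evInf v) (g : Matrix (Fin 2) (Fin 2) 𝔸[F])).symm

theorem det_gFin (v : FinPl F) (g : GL (Fin 2) 𝔸[F]) :
    (gFin v g : Matrix (Fin 2) (Fin 2) (v.adicCompletion F)).det = evFin v (detA g : 𝔸[F]) :=
  (RingHom.map_det (evFin v) (g : Matrix (Fin 2) (Fin 2) 𝔸[F])).symm

/-- The global cocycle in terms of the ideles formed by the values of `ℓ`. The product over the
finite places may be split because each of the factors is trivial at almost all places. -/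
theorem beta_eq {g h : GL (Fin 2) 𝔸[F]} {l l' l'' : 𝔸[F]ˣ} (hg : HasEll g l) (hh : HasEll h l')
    (hgh : HasEll (g * h) l'') :
    beta g h = hil (l'' / l) (l'' / l' * detA g) * sAdele g * sAdele h * sAdele (g * h) := by
  have hinf : ∀ v : InfinitePlace F, betaInf v (gInf v g) (gInf v h) =
      hilbert (evInf v ((l'' / l : 𝔸[F]ˣ) : 𝔸[F]))
        (evInf v ((l'' / l' * detA g : 𝔸[F]ˣ) : 𝔸[F])) := by
    intro v
    have hm : gInf v g * gInf v h = gInf v (g * h) := (map_mul _ _ _).symm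
    rw [betaInf, betaCore, hm, hg.inf, hh.inf, hgh.inf, det_gInf]
    have hd : ∀ a b : 𝔸[F]ˣ, evInf v ((a / b : 𝔸[F]ˣ) : 𝔸[F]) =
        evInf v (a : 𝔸[F]) / evInf v (b : 𝔸[F]) := fun a b => by
      rw [eq_div_iff (evInf_ne_zero v b), ← map_mul, ← Units.val_mul, div_mul_cancel]
    rw [Units.val_mul, map_mul, hd, hd]
  have hfin : ∀ v : FinPl F, betaFin v (gFin v g) (gFin v h) =
      hilbert (evFin v ((l'' / l : 𝔸[F]ˣ) : 𝔸[F])) (evFin v ((l'' / l' * detA g : 𝔸[F]ˣ) : 𝔸[F])) *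
        sLocal v (gFin v g) * sLocal v (gFin v h) * sLocal v (gFin v (g * h)) := by
    intro v
    have hm : gFin v g * gFin v h = gFin v (g * h) := (map_mul _ _ _).symm
    rw [betaFin, betaCore, hm, hg.fin, hh.fin, hgh.fin, det_gFin]
    have hd : ∀ a b : 𝔸[F]ˣ, evFin v ((a / b : 𝔸[F]ˣ) : 𝔸[F]) =
        evFin v (a : 𝔸[F]) / evFin v (b : 𝔸[F]) := fun a b => by
      rw [eq_div_iff (evFin_ne_zero v b), ← map_mul, ← Units.val_mul, div_mul_cancel]
    rw [Units.val_mul, map_mul, hd, hd]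
  have f1 := finite_hilbert_ne_one (l'' / l) (l'' / l' * detA g)
  have f2 := hg.finite_sLocal
  have f3 := hh.finite_sLocal
  have f4 := hgh.finite_sLocal
  have f12 := (f1.union f2).subset (Function.mulSupport_mul _ _)
  have f123 := (f12.union f3).subset (Function.mulSupport_mul _ _)
  rw [beta, finprod_congr hfin, Finset.prod_congr rfl fun v _ => hinf v,
    finprod_mul_distrib f123 f4, finprod_mul_distrib f12 f3, finprod_mul_distrib f1 f2, hil, sAdele,
    sAdele, sAdele]
  simp only [mul_assoc]

theorem sLocal_congr {v : FinPl F} {g h : GL (Fin 2) (v.adicCompletion F)}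
    (h0 : g 1 0 = h 1 0) (h1 : g 1 1 = h 1 1)
    (hd : (g : Matrix (Fin 2) (Fin 2) (v.adicCompletion F)).det =
      (h : Matrix (Fin 2) (Fin 2) (v.adicCompletion F)).det) : sLocal v g = sLocal v h := by
  unfold sLocal; rw [h0, h1, hd]

theorem sAdele_congr {g h : GL (Fin 2) 𝔸[F]} (h0 : g 1 0 = h 1 0) (h1 : g 1 1 = h 1 1)
    (hd : detA g = detA h) : sAdele g = sAdele h := by
  refine finprod_congr fun v => sLocal_congr (congrArg (evFin v) h0) (congrArg (evFin v) h1) ?_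
  rw [det_gFin, det_gFin, hd]

theorem sLocal_of_neg_one {g : GL (Fin 2) 𝔸[F]} (h : g 1 0 = -1) (v : FinPl F) :
    sLocal v (gFin v g) = 1 := by
  have h1 : gFin v g 1 0 = -1 := (congrArg (evFin v) h).trans (by rw [map_neg, map_one])
  rw [sLocal, if_neg]
  rintro ⟨-, -, n, hn, h2⟩
  rw [h1, Valuation.map_neg, map_one, ← WithZero.exp_zero, WithZero.exp_inj] at h2
  simp [← h2] at hn

theorem sLocal_of_upper {g : GL (Fin 2) 𝔸[F]} (h : g 1 0 = 0) (v : FinPl F) :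
    sLocal v (gFin v g) = 1 := by
  have : gFin v g 1 0 = 0 := (congrArg (evFin v) h).trans (map_zero _)
  rw [sLocal, if_neg]
  simp [this]

theorem sAdele_eq_one_of_upper {g : GL (Fin 2) 𝔸[F]} (h : g 1 0 = 0) : sAdele g = 1 :=
  (finprod_congr (sLocal_of_upper h)).trans finprod_one

theorem sAdele_eq_one_of_neg_one {g : GL (Fin 2) 𝔸[F]} (h : g 1 0 = -1) : sAdele g = 1 :=
  (finprod_congr (sLocal_of_neg_one h)).trans finprod_one

theorem sAdele_eq_one_of_entry_eq_zero {g : GL (Fin 2) 𝔸[F]}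
    (h : ∀ v, gFin v g 1 0 = 0 ∨ gFin v g 1 1 = 0) : sAdele g = 1 := by
  refine (finprod_congr fun v => ?_).trans finprod_one
  rw [sLocal, if_neg]
  rintro ⟨h0, h1, -⟩
  exact (h v).elim h0 h1

/-! ### Products in the metaplectic group -/

theorem MetaGL2.mk_mul (g h : GL (Fin 2) 𝔸[F]) (ε ε' : ℤˣ) :
    (⟨g, ε⟩ * ⟨h, ε'⟩ : MetaGL2 F) = ⟨g * h, ε * ε' * beta g h⟩ := rfl

section Entries

variable {R : Type*} [CommRing R]

theorem zMat_mul_apply (y : Rˣ) (g : GL (Fin 2) R) (i j : Fin 2) :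
    (zMat y * g) i j = y * g i j := by
  fin_cases i <;> simp [zMat, Matrix.mul_apply]

theorem mul_zMat_apply (y : Rˣ) (g : GL (Fin 2) R) (i j : Fin 2) :
    (g * zMat y) i j = y * g i j := by
  fin_cases j <;> simp [zMat, Matrix.mul_apply, mul_comm]

theorem zMat_comm (y : Rˣ) (g : GL (Fin 2) R) : g * zMat y = zMat y * g := by
  ext i j; rw [mul_zMat_apply, zMat_mul_apply]

theorem nMat_mul_apply_one (x : R) (g : GL (Fin 2) R) (j : Fin 2) :
    (nMat x * g) 1 j = g 1 j := by
  simp [nMat, Matrix.mul_apply]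

theorem aMat_mul_apply_one (y : Rˣ) (g : GL (Fin 2) R) (j : Fin 2) :
    (aMat y * g) 1 j = g 1 j := by
  simp [aMat, Matrix.mul_apply]

theorem nMat_mul_nMat (x y : R) : nMat x * nMat y = nMat (x + y) := by
  ext i j
  fin_cases i <;> fin_cases j <;> simp [nMat, Matrix.mul_apply, add_comm]

theorem nMat_zero : nMat (0 : R) = 1 := by
  ext i j
  fin_cases i <;> fin_cases j <;> simp [nMat]

theorem aMat_mul_aMat (x y : Rˣ) : aMat x * aMat y = aMat (x * y) := by
  ext i j
  fin_cases i <;> fin_cases j <;> simp [aMat, Matrix.mul_apply]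

theorem aMat_one : aMat (1 : Rˣ) = 1 := by
  ext i j
  fin_cases i <;> fin_cases j <;> simp [aMat]

theorem aMat_inv (x : Rˣ) : (aMat x)⁻¹ = aMat x⁻¹ := by
  rw [inv_eq_iff_mul_eq_one, aMat_mul_aMat, mul_inv_cancel, aMat_one]

theorem zMat_one : zMat (1 : Rˣ) = 1 := by
  ext i j
  fin_cases i <;> fin_cases j <;> simp [zMat]

theorem aMat_mul_nMat (y : Rˣ) (x : R) : aMat y * nMat x = nMat (y * x) * aMat y := by
  ext i j
  fin_cases i <;> fin_cases j <;> simp [aMat, nMat, Matrix.mul_apply]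

end Entries

theorem detA_zMat (y : 𝔸[F]ˣ) : detA (zMat y) = y ^ 2 := by
  ext1; simp [zMat, pow_two]

theorem detA_nMat (x : 𝔸[F]) : detA (nMat x) = 1 := by
  ext1; simp [nMat]

theorem detA_aMat (y : 𝔸[F]ˣ) : detA (aMat y) = y := by
  ext1; simp [aMat]

theorem detA_mul (g h : GL (Fin 2) 𝔸[F]) : detA (g * h) = detA g * detA h := map_mul _ _ _

theorem hasEll_zMat (y : 𝔸[F]ˣ) : HasEll (zMat y) y :=
  .of_upper (by simp [zMat]) (by simp [zMat])

theorem hasEll_nMat (x : 𝔸[F]) : HasEll (nMat x) 1 :=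
  .of_upper (by simp [nMat]) (by simp [nMat])

theorem hasEll_aMat (y : 𝔸[F]ˣ) : HasEll (aMat y) 1 :=
  .of_upper (by simp [aMat]) (by simp [aMat])

theorem sAdele_zMat (y : 𝔸[F]ˣ) : sAdele (zMat y) = 1 := sAdele_eq_one_of_upper (by simp [zMat])

theorem sAdele_nMat (x : 𝔸[F]) : sAdele (nMat x) = 1 := sAdele_eq_one_of_upper (by simp [nMat])

theorem sAdele_aMat (y : 𝔸[F]ˣ) : sAdele (aMat y) = 1 := sAdele_eq_one_of_upper (by simp [aMat])

theorem HasEll.zMat_mul {g : GL (Fin 2) 𝔸[F]} {l : 𝔸[F]ˣ} (h : HasEll g l) (y : 𝔸[F]ˣ) :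
    HasEll (zMat y * g) (y * l) :=
  h.of_row_smul (zMat_mul_apply y g 1 0) (zMat_mul_apply y g 1 1)

theorem HasEll.nMat_mul {g : GL (Fin 2) 𝔸[F]} {l : 𝔸[F]ˣ} (h : HasEll g l) (x : 𝔸[F]) :
    HasEll (nMat x * g) l :=
  h.of_row (nMat_mul_apply_one x g 0) (nMat_mul_apply_one x g 1)

theorem HasEll.aMat_mul {g : GL (Fin 2) 𝔸[F]} {l : 𝔸[F]ˣ} (h : HasEll g l) (y : 𝔸[F]ˣ) :
    HasEll (aMat y * g) l :=
  h.of_row (aMat_mul_apply_one y g 0) (aMat_mul_apply_one y g 1)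

theorem sAdele_nMat_mul (x : 𝔸[F]) (g : GL (Fin 2) 𝔸[F]) : sAdele (nMat x * g) = sAdele g :=
  sAdele_congr (nMat_mul_apply_one x g 0) (nMat_mul_apply_one x g 1)
    (by rw [detA_mul, detA_nMat, one_mul])

theorem units_mul_self_cancel (a b : ℤˣ) : a * (a * b) = b := by
  rw [← mul_assoc, ← pow_two, Int.units_sq, one_mul]

theorem beta_zMat_left {g : GL (Fin 2) 𝔸[F]} {l : 𝔸[F]ˣ} (h : HasEll g l) (y : 𝔸[F]ˣ) :
    beta (zMat y) g = hil l y * sAdele g * sAdele (zMat y * g) := by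
  rw [beta_eq (hasEll_zMat y) h (h.zMat_mul y), sAdele_zMat, mul_one, detA_zMat,
    mul_div_cancel_left,
    mul_div_cancel_right, hil_mul_sq]

theorem beta_nMat_left {g : GL (Fin 2) 𝔸[F]} {l : 𝔸[F]ˣ} (h : HasEll g l) (x : 𝔸[F]) :
    beta (nMat x) g = 1 := by
  rw [beta_eq (hasEll_nMat x) h (h.nMat_mul x), sAdele_nMat, mul_one, detA_nMat, div_self', one_mul,
    hil_comm, hil_one_left, sAdele_nMat_mul, one_mul, ← pow_two, Int.units_sq]

theorem beta_aMat_left {g : GL (Fin 2) 𝔸[F]} {l : 𝔸[F]ˣ} (h : HasEll g l) (y : 𝔸[F]ˣ) :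
    beta (aMat y) g = hil l y * sAdele g * sAdele (aMat y * g) := by
  rw [beta_eq (hasEll_aMat y) h (h.aMat_mul y), sAdele_aMat, mul_one, detA_aMat, div_self', one_mul,
    div_one]

theorem beta_zMat_right {g : GL (Fin 2) 𝔸[F]} {l : 𝔸[F]ˣ} (h : HasEll g l) (y : 𝔸[F]ˣ) :
    beta g (zMat y) = hil y (l * detA g) * sAdele g * sAdele (zMat y * g) := by
  rw [beta_eq h (hasEll_zMat y) (by rw [zMat_comm]; exact h.zMat_mul y), sAdele_zMat, mul_one,
    zMat_comm, mul_div_cancel_left, mul_div_cancel_right]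

theorem beta_one_right (g : GL (Fin 2) 𝔸[F]) : beta g 1 = 1 := by
  have h1 : ∀ {K : Type _} [Field K] (x : GL (Fin 2) K), betaCore x 1 = 1 := fun x => by
    rw [betaCore, mul_one, div_self (ell_ne_zero x), hilbert_one_left]
  rw [beta, Finset.prod_eq_one, finprod_eq_one_of_forall_eq_one, one_mul]
  · intro v
    have hs : sLocal v (gFin v (1 : GL (Fin 2) 𝔸[F])) = 1 := by
      rw [sLocal, if_neg]; simp [gFin]
    have hm : gFin v (1 : GL (Fin 2) 𝔸[F]) = 1 := map_one _
    rw [betaFin, hs, hm, h1, mul_one, one_mul, mul_one, ← pow_two, Int.units_sq]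
  · intro v _
    have hm : gInf v (1 : GL (Fin 2) 𝔸[F]) = 1 := map_one _
    rw [betaInf, hm, h1]

/-- Multiplication on the right by a matrix `k` that keeps the bottom row and the determinant. The
sign only depends on `k`. -/
theorem beta_of_row_fixed {g k : GL (Fin 2) 𝔸[F]} (h0 : (g * k) 1 0 = g 1 0)
    (h1 : (g * k) 1 1 = g 1 1) (hd : detA k = 1) : beta g k = sAdele k := by
  have hd' : detA (g * k) = detA g := by rw [detA_mul, hd, mul_one]
  rw [beta, Finset.prod_eq_one, one_mul, sAdele]
  · refine finprod_congr fun v => ?_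
    have hm : gFin v g * gFin v k = gFin v (g * k) := (map_mul _ _ _).symm
    have hl : ell (gFin v (g * k)) = ell (gFin v g) :=
      ell_eq_of_row (congrArg (evFin v) h0) (congrArg (evFin v) h1)
    have hs : sLocal v (gFin v (g * k)) = sLocal v (gFin v g) :=
      sLocal_congr (congrArg (evFin v) h0) (congrArg (evFin v) h1)
        (by rw [det_gFin, det_gFin, hd'])
    rw [betaFin, betaCore, hm, hl, hs, div_self (ell_ne_zero _), hilbert_one_left, one_mul,
      mul_comm, units_mul_self_cancel]
  · intro v _
    have hm : gInf v g * gInf v k = gInf v (g * k) := (map_mul _ _ _).symm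
    have hl : ell (gInf v (g * k)) = ell (gInf v g) :=
      ell_eq_of_row (congrArg (evInf v) h0) (congrArg (evInf v) h1)
    rw [betaInf, betaCore, hm, hl, div_self (ell_ne_zero _), hilbert_one_left]

/-! ### Rational elements -/

theorem diag_zMat (q : Fˣ) : diag (zMat q) = zMat (principal q) := by
  ext i j; fin_cases i <;> fin_cases j <;> simp [diag, zMat, principal]

theorem diag_aMat (q : Fˣ) : diag (aMat q) = aMat (principal q) := by
  ext i j; fin_cases i <;> fin_cases j <;> simp [diag, aMat, principal]

theorem diag_nMat (q : F) : diag (nMat q) = nMat (algebraMap F 𝔸[F] q) := by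
  ext i j; fin_cases i <;> fin_cases j <;> simp [diag, nMat]

theorem diag_wMat : diag (wMat F) = wMat 𝔸[F] := by
  ext i j; fin_cases i <;> fin_cases j <;> simp [diag, wMat]

theorem varsigma_eq (γ : GL (Fin 2) F) : varsigma γ = ⟨diag γ, sAdele (diag γ)⟩ := rfl

theorem varsigma_zMat (q : Fˣ) : varsigma (zMat q) = gstar (zMat (principal q)) := by
  rw [varsigma_eq, diag_zMat, sAdele_zMat, gstar]

theorem varsigma_aMat (q : Fˣ) : varsigma (aMat q) = gstar (aMat (principal q)) := by
  rw [varsigma_eq, diag_aMat, sAdele_aMat, gstar]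

theorem varsigma_nMat (q : F) : varsigma (nMat q) = gstar (nMat (algebraMap F 𝔸[F] q)) := by
  rw [varsigma_eq, diag_nMat, sAdele_nMat, gstar]

theorem varsigma_wMat : varsigma (wMat F) = gstar (wMat 𝔸[F]) := by
  rw [varsigma_eq, diag_wMat, sAdele_eq_one_of_neg_one (by simp [wMat]), gstar]

theorem principal_inv (q : Fˣ) : principal q⁻¹ = (principal q)⁻¹ := map_inv _ _

theorem principal_one : principal (1 : Fˣ) = 1 := map_one _

/-! ### Genuine characters of the preimage of the centre -/

/-- The sign `±1` as a unit of `ℂ`. -/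
abbrev sgnC : ℤˣ →* ℂˣ := Units.map (Int.castRingHom ℂ).toMonoidHom

theorem coe_sgnC (ε : ℤˣ) : ((sgnC ε : ℂˣ) : ℂ) = ((ε : ℤ) : ℂ) := rfl

theorem sgnC_injective : Function.Injective sgnC := fun a b h => by
  have := congrArg Units.val h
  rw [coe_sgnC, coe_sgnC] at this
  exact Units.ext (by exact_mod_cast this)

theorem sgn_mul_self (ε : ℤˣ) : ((ε : ℤ) : ℂ) * ((ε : ℤ) : ℂ) = 1 := by
  rw [← Int.cast_mul, ← Units.val_mul, Int.units_mul_self, Units.val_one, Int.cast_one]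

theorem zEl_mul_zEl (a b : 𝔸[F]ˣ) (ε ε' : ℤˣ) :
    zEl a ε * zEl b ε' = zEl (a * b) (ε * ε' * hil a b) := by
  refine Subtype.ext ?_
  change (⟨zMat a, ε⟩ * ⟨zMat b, ε'⟩ : MetaGL2 F) = ⟨zMat (a * b), _⟩
  rw [MetaGL2.mk_mul, zMat_mul, beta_zMat_left (hasEll_zMat b), zMat_mul, sAdele_zMat, sAdele_zMat,
    mul_one, mul_one, hil_comm]

theorem GenuineChar.apply_zEl (μ : GenuineChar F) (a : 𝔸[F]ˣ) (ε : ℤˣ) :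
    μ.toFun (zEl a ε) = sgnC ε * μ.toFun (zStar a) := by
  rw [← μ.genuine', zStar, zEl_mul_zEl, mul_one, one_mul, hil_comm, hil_one_left, mul_one]

theorem GenuineChar.map_zStar_mul (μ : GenuineChar F) (a b : 𝔸[F]ˣ) :
    μ.toFun (zStar (a * b)) = sgnC (hil a b) * (μ.toFun (zStar a) * μ.toFun (zStar b)) := by
  have h : zStar a * zStar b = zEl (a * b) (hil a b) := by
    simp only [zStar, zEl_mul_zEl, one_mul]
  rw [← μ.map_mul', h, μ.apply_zEl, ← mul_assoc, ← map_mul, Int.units_mul_self, map_one, one_mul]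

/-- The existence of a genuine character forces the product of Hilbert symbols to be a
`2`-cocycle on the ideles. -/
theorem GenuineChar.hil_cocycle (μ : GenuineChar F) (a b d : 𝔸[F]ˣ) :
    hil a b * hil (a * b) d = hil a (b * d) * hil b d := by
  have h1 := μ.map_zStar_mul (a * b) d
  have h2 := μ.map_zStar_mul a (b * d)
  rw [μ.map_zStar_mul a b] at h1
  rw [μ.map_zStar_mul b d, ← mul_assoc a b d, h1] at h2
  apply sgnC_injective
  have h3 : sgnC (hil (a * b) d) * sgnC (hil a b) *
      (μ.toFun (zStar a) * μ.toFun (zStar b) * μ.toFun (zStar d)) =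
      sgnC (hil a (b * d)) * sgnC (hil b d) *
      (μ.toFun (zStar a) * μ.toFun (zStar b) * μ.toFun (zStar d)) := by
    convert h2 using 1
    · simp only [mul_assoc]
    · simp only [mul_assoc, mul_left_comm]
  rw [map_mul, map_mul, mul_comm]
  exact mul_right_cancel h3

theorem twist_zStar (μ : GenuineChar F) (ξ : Fˣ) (y : 𝔸[F]ˣ) :
    twist μ.toFun ξ (zStar y) = sgnC (hil y (principal ξ)) * μ.toFun (zStar y) := by
  rw [← μ.apply_zEl]
  unfold twist
  congr 1
  refine Subtype.ext ?_
  change (⟨_, _⟩ * ⟨_, _⟩ * ⟨_, _⟩ : MetaGL2 F) = ⟨zMat y, _⟩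
  have h1 : HasEll (aMat (principal ξ)⁻¹ * zMat y) y := (hasEll_zMat y).aMat_mul _
  have e : aMat (principal ξ)⁻¹ * zMat y * aMat (principal ξ) = zMat y := by
    rw [mul_assoc, ← zMat_comm, ← mul_assoc, aMat_mul_aMat, inv_mul_cancel, aMat_one, one_mul]
  have hb : beta (aMat (principal ξ)⁻¹ * zMat y) (aMat (principal ξ)) = 1 := by
    rw [beta_eq h1 (hasEll_aMat _) (e ▸ hasEll_zMat y), div_self', hil_one_left, e, sAdele_zMat,
      sAdele_aMat, sAdele_eq_one_of_upper (by rw [aMat_mul_apply_one]; simp [zMat])]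
    rfl
  rw [aMat_inv, MetaGL2.mk_mul, MetaGL2.mk_mul, beta_aMat_left (hasEll_zMat y), hb, e, sAdele_zMat,
    sAdele_eq_one_of_upper (by rw [aMat_mul_apply_one]; simp [zMat]), hil_inv]
  simp

/-! ### Translates of an automorphic form along the torus and the unipotent group -/

/-- A matrix of determinant `1` whose bottom row is `(0, 1)` (with `e = 1`) or `(-1, *)`
(with `e = -1`). -/
structure IsBase (g₀ : GL (Fin 2) 𝔸[F]) (e : 𝔸[F]ˣ) : Prop where
  det : detA g₀ = 1
  row : (e = 1 ∧ g₀ 1 0 = 0 ∧ g₀ 1 1 = 1) ∨ (e = -1 ∧ g₀ 1 0 = -1)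

theorem IsBase.hasEll {g₀ : GL (Fin 2) 𝔸[F]} {e : 𝔸[F]ˣ} (h : IsBase g₀ e) : HasEll g₀ e := by
  rcases h.row with ⟨rfl, h0, h1⟩ | ⟨rfl, h0⟩
  · exact .of_upper h0 h1
  · exact .of_lower h0

theorem IsBase.sAdele_of_row {g₀ g : GL (Fin 2) 𝔸[F]} {e : 𝔸[F]ˣ} (h : IsBase g₀ e)
    (hg : g 1 0 = g₀ 1 0) : sAdele g = 1 := by
  rcases h.row with ⟨-, h0, h1⟩ | ⟨-, h0⟩
  · exact sAdele_eq_one_of_upper (hg.trans h0)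
  · exact sAdele_eq_one_of_neg_one (hg.trans h0)

theorem IsBase.sAdele {g₀ : GL (Fin 2) 𝔸[F]} {e : 𝔸[F]ˣ} (h : IsBase g₀ e) : sAdele g₀ = 1 :=
  h.sAdele_of_row rfl

/-- The element `z(y)^* n(x)^* g₀^*`. -/
def elt (g₀ : GL (Fin 2) 𝔸[F]) (y : 𝔸[F]ˣ) (x : 𝔸[F]) : MetaGL2 F :=
  (zStar y).1 * gstar (nMat x) * gstar g₀

theorem zStar_mul_nMat (y : 𝔸[F]ˣ) (x : 𝔸[F]) :
    (zStar y).1 * gstar (nMat x) = gstar (zMat y * nMat x) := by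
  change (⟨zMat y, 1⟩ * ⟨nMat x, 1⟩ : MetaGL2 F) = ⟨_, 1⟩
  rw [MetaGL2.mk_mul, beta_zMat_left (hasEll_nMat x), hil_one_left, sAdele_nMat,
    sAdele_eq_one_of_upper (by rw [zMat_mul_apply]; simp [nMat])]
  simp

theorem hasEll_zMat_mul_nMat (y : 𝔸[F]ˣ) (x : 𝔸[F]) : HasEll (zMat y * nMat x) y := by
  simpa using (hasEll_nMat x).zMat_mul y

/-- The product of `z(y)^* n(x)^*` and `g^*`. -/
theorem zStar_mul_nMat_mul {g : GL (Fin 2) 𝔸[F]} {l : 𝔸[F]ˣ} (h : HasEll g l) (hs : sAdele g = 1)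
    (y : 𝔸[F]ˣ) (x : 𝔸[F]) : (zStar y).1 * gstar (nMat x) * gstar g =
      ⟨zMat y * nMat x * g, hil l y * sAdele (zMat y * nMat x * g)⟩ := by
  rw [zStar_mul_nMat, gstar, gstar, MetaGL2.mk_mul]
  have h1 : HasEll (zMat y * nMat x * g) (y * l) := by
    rw [mul_assoc]; exact (h.nMat_mul x).zMat_mul y
  rw [beta_eq (hasEll_zMat_mul_nMat y x) h h1, hs, mul_div_cancel_left, mul_div_cancel_right,
    sAdele_eq_one_of_upper (g := zMat y * nMat x) (by rw [zMat_mul_apply]; simp [nMat]), detA_mul,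
    detA_zMat, detA_nMat, mul_one (y ^ 2), mul_one, mul_one, mul_one, hil_mul_sq, one_mul]

section Base

variable {g₀ : GL (Fin 2) 𝔸[F]} {e : 𝔸[F]ˣ} (hb : IsBase g₀ e)

include hb

theorem IsBase.hasEll_mul (y : 𝔸[F]ˣ) (x : 𝔸[F]) : HasEll (zMat y * nMat x * g₀) (y * e) := by
  rw [mul_assoc]; exact (hb.hasEll.nMat_mul x).zMat_mul y

theorem IsBase.elt_eq (y : 𝔸[F]ˣ) (x : 𝔸[F]) :
    elt g₀ y x = ⟨zMat y * nMat x * g₀, hil e y * Metaplectic.sAdele (zMat y * nMat x * g₀)⟩ :=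
  zStar_mul_nMat_mul hb.hasEll hb.sAdele y x

theorem IsBase.detA_mul (y : 𝔸[F]ˣ) (x : 𝔸[F]) : detA (zMat y * nMat x * g₀) = y ^ 2 := by
  rw [Metaplectic.detA_mul, Metaplectic.detA_mul, detA_zMat, detA_nMat, hb.det, mul_one, mul_one]

/-- The element `z(y)^* n(x)^* g₀^*` for `y = 1`. -/
theorem IsBase.elt_one (x : 𝔸[F]) : elt g₀ 1 x = gstar (nMat x) * gstar g₀ := by
  rw [hb.elt_eq, gstar, gstar, MetaGL2.mk_mul, beta_nMat_left hb.hasEll, zMat_one, one_mul,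
    sAdele_nMat_mul, hb.sAdele, hil_comm, hil_one_left]
  simp

theorem IsBase.elt_eq_nMat_mul (y : 𝔸[F]ˣ) (x : 𝔸[F]) :
    elt g₀ y x = gstar (nMat x) * ((zStar y).1 * gstar g₀) := by
  have h1 : (zStar y).1 * gstar g₀ = ⟨zMat y * g₀, hil e y * Metaplectic.sAdele (zMat y * g₀)⟩ := by
    change (⟨zMat y, 1⟩ * ⟨g₀, 1⟩ : MetaGL2 F) = _
    rw [MetaGL2.mk_mul, beta_zMat_left hb.hasEll, hb.sAdele]
    simp
  have h2 : zMat y * nMat x * g₀ = nMat x * (zMat y * g₀) := by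
    rw [← zMat_comm, mul_assoc]
  rw [h1, hb.elt_eq, gstar, MetaGL2.mk_mul, beta_nMat_left (hb.hasEll.zMat_mul y), h2,
    sAdele_nMat_mul]
  simp

theorem IsBase.nMat_mul_elt (y : 𝔸[F]ˣ) (x q : 𝔸[F]) :
    gstar (nMat q) * elt g₀ y x = elt g₀ y (q + x) := by
  have h2 : nMat q * (zMat y * nMat x * g₀) = zMat y * nMat (q + x) * g₀ := by
    rw [← nMat_mul_nMat, ← mul_assoc, ← mul_assoc, ← mul_assoc, zMat_comm]
  have h3 : Metaplectic.sAdele (zMat y * nMat (q + x) * g₀) =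
      Metaplectic.sAdele (zMat y * nMat x * g₀) := by rw [← h2, sAdele_nMat_mul]
  rw [hb.elt_eq, hb.elt_eq, gstar, MetaGL2.mk_mul, beta_nMat_left (hb.hasEll_mul y x), h2, h3]
  simp

/-- The sign by which right translation by `z(t)^*` differs from a change of the parameter `y`. -/
theorem IsBase.elt_mul_zStar
    (hc : ∀ a b d : 𝔸[F]ˣ, hil a b * hil (a * b) d = hil a (b * d) * hil b d)
    (t y : 𝔸[F]ˣ) (x : 𝔸[F]) :
    elt g₀ y x * (zStar t).1 = ⟨(elt g₀ (y * t) x).mat, hil y t * (elt g₀ (y * t) x).sgn⟩ := by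
  have h2 : zMat t * (zMat y * nMat x * g₀) = zMat (y * t) * nMat x * g₀ := by
    rw [mul_comm y t, ← zMat_mul, ← mul_assoc, ← mul_assoc]
  change elt g₀ y x * ⟨zMat t, 1⟩ = _
  rw [hb.elt_eq, hb.elt_eq, MetaGL2.mk_mul, beta_zMat_right (hb.hasEll_mul y x), zMat_comm, h2,
    hb.detA_mul, hil_mul_sq]
  congr 1
  have := hc e y t
  rw [hil_comm t, mul_comm y e]
  generalize Metaplectic.sAdele (zMat y * nMat x * g₀) = s
  generalize Metaplectic.sAdele (zMat (y * t) * nMat x * g₀) = s'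
  calc hil e y * s * 1 * (hil (e * y) t * s * s') = (hil e y * hil (e * y) t) * (s * s) * s' := by
        simp only [mul_one, mul_assoc, mul_left_comm, mul_comm]
    _ = _ := by
        rw [this, Int.units_mul_self, mul_one, mul_comm (hil e (y * t)), mul_assoc]

theorem IsBase.zStar_mul_elt
    (hc : ∀ a b d : 𝔸[F]ˣ, hil a b * hil (a * b) d = hil a (b * d) * hil b d)
    (t y : 𝔸[F]ˣ) (x : 𝔸[F]) :
    gstar (zMat t) * elt g₀ y x =
      ⟨(elt g₀ (y * t) x).mat, hil y t * (elt g₀ (y * t) x).sgn⟩ := by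
  have h2 : zMat t * (zMat y * nMat x * g₀) = zMat (y * t) * nMat x * g₀ := by
    rw [mul_comm y t, ← zMat_mul, ← mul_assoc, ← mul_assoc]
  rw [hb.elt_eq, hb.elt_eq, gstar, MetaGL2.mk_mul, beta_zMat_left (hb.hasEll_mul y x), h2]
  congr 1
  have := hc e y t
  rw [mul_comm y e]
  generalize Metaplectic.sAdele (zMat y * nMat x * g₀) = s
  generalize Metaplectic.sAdele (zMat (y * t) * nMat x * g₀) = s'
  calc 1 * (hil e y * s) * (hil (e * y) t * s * s') =
        (hil e y * hil (e * y) t) * (s * s) * s' := by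
        rw [one_mul]; simp only [mul_assoc, mul_left_comm, mul_comm]
    _ = _ := by
        rw [this, Int.units_mul_self, mul_one, mul_comm (hil e (y * t)), mul_assoc]

/-- Right translation by the conjugate `g₀⁻¹ n(u) g₀`. The sign only depends on `u`. -/
theorem IsBase.elt_mul_conj (y : 𝔸[F]ˣ) (x u : 𝔸[F]) :
    elt g₀ y x * gstar (g₀⁻¹ * nMat u * g₀) = ⟨(elt g₀ y (x + u)).mat,
      (elt g₀ y (x + u)).sgn * Metaplectic.sAdele (g₀⁻¹ * nMat u * g₀)⟩ := by
  have h1 : ∀ x, zMat y * nMat x * g₀ = nMat x * (zMat y * g₀) := fun x => by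
    rw [← zMat_comm, mul_assoc]
  have h2 : zMat y * nMat x * g₀ * (g₀⁻¹ * nMat u * g₀) = zMat y * nMat (x + u) * g₀ := by
    rw [← nMat_mul_nMat]; group
  have h3 : ∀ j, (zMat y * nMat (x + u) * g₀) 1 j = (zMat y * nMat x * g₀) 1 j := fun j => by
    rw [h1, h1, nMat_mul_apply_one, nMat_mul_apply_one]
  have hd : detA (g₀⁻¹ * nMat u * g₀) = 1 := by
    rw [Metaplectic.detA_mul, Metaplectic.detA_mul, detA_nMat, mul_one, ← Metaplectic.detA_mul,
      inv_mul_cancel]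
    exact map_one _
  have hs : Metaplectic.sAdele (zMat y * nMat (x + u) * g₀) =
      Metaplectic.sAdele (zMat y * nMat x * g₀) :=
    sAdele_congr (h3 0) (h3 1) (by rw [hb.detA_mul, hb.detA_mul])
  rw [hb.elt_eq, hb.elt_eq, gstar, MetaGL2.mk_mul,
    beta_of_row_fixed (by rw [h2, h3]) (by rw [h2, h3]) hd, h2, hs, mul_one]

/-- The effect of `a(ξ)` with `ξ ∈ F^×` on the left. -/
theorem IsBase.aMat_inv_mul
    (hc : ∀ a b d : 𝔸[F]ˣ, hil a b * hil (a * b) d = hil a (b * d) * hil b d)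
    (t y : 𝔸[F]ˣ) (x : 𝔸[F]) :
    gstar (aMat t⁻¹) * ((zStar y).1 * gstar (nMat ((t : 𝔸[F]) * x)) * (gstar (aMat t) * gstar g₀)) =
      ⟨(elt g₀ y x).mat, hil y t * (elt g₀ y x).sgn⟩ := by
  have ha : HasEll (aMat t * g₀) e := hb.hasEll.aMat_mul t
  have hsa : Metaplectic.sAdele (aMat t * g₀) = 1 := hb.sAdele_of_row (aMat_mul_apply_one t g₀ 0)
  have h1 : gstar (aMat t) * gstar g₀ = ⟨aMat t * g₀, hil e t⟩ := by
    rw [gstar, gstar, MetaGL2.mk_mul, beta_aMat_left hb.hasEll, hsa, hb.sAdele]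
    simp
  have h2 := zStar_mul_nMat_mul ha hsa y ((t : 𝔸[F]) * x)
  have h3 : (zStar y).1 * gstar (nMat ((t : 𝔸[F]) * x)) * ⟨aMat t * g₀, hil e t⟩ =
      ⟨zMat y * nMat ((t : 𝔸[F]) * x) * (aMat t * g₀), hil e t *
        (hil e y * Metaplectic.sAdele (zMat y * nMat ((t : 𝔸[F]) * x) * (aMat t * g₀)))⟩ := by
    rw [zStar_mul_nMat, gstar, gstar, MetaGL2.mk_mul, MetaGL2.mk.injEq] at h2
    rw [zStar_mul_nMat, gstar, MetaGL2.mk_mul, ← h2.2]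
    simp
  have h4 : aMat t⁻¹ * (zMat y * nMat ((t : 𝔸[F]) * x) * (aMat t * g₀)) = zMat y * nMat x * g₀ := by
    have : zMat y * nMat ((t : 𝔸[F]) * x) * (aMat t * g₀) = aMat t * (zMat y * nMat x * g₀) := by
      rw [← mul_assoc, mul_assoc (zMat y), ← aMat_mul_nMat, ← mul_assoc, ← zMat_comm]
      simp only [mul_assoc]
    rw [this, ← mul_assoc, aMat_mul_aMat, inv_mul_cancel, aMat_one, one_mul]
  have h5 : HasEll (zMat y * nMat ((t : 𝔸[F]) * x) * (aMat t * g₀)) (y * e) := by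
    rw [mul_assoc]; exact (ha.nMat_mul _).zMat_mul y
  have he : hil t (e * y) = hil t e * hil t y := by
    rcases hb.row with ⟨rfl, -, -⟩ | ⟨rfl, -⟩
    · rw [one_mul, hil_comm t 1, hil_one_left, one_mul]
    · rw [neg_one_mul, hil_neg_of_cocycle hc]
  rw [h1, h3, hb.elt_eq, gstar, MetaGL2.mk_mul, beta_aMat_left h5, h4, hil_inv]
  congr 1
  rw [mul_comm y e, hil_comm (e * y), he, hil_comm e t, hil_comm y t]
  generalize Metaplectic.sAdele (zMat y * nMat ((t : 𝔸[F]) * x) * (aMat t * g₀)) = s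
  generalize Metaplectic.sAdele (zMat y * nMat x * g₀) = s'
  calc 1 * (hil t e * (hil e y * s)) * (hil t e * hil t y * s * s') =
        (hil t e * hil t e) * (s * s) * (hil t y * (hil e y * s')) := by
        rw [one_mul]; simp only [mul_assoc, mul_left_comm, mul_comm]
    _ = _ := by rw [Int.units_mul_self, Int.units_mul_self, one_mul, one_mul]

end Base

/-! ### Consequences of genuineness and automorphy -/

section Forms

variable {φ : MetaGL2 F → ℂ} (hφ : IsGenuineCuspForm φ)

include hφ

theorem IsGenuineCuspForm.map_sign (g : MetaGL2 F) (ε : ℤˣ) :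
    φ ⟨g.mat, ε * g.sgn⟩ = ((ε : ℤ) : ℂ) * φ g := by
  rw [← hφ.genuine g ε, ofSign]
  obtain ⟨g, δ⟩ := g
  rw [MetaGL2.mk_mul, beta_one_right, mul_one, mul_one, mul_comm]

theorem IsGenuineCuspForm.map_sign' (g : MetaGL2 F) (ε : ℤˣ) :
    φ ⟨g.mat, g.sgn * ε⟩ = ((ε : ℤ) : ℂ) * φ g := by
  rw [mul_comm, hφ.map_sign]

variable {g₀ : GL (Fin 2) 𝔸[F]} {e : 𝔸[F]ˣ} (hb : IsBase g₀ e)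

include hb

theorem IsGenuineCuspForm.elt_add_rational (y : 𝔸[F]ˣ) (x : 𝔸[F]) (q : F) :
    φ (elt g₀ y (x + algebraMap F 𝔸[F] q)) = φ (elt g₀ y x) := by
  rw [add_comm, ← hb.nMat_mul_elt, ← varsigma_nMat, hφ.automorphic]

theorem IsGenuineCuspForm.elt_mul_rational
    (hc : ∀ a b d : 𝔸[F]ˣ, hil a b * hil (a * b) d = hil a (b * d) * hil b d)
    (y : 𝔸[F]ˣ) (x : 𝔸[F]) (q : Fˣ) :
    φ (elt g₀ (y * principal q) x) = ((hil y (principal q) : ℤˣ) : ℤ) * φ (elt g₀ y x) := by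
  have h := hφ.automorphic (zMat q) (elt g₀ y x)
  rw [varsigma_zMat, hb.zStar_mul_elt hc, hφ.map_sign] at h
  rw [← h, ← mul_assoc, sgn_mul_self, one_mul]

theorem IsGenuineCuspForm.elt_mul_idele
    (hc : ∀ a b d : 𝔸[F]ˣ, hil a b * hil (a * b) d = hil a (b * d) * hil b d)
    (y t : 𝔸[F]ˣ) (x : 𝔸[F]) :
    φ (elt g₀ (y * t) x) = ((hil y t : ℤˣ) : ℤ) * rightTranslate (zStar t).1 φ (elt g₀ y x) := by
  rw [rightTranslate, hb.elt_mul_zStar hc, hφ.map_sign, ← mul_assoc, sgn_mul_self, one_mul]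

theorem IsGenuineCuspForm.elt_add_adele (y : 𝔸[F]ˣ) (x u : 𝔸[F]) :
    φ (elt g₀ y (x + u)) = ((sAdele (g₀⁻¹ * nMat u * g₀) : ℤˣ) : ℤ) *
      rightTranslate (gstar (g₀⁻¹ * nMat u * g₀)) φ (elt g₀ y x) := by
  rw [rightTranslate, hb.elt_mul_conj, hφ.map_sign', ← mul_assoc, sgn_mul_self, one_mul]

/-- Left translation by `a(ξ)` with `ξ ∈ F^×` replaces `n(ξx)` by `n(x)`, at the cost of the sign by
which `μ^ξ` differs from `μ`. -/
theorem IsGenuineCuspForm.elt_aMat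
    (hc : ∀ a b d : 𝔸[F]ˣ, hil a b * hil (a * b) d = hil a (b * d) * hil b d)
    (ξ : Fˣ) (y : 𝔸[F]ˣ) (x : 𝔸[F]) :
    φ ((zStar y).1 * gstar (nMat ((principal ξ : 𝔸[F]) * x)) *
      (gstar (aMat (principal ξ)) * gstar g₀)) =
      ((hil y (principal ξ) : ℤˣ) : ℤ) * φ (elt g₀ y x) := by
  have h := hφ.automorphic (aMat ξ⁻¹) ((zStar y).1 * gstar (nMat ((principal ξ : 𝔸[F]) * x)) *
    (gstar (aMat (principal ξ)) * gstar g₀))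
  rw [varsigma_aMat, principal_inv, hb.aMat_inv_mul hc, hφ.map_sign] at h
  exact h.symm

end Forms

/-! ### The base points `1` and `w h(ζ)` -/

theorem isBase_one : IsBase (1 : GL (Fin 2) 𝔸[F]) 1 :=
  ⟨map_one _, Or.inl ⟨rfl, by simp, by simp⟩⟩

theorem hMat_val (ζ : 𝔸[F]) : (hMat ζ : Matrix (Fin 2) (Fin 2) 𝔸[F]) =
    !![1, indS ζ * ζ; -invS ζ, 1 - indS ζ] := rfl

theorem indS_mul_indS (ζ : 𝔸[F]) : indS ζ * indS ζ = indS ζ := by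
  linear_combination ζ * indS_mul_invS ζ + (1 - indS ζ) * mul_invS ζ

theorem det_hMat (ζ : 𝔸[F]) : detA (hMat ζ) = 1 := by
  ext1
  change (hMat ζ : Matrix (Fin 2) (Fin 2) 𝔸[F]).det = 1
  rw [hMat_val, Matrix.det_fin_two_of]
  linear_combination ζ * indS_mul_invS ζ + mul_invS ζ

theorem wMat_mul_hMat_val (ζ : 𝔸[F]) :
    ((wMat 𝔸[F] * hMat ζ : GL (Fin 2) 𝔸[F]) : Matrix (Fin 2) (Fin 2) 𝔸[F]) =
      !![-invS ζ, 1 - indS ζ; -1, -(indS ζ * ζ)] := by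
  rw [Units.val_mul, hMat_val]
  ext i j
  fin_cases i <;> fin_cases j <;> simp [wMat, Matrix.mul_apply]

theorem isBase_wMat_mul_hMat (ζ : 𝔸[F]) : IsBase (wMat 𝔸[F] * hMat ζ) (-1) := by
  refine ⟨?_, Or.inr ⟨rfl, by rw [wMat_mul_hMat_val]; rfl⟩⟩
  rw [detA_mul, det_hMat, mul_one]
  ext1
  simp [wMat]

theorem sAdele_hMat_local (ζ : 𝔸[F]) (v : FinPl F) :
    gFin v (hMat ζ) 1 0 = 0 ∨ gFin v (hMat ζ) 1 1 = 0 := by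
  classical
  by_cases hv : v ∈ SFin ζ
  · right
    change evFin v (1 - indS ζ) = 0
    rw [map_sub, map_one]
    have : evFin v (indS ζ) = 1 := if_pos hv
    rw [this, sub_self]
  · left
    change evFin v (-invS ζ) = 0
    rw [map_neg, neg_eq_zero]
    exact if_neg hv

/-- A product with trivial sign: the bottom rows have the same leading entry and all the
signs `s_v` are trivial. -/
theorem gstar_mul_of_hasEll {g h : GL (Fin 2) 𝔸[F]} {l : 𝔸[F]ˣ} (hg : HasEll g l)
    (hgh : HasEll (g * h) l) (sg : ∀ v, sLocal v (gFin v g) = 1)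
    (sh : ∀ v, sLocal v (gFin v h) = 1) (sgh : ∀ v, sLocal v (gFin v (g * h)) = 1) (ε : ℤˣ) :
    (⟨g, ε⟩ * gstar h : MetaGL2 F) = ⟨g * h, ε⟩ := by
  have : beta g h = 1 := by
    rw [beta, Finset.prod_eq_one, finprod_eq_one_of_forall_eq_one, one_mul]
    · intro v
      have hm : gFin v g * gFin v h = gFin v (g * h) := (map_mul _ _ _).symm
      rw [betaFin, betaCore, hm, hgh.fin, hg.fin, div_self (evFin_ne_zero v l), hilbert_one_left,
        sg, sh, sgh]
      rfl
    · intro v _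
      have hm : gInf v g * gInf v h = gInf v (g * h) := (map_mul _ _ _).symm
      rw [betaInf, betaCore, hm, hgh.inf, hg.inf, div_self (evInf_ne_zero v l), hilbert_one_left]
  rw [gstar, MetaGL2.mk_mul, this, mul_one, mul_one]

theorem sLocal_hMat (ζ : 𝔸[F]) (v : FinPl F) : sLocal v (gFin v (hMat ζ)) = 1 := by
  rw [sLocal, if_neg]
  rintro ⟨h0, h1, -⟩
  exact (sAdele_hMat_local ζ v).elim h0 h1

theorem gstar_aMat_mul_one (t : 𝔸[F]ˣ) : gstar (aMat t) * gstar 1 = gstar (aMat t) := by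
  rw [gstar, gstar, MetaGL2.mk_mul, beta_one_right]; simp

theorem gstar_aMat_mul_wMat_mul_hEl (t : 𝔸[F]ˣ) (ζ : 𝔸[F]) :
    gstar (aMat t) * varsigma (wMat F) * hEl ζ = gstar (aMat t) * gstar (wMat 𝔸[F] * hMat ζ) := by
  have hb := isBase_wMat_mul_hMat ζ
  have hw : (wMat 𝔸[F]) 1 0 = -1 := by simp [wMat]
  have hw1 : HasEll (wMat 𝔸[F]) (-1) := .of_lower (by simp [hw])
  have haw : (aMat t * wMat 𝔸[F]) 1 0 = -1 := by rw [aMat_mul_apply_one, hw]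
  have hawh : (aMat t * (wMat 𝔸[F] * hMat ζ)) 1 0 = -1 := by
    rw [aMat_mul_apply_one, wMat_mul_hMat_val]; rfl
  have e1 : gstar (aMat t) * gstar (wMat 𝔸[F]) = ⟨aMat t * wMat 𝔸[F], 1 * 1 *
      beta (aMat t) (wMat 𝔸[F])⟩ := rfl
  rw [varsigma_wMat, hEl, e1, beta_aMat_left hw1,
    gstar_mul_of_hasEll (.of_lower (l := -1) (by simp [haw]))
      (.of_lower (l := -1) (by rw [mul_assoc, hawh]; simp)) (sLocal_of_neg_one haw) (sLocal_hMat ζ)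
      (by rw [mul_assoc]; exact sLocal_of_neg_one hawh), gstar, gstar, MetaGL2.mk_mul,
    beta_aMat_left hb.hasEll, sAdele_eq_one_of_neg_one hw, sAdele_eq_one_of_neg_one haw, hb.sAdele,
    sAdele_eq_one_of_neg_one hawh, mul_assoc (aMat t)]

theorem nMat_mul_wMat_mul_hMat (ζ : 𝔸[F]) :
    nMat (-invS ζ) * (wMat 𝔸[F] * hMat ζ) = wMat 𝔸[F] * nMat (indS ζ * ζ) := by
  apply Units.ext
  rw [Units.val_mul, wMat_mul_hMat_val]
  ext i j
  fin_cases i <;> fin_cases j <;> simp [wMat, nMat, Matrix.mul_apply]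
  linear_combination indS ζ * mul_invS ζ + indS_mul_indS ζ

/-- The embedding of the finite adeles into the adeles. -/
def finEmb : FinAdele F →+ 𝔸[F] where
  toFun u := ((0 : InfiniteAdeleRing F), u)
  map_zero' := rfl
  map_add' _ _ := Prod.ext (add_zero (0 : InfiniteAdeleRing F)).symm rfl

theorem ofFin_nMat (u : FinAdele F) : ofFin (nMat u) = nMat (finEmb u) := by
  apply Units.ext
  ext i j
  fin_cases i <;> fin_cases j <;> rfl

/-- The comparison of the two base points. -/
theorem IsGenuineCuspForm.elt_wMat_mul_hMat {φ : MetaGL2 F → ℂ} (hφ : IsGenuineCuspForm φ)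
    (hN : IsNInvariant φ) (ζ : 𝔸[F]) :
    φ (elt (wMat 𝔸[F] * hMat ζ) 1 (-invS ζ)) = φ (elt 1 1 ζ) := by
  have hw : (wMat 𝔸[F]) 1 0 = -1 := by simp [wMat]
  have hwn : (wMat 𝔸[F] * nMat (indS ζ * ζ)) 1 0 = -1 := by
    simp [wMat, nMat, Matrix.mul_apply]
  have hb := isBase_wMat_mul_hMat ζ
  rw [hb.elt_one, isBase_one.elt_one]
  have h1 : gstar (nMat (-invS ζ)) * gstar (wMat 𝔸[F] * hMat ζ) =
      varsigma (wMat F) * gstar (nMat (indS ζ * ζ)) := by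
    rw [varsigma_wMat, gstar, gstar, MetaGL2.mk_mul, beta_nMat_left hb.hasEll,
      nMat_mul_wMat_mul_hMat, gstar, gstar_mul_of_hasEll (.of_lower (l := -1) (by simp [hw]))
      (.of_lower (l := -1) (by simp [hwn])) (sLocal_of_neg_one hw)
      (sLocal_of_upper (by simp [nMat])) (sLocal_of_neg_one hwn)]
    simp
  rw [h1, hφ.automorphic]
  have h2 : gstar (nMat ζ) * gstar 1 = gstar (nMat ζ) := by
    rw [gstar, gstar, MetaGL2.mk_mul, beta_one_right]; simp
  rw [h2]
  -- outside `S` the components of `ζ` vanish or are integral, so `n(ζ)` and `n(indS ζ * ζ)` differ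
  -- by an element of `N(ô)`
  have hu : ∀ v : FinPl F, (ζ - indS ζ * ζ).2 v ∈ v.adicCompletionIntegers F := by
    intro v
    change evFin v (ζ - indS ζ * ζ) ∈ v.adicCompletionIntegers F
    rw [map_sub, map_mul]
    by_cases hv : v ∈ SFin ζ
    · have : evFin v (indS ζ) = 1 := if_pos hv
      rw [this, one_mul, sub_self]; exact zero_mem _
    · have : evFin v (indS ζ) = 0 := if_neg hv
      rw [this, zero_mul, sub_zero]
      exact not_lt.1 (show ¬ 1 < Valued.v (evFin v ζ) from hv)
  have hz : finEmb (ζ - indS ζ * ζ).2 = ζ - indS ζ * ζ := by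
    refine Prod.ext (funext fun v => ?_) rfl
    change 0 = evInf v (ζ - indS ζ * ζ)
    rw [map_sub, map_mul]
    by_cases hv : v ∈ SInf ζ
    · have : evInf v (indS ζ) = 1 := if_pos hv
      rw [this, one_mul, sub_self]
    · have : evInf v ζ = 0 := not_not.1 hv
      rw [this, mul_zero, sub_zero]
  have h3 := congrFun (hN _ hu) (gstar (nMat (indS ζ * ζ)))
  have h4 : gstar (nMat (indS ζ * ζ)) * gstar (nMat (ζ - indS ζ * ζ)) = gstar (nMat ζ) := by
    rw [gstar, gstar, MetaGL2.mk_mul, beta_nMat_left (hasEll_nMat _), nMat_mul_nMat,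
      add_sub_cancel, mul_one, mul_one, gstar]
  rw [rightTranslate, ofFin_nMat, hz, h4] at h3
  exact h3.symm

/-! ### The topology of the adeles -/

open scoped Classical in
/-- There are positive integers which are arbitrarily small at finitely many places. -/
theorem exists_nat_valued_le (T : Finset (FinPl F)) (n : FinPl F → ℕ) :
    ∃ N : ℕ, 0 < N ∧ ∀ v ∈ T, Valued.v (N : v.adicCompletion F) ≤ WithZero.exp (-(n v : ℤ)) := by
  refine ⟨∏ v ∈ T, Ideal.absNorm v.asIdeal ^ n v, Finset.prod_pos fun v _ => pow_pos
    (Nat.pos_of_ne_zero fun h => v.ne_bot (Ideal.absNorm_eq_zero_iff.1 h)) _, fun v hv => ?_⟩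
  have h : ((∏ v ∈ T, Ideal.absNorm v.asIdeal ^ n v : ℕ) : 𝓞 F) ∈ v.asIdeal ^ n v := by
    rw [← Finset.mul_prod_erase _ _ hv, Nat.cast_mul, Nat.cast_pow]
    exact Ideal.mul_mem_right _ _ (Ideal.pow_mem_pow (Ideal.absNorm_mem _) _)
  have h2 := (valued_int_le_exp_iff v _ _).2 h
  convert h2 using 2
  exact (map_natCast ((algebraMap F (v.adicCompletion F)).comp (algebraMap (𝓞 F) F)) _).symm

theorem natCast_ne_zero (v : FinPl F) {N : ℕ} (hN : 0 < N) : (N : v.adicCompletion F) ≠ 0 := by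
  have : ((N : F) : F) ≠ 0 := Nat.cast_ne_zero.2 hN.ne'
  intro h
  refine this ((algebraMap F (v.adicCompletion F)).injective ?_)
  rw [map_natCast, h, map_zero]

variable (F) in
/-- The open subgroup `N · Ô` of the finite adeles. -/
def intBall (N : ℕ) : AddSubgroup (FinAdele F) where
  carrier := {u | ∀ v, Valued.v (u v) ≤ Valued.v (N : v.adicCompletion F)}
  zero_mem' v := by
    change Valued.v (0 : v.adicCompletion F) ≤ _
    rw [map_zero]; exact zero_le
  add_mem' hu hu' v := valued_add_le (hu v) (hu' v)
  neg_mem' {u} hu v := by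
    change Valued.v (-(u v)) ≤ _
    rw [Valuation.map_neg]; exact hu v

theorem mul_mem_intBall {N : ℕ} {u u' : FinAdele F} (h : u ∈ intBall F N)
    (h' : ∀ v, Valued.v (u' v) ≤ 1) : u * u' ∈ intBall F N := fun v => by
  change Valued.v (u v * u' v) ≤ _
  rw [map_mul]
  exact (mul_le_mul' (h v) (h' v)).trans_eq (mul_one _)

theorem valued_natCast_le_one (v : FinPl F) (N : ℕ) : Valued.v (N : v.adicCompletion F) ≤ 1 := by
  have := valued_int_le_one v (N : 𝓞 F)
  convert this using 2
  exact (map_natCast ((algebraMap F (v.adicCompletion F)).comp (algebraMap (𝓞 F) F)) _).symm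

theorem algebraMap_finAdele_apply (x : F) (v : FinPl F) :
    (algebraMap F (FinAdele F) x) v = algebraMap F (v.adicCompletion F) x := rfl

theorem isOpen_valued_le_one : IsOpen {u : FinAdele F | ∀ v, Valued.v (u v) ≤ 1} :=
  RestrictedProduct.isOpen_forall_mem (R := fun v : FinPl F => v.adicCompletion F)
    (A := fun v : FinPl F => (v.adicCompletionIntegers F : Set (v.adicCompletion F)))
    fun _ => Valued.isOpen_valuationSubring _

theorem isOpen_intBall {N : ℕ} (hN : 0 < N) : IsOpen (intBall F N : Set (FinAdele F)) := by
  have hc : Continuous fun u : FinAdele F => algebraMap F (FinAdele F) (N : F)⁻¹ * u :=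
    continuous_const.mul continuous_id
  convert isOpen_valued_le_one.preimage hc using 1
  ext u
  refine forall_congr' fun v => ?_
  change _ ↔ Valued.v (algebraMap F (v.adicCompletion F) (N : F)⁻¹ * u v) ≤ 1
  have h0 : Valued.v (N : v.adicCompletion F) ≠ 0 :=
    (Valuation.ne_zero_iff _).2 (natCast_ne_zero v hN)
  rw [map_inv₀, map_natCast (algebraMap F (v.adicCompletion F)), map_mul, map_inv₀,
    inv_mul_le_one₀ (zero_lt_iff.2 h0)]

/-- The groups `N · Ô` form a basis of neighbourhoods of `0` in the finite adeles. -/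
theorem exists_intBall_subset {U : Set (FinAdele F)} (hU : U ∈ nhds 0) :
    ∃ N : ℕ, 0 < N ∧ (intBall F N : Set (FinAdele F)) ⊆ U := by
  have h := RestrictedProduct.nhds_zero_eq_map_structureMap
    (R := fun v : FinPl F => v.adicCompletion F)
    (B := fun v : FinPl F => v.adicCompletionIntegers F)
    (fun v => Valued.isOpen_valuationSubring _)
  have hU' : U ∈ Filter.map (RestrictedProduct.structureMap
      (fun v : FinPl F => v.adicCompletion F)
      (fun v : FinPl F => (v.adicCompletionIntegers F : Set (v.adicCompletion F)))
      Filter.cofinite) (nhds 0) := by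
    rw [← h]; exact hU
  replace hU' := Filter.mem_map.1 hU'
  rw [nhds_pi, Filter.mem_pi] at hU'
  obtain ⟨I, hI, t, ht, hsub⟩ := hU'
  have ht' : ∀ v : FinPl F, ∃ n : ℕ, ∀ x : v.adicCompletionIntegers F,
      Valued.v (x : v.adicCompletion F) ≤ WithZero.exp (-(n : ℤ)) → x ∈ t v := by
    intro v
    have := ht v
    rw [nhds_subtype_eq_comap, Filter.mem_comap] at this
    obtain ⟨s, hs, hst⟩ := this
    obtain ⟨n, hn⟩ := valued_mem_nhds_zero.1 hs
    exact ⟨n, fun x hx => hst (hn hx)⟩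
  choose n hn using ht'
  obtain ⟨N, hN, hNv⟩ := exists_nat_valued_le hI.toFinset n
  refine ⟨N, hN, fun u hu => ?_⟩
  have hint : ∀ v, u v ∈ v.adicCompletionIntegers F := fun v =>
    (hu v).trans (valued_natCast_le_one v N)
  let w : (v : FinPl F) → v.adicCompletionIntegers F := fun v => ⟨u v, hint v⟩
  have hw : w ∈ I.pi t := fun v hv => hn v (w v) ((hu v).trans (hNv v (hI.mem_toFinset.2 hv)))
  have hw' := hsub hw
  have he : RestrictedProduct.structureMap (fun v : FinPl F => v.adicCompletion F)
      (fun v : FinPl F => (v.adicCompletionIntegers F : Set (v.adicCompletion F)))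
      Filter.cofinite w = u := rfl
  rw [← he]
  exact hw'

theorem isCompact_valued_le_one : IsCompact {u : FinAdele F | ∀ v, Valued.v (u v) ≤ 1} := by
  have : ∀ v : FinPl F, CompactSpace (v.adicCompletionIntegers F) := fun v =>
    isCompact_iff_compactSpace.1 (isCompact_adicCompletionIntegers v)
  have h := isCompact_range (RestrictedProduct.isEmbedding_structureMap
    (R := fun v : FinPl F => v.adicCompletion F)
    (A := fun v : FinPl F => (v.adicCompletionIntegers F : Set (v.adicCompletion F)))
    (𝓕 := Filter.cofinite)).continuous
  rw [RestrictedProduct.range_structureMap] at h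
  exact h

/-- Strong approximation for the finite adeles: `𝔸_f = F + Ô`. -/
theorem exists_sub_integral (a : FinAdele F) :
    ∃ q : F, ∀ v, Valued.v ((a - algebraMap F (FinAdele F) q) v) ≤ 1 := by
  have hT : {v : FinPl F | a v ∉ v.adicCompletionIntegers F}.Finite := a.2
  have hn : ∀ v : FinPl F, ∃ n : ℕ, Valued.v (a v) ≤ WithZero.exp (n : ℤ) := fun v => by
    by_cases h0 : Valued.v (a v) = 0
    · exact ⟨0, by rw [h0]; exact zero_le⟩
    · refine ⟨(WithZero.log (Valued.v (a v))).toNat, ?_⟩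
      rw [← WithZero.exp_log h0, WithZero.exp_le_exp, WithZero.log_exp]
      exact Int.self_le_toNat _
  choose n hn using hn
  -- a common denominator `D`; then approximate `D * a` modulo `D` by the Chinese remainder theorem
  obtain ⟨D, hD, hDv⟩ := exists_nat_valued_le hT.toFinset n
  have hint : ∀ v, Valued.v ((D : v.adicCompletion F) * a v) ≤ 1 := fun v => by
    rw [map_mul]
    by_cases hv : a v ∈ v.adicCompletionIntegers F
    · exact mul_le_one' (valued_natCast_le_one v D) hv
    · refine (mul_le_mul' (hDv v (hT.mem_toFinset.2 hv)) (hn v)).trans_eq ?_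
      rw [← WithZero.exp_add, neg_add_cancel, WithZero.exp_zero]
  have hT' : {v : FinPl F | Valued.v (D : v.adicCompletion F) ≠ 1}.Finite := by
    let u : 𝔸[F]ˣ := Units.map (algebraMap F 𝔸[F]).toMonoidHom
      (Units.mk0 (D : F) (Nat.cast_ne_zero.2 hD.ne'))
    refine (idele_finite_valued_ne_one u).subset fun v hv => ?_
    have : evFin v (u : 𝔸[F]) = D := map_natCast ((evFin v).comp (algebraMap F 𝔸[F])) D
    rwa [Set.mem_ofPred_eq, this]
  have he : ∀ v : FinPl F, ∃ e : ℕ,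
      WithZero.exp (-(e : ℤ)) ≤ Valued.v (D : v.adicCompletion F) := fun v => by
    have h0 : Valued.v (D : v.adicCompletion F) ≠ 0 :=
      (Valuation.ne_zero_iff _).2 (natCast_ne_zero v hD)
    refine ⟨(-WithZero.log (Valued.v (D : v.adicCompletion F))).toNat, ?_⟩
    rw [← WithZero.exp_log h0, WithZero.exp_le_exp, WithZero.log_exp]
    have := Int.self_le_toNat (-WithZero.log (Valued.v (D : v.adicCompletion F)))
    omega
  choose e he using he
  choose r hr using fun v => exists_int_close v (hint v) (e v)
  obtain ⟨s, hs⟩ := IsDedekindDomain.exists_forall_sub_mem_ideal (s := hT'.toFinset)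
    (fun v => v.asIdeal) e (fun v _ => v.prime)
    (fun v _ w _ hvw h => hvw (HeightOneSpectrum.ext h)) (fun v => r v)
  refine ⟨(D : F)⁻¹ * s, fun v => ?_⟩
  have hDF : (D : v.adicCompletion F) ≠ 0 := natCast_ne_zero v hD
  have hD0 : Valued.v (D : v.adicCompletion F) ≠ 0 := (Valuation.ne_zero_iff _).2 hDF
  change Valued.v (a v - algebraMap F (v.adicCompletion F) ((D : F)⁻¹ * s)) ≤ 1
  have h1 : a v - algebraMap F (v.adicCompletion F) ((D : F)⁻¹ * s) =
      (D : v.adicCompletion F)⁻¹ * (D * a v - algebraMap F _ (s : F)) := by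
    rw [map_mul, map_inv₀, map_natCast]; field_simp
  have h2 : Valued.v ((D : v.adicCompletion F) * a v - algebraMap F _ (s : F)) ≤
      Valued.v (D : v.adicCompletion F) := by
    by_cases hv : Valued.v (D : v.adicCompletion F) = 1
    · rw [hv]
      exact Valuation.map_sub_le _ (hint v) (valued_int_le_one v s)
    · have h3 := hs v (hT'.mem_toFinset.2 hv)
      rw [← valued_int_le_exp_iff] at h3
      have h4 : (D : v.adicCompletion F) * a v - algebraMap F _ (s : F) =
          (D * a v - algebraMap F _ (r v : F)) -
            algebraMap F (v.adicCompletion F) ((s - r v : 𝓞 F) : F) := by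
        have : algebraMap F (v.adicCompletion F) ((s - r v : 𝓞 F) : F) =
            algebraMap F _ (s : F) - algebraMap F _ (r v : F) :=
          map_sub ((algebraMap F (v.adicCompletion F)).comp (algebraMap (𝓞 F) F)) _ _
        rw [this]; ring
      rw [h4]
      exact (Valuation.map_sub_le _ (hr v) h3).trans (he v)
  rw [h1, map_mul, map_inv₀]
  exact (mul_le_mul_right h2 _).trans_eq (inv_mul_cancel₀ hD0)

/-! ### The archimedean component -/

omit [NumberField F] in
theorem continuous_ringEquiv_mixedSpace :
    Continuous (InfiniteAdeleRing.ringEquiv_mixedSpace F) := by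
  refine Continuous.prodMk ?_ ?_
  · exact continuous_pi fun v => (InfinitePlace.Completion.isometry_extensionEmbeddingOfIsReal
      v.2).continuous.comp (continuous_apply v.1)
  · exact continuous_pi fun v => (InfinitePlace.Completion.isometry_extensionEmbedding
      v.1).continuous.comp (continuous_apply v.1)

omit [NumberField F] in
theorem continuous_ringEquiv_mixedSpace_symm :
    Continuous (InfiniteAdeleRing.ringEquiv_mixedSpace F).symm := by
  refine continuous_pi fun v => ?_
  have key : ∀ y : mixedEmbedding.mixedSpace F, InfiniteAdeleRing.ringEquiv_mixedSpace F
    ((InfiniteAdeleRing.ringEquiv_mixedSpace F).symm y) = y :=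
    fun y => RingEquiv.apply_symm_apply _ y
  by_cases hv : v.IsReal
  · have h := InfinitePlace.Completion.isometry_extensionEmbeddingOfIsReal hv
    rw [h.isEmbedding.isInducing.continuous_iff]
    have : (InfinitePlace.Completion.extensionEmbeddingOfIsReal hv ∘ fun y =>
        (InfiniteAdeleRing.ringEquiv_mixedSpace F).symm y v) = fun y => y.1 ⟨v, hv⟩ :=
      funext fun y => congrFun (congrArg Prod.fst (key y)) ⟨v, hv⟩
    rw [this]
    exact (continuous_apply _).comp continuous_fst
  · have h := InfinitePlace.Completion.isometry_extensionEmbedding v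
    rw [h.isEmbedding.isInducing.continuous_iff]
    have hv' := InfinitePlace.not_isReal_iff_isComplex.1 hv
    have : (InfinitePlace.Completion.extensionEmbedding v ∘ fun y =>
        (InfiniteAdeleRing.ringEquiv_mixedSpace F).symm y v) = fun y => y.2 ⟨v, hv'⟩ :=
      funext fun y => congrFun (congrArg Prod.snd (key y)) ⟨v, hv'⟩
    rw [this]
    exact (continuous_apply _).comp continuous_snd

/-- The embedding of the archimedean component `F_∞ = ℝ^{r₁} × ℂ^{r₂}` into the adeles. -/
def infEmb : mixedEmbedding.mixedSpace F →+ 𝔸[F] where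
  toFun t := ((InfiniteAdeleRing.ringEquiv_mixedSpace F).symm t, (0 : FinAdele F))
  map_zero' := Prod.ext (map_zero (InfiniteAdeleRing.ringEquiv_mixedSpace F).symm) rfl
  map_add' t t' := Prod.ext (map_add (InfiniteAdeleRing.ringEquiv_mixedSpace F).symm t t')
    (add_zero (0 : FinAdele F)).symm

theorem continuous_infEmb : Continuous (infEmb (F := F)) :=
  continuous_ringEquiv_mixedSpace_symm.prodMk continuous_const

theorem continuous_finEmb : Continuous (finEmb (F := F)) :=
  continuous_const.prodMk continuous_id

theorem infEmb_add_finEmb (a : 𝔸[F]) : infEmb (toMixed a) + finEmb a.2 = a := by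
  refine Prod.ext ?_ (zero_add a.2)
  change (InfiniteAdeleRing.ringEquiv_mixedSpace F).symm
    (InfiniteAdeleRing.ringEquiv_mixedSpace F a.1) + 0 = a.1
  rw [RingEquiv.symm_apply_apply, add_zero]

theorem continuous_toMixed : Continuous (toMixed (F := F)) :=
  continuous_ringEquiv_mixedSpace.comp continuous_fst

theorem continuous_snd_adele : Continuous (fun a : 𝔸[F] => a.2) := continuous_snd

theorem toMixed_algebraMap (x : F) : toMixed (algebraMap F 𝔸[F] x) = mixedEmbedding F x :=
  (InfiniteAdeleRing.mixedEmbedding_eq_algebraMap_comp F).symm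

section Classical

open scoped Classical

/-- The product of a box in `F_∞` and `Ô` meets every class of `𝔸 / F`. -/
theorem exists_isCompact_add_rational :
    ∃ C : Set 𝔸[F], IsCompact C ∧ ∀ a : 𝔸[F], ∃ q : F, a - algebraMap F 𝔸[F] q ∈ C := by
  let b := mixedEmbedding.latticeBasis F
  let R := ∑ i, ‖b i‖
  refine ⟨(fun p : mixedEmbedding.mixedSpace F × FinAdele F => infEmb p.1 + finEmb p.2) ''
    (Metric.closedBall 0 R ×ˢ {u | ∀ v, Valued.v (u v) ≤ 1}), ?_, fun a => ?_⟩
  · exact ((isCompact_closedBall 0 R).prod isCompact_valued_le_one).image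
      ((continuous_infEmb.comp continuous_fst).add (continuous_finEmb.comp continuous_snd))
  -- first make the finite part integral, then reduce modulo the lattice `𝓞 F` of `F_∞`
  · obtain ⟨q, hq⟩ := exists_sub_integral a.2
    have hfl : ((ZSpan.floor b (toMixed (a - algebraMap F 𝔸[F] q)) : _) :
        mixedEmbedding.mixedSpace F) ∈ Submodule.span ℤ (Set.range b) := Subtype.prop _
    rw [mixedEmbedding.mem_span_latticeBasis] at hfl
    obtain ⟨r, hr⟩ := hfl
    have hr : mixedEmbedding F (r : F) = ZSpan.floor b (toMixed (a - algebraMap F 𝔸[F] q)) := hr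
    refine ⟨q + r, (toMixed (a - algebraMap F 𝔸[F] (q + r)), (a - algebraMap F 𝔸[F] (q + r)).2),
      ⟨?_, ?_⟩, infEmb_add_finEmb _⟩
    · rw [mem_closedBall_zero_iff]
      have : toMixed (a - algebraMap F 𝔸[F] (q + r)) =
          ZSpan.fract b (toMixed (a - algebraMap F 𝔸[F] q)) := by
        rw [ZSpan.fract_apply, ← hr, ← toMixed_algebraMap, ← map_sub, map_add, sub_sub]
      dsimp only
      rw [this]
      exact ZSpan.norm_fract_le b _
    · intro v
      change Valued.v (a.2 v - algebraMap F (v.adicCompletion F) (q + r)) ≤ 1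
      rw [map_add, ← sub_sub]
      exact Valuation.map_sub_le _ (hq v) (valued_int_le_one v r)

theorem intBall_mem_nhds {N : ℕ} (hN : 0 < N) {ε : ℝ} (hε : 0 < ε) (a : 𝔸[F]) :
    {b : 𝔸[F] | ‖toMixed (b - a)‖ < ε ∧ (b - a).2 ∈ intBall F N} ∈ nhds a := by
  have h1 : Continuous fun b : 𝔸[F] => ‖toMixed (b - a)‖ :=
    (continuous_toMixed.comp (continuous_id.sub continuous_const)).norm
  have h2 : Continuous fun b : 𝔸[F] => (b - a).2 :=
    continuous_snd_adele.comp (continuous_id.sub continuous_const)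
  refine IsOpen.mem_nhds ((isOpen_lt h1 continuous_const).inter
    ((isOpen_intBall hN).preimage h2)) ⟨?_, ?_⟩
  · simp [hε]
  · rw [sub_self]
    exact (intBall F N).zero_mem

end Classical

/-! ### The Haar measure of `𝔸 / F` -/

instance : BorelSpace (AdeleQuot F) := ⟨rfl⟩

instance : CompactSpace (AdeleQuot F) := by
  obtain ⟨C, hC, h⟩ := exists_isCompact_add_rational (F := F)
  refine ⟨?_⟩
  convert hC.image (QuotientAddGroup.continuous_mk (N := AdeleRing.principalSubgroup (𝓞 F) F))
  refine (Set.eq_univ_of_forall fun x => ?_).symm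
  obtain ⟨a, rfl⟩ := QuotientAddGroup.mk_surjective x
  obtain ⟨q, hq⟩ := h a
  refine ⟨_, hq, ?_⟩
  rw [QuotientAddGroup.eq_iff_sub_mem]
  exact ⟨-q, by simp⟩

theorem adeleHaar_spec : (adeleHaar F).IsAddHaarMeasure ∧ IsProbabilityMeasure (adeleHaar F) := by
  have h : ∃ ν : Measure (AdeleQuot F), ν.IsAddHaarMeasure ∧ IsProbabilityMeasure ν :=
    ⟨Measure.addHaarMeasure ⊤, inferInstance, ⟨by
      simpa using Measure.addHaarMeasure_self (K₀ := (⊤ : TopologicalSpace.PositiveCompacts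
        (AdeleQuot F)))⟩⟩
  rw [adeleHaar, dif_pos h]
  exact h.choose_spec

instance : (adeleHaar F).IsAddHaarMeasure := adeleHaar_spec.1

instance : IsProbabilityMeasure (adeleHaar F) := adeleHaar_spec.2

/-! ### Additive characters of `𝔸 / F` -/

/-- Two terms of any sequence of adeles are arbitrarily close modulo `F`, as `𝔸 / F` is compact. -/
theorem exists_sub_sub_rational_mem (t : ℕ → 𝔸[F]) {W : Set 𝔸[F]} (hW : W ∈ nhds 0) :
    ∃ m n, m < n ∧ ∃ q : F, t n - t m - algebraMap F 𝔸[F] q ∈ W := by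
  obtain ⟨C, hC, h⟩ := exists_isCompact_add_rational (F := F)
  choose q hq using fun n => h (t n)
  obtain ⟨c, -, hc⟩ := hC.exists_mapClusterPt (f := Filter.atTop)
    (u := fun n => t n - algebraMap F 𝔸[F] (q n))
    (Filter.tendsto_principal.2 (Filter.Eventually.of_forall hq))
  have hsub : Filter.Tendsto (fun p : 𝔸[F] × 𝔸[F] => p.1 - p.2) (nhds (c, c)) (nhds 0) := by
    have := (continuous_sub (G := 𝔸[F])).tendsto (c, c)
    rwa [sub_self] at this
  obtain ⟨s, hs, s', hs', hss⟩ := mem_nhds_prod_iff.1 (hsub hW)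
  have hfr := Filter.frequently_atTop.1 
    (mapClusterPt_iff_frequently.1 hc _ (Filter.inter_mem hs hs'))
  obtain ⟨m, -, hm⟩ := hfr 0
  obtain ⟨n, hn, hn'⟩ := hfr (m + 1)
  refine ⟨m, n, hn, q n - q m, ?_⟩
  have := hss (Set.mk_mem_prod hn'.1 hm.2)
  have e : t n - t m - algebraMap F 𝔸[F] (q n - q m) =
      t n - algebraMap F 𝔸[F] (q n) - (t m - algebraMap F 𝔸[F] (q m)) := by
    rw [map_sub]; ring
  rw [e]
  exact this

/-- The multiplicative group of `ℂ` has no small subgroups. -/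
theorem eq_one_of_forall_norm_pow_sub_one_le {z : ℂ} (h : ∀ n : ℕ, ‖z ^ n - 1‖ ≤ 1 / 2) :
    z = 1 := by
  have key : ∀ k : ℕ, (3 / 2 : ℝ) ^ k * ‖z - 1‖ ≤ ‖z ^ 2 ^ k - 1‖ := by
    intro k
    induction k with
    | zero => simp
    | succ k ih =>
      have h1 := h (2 ^ k)
      set y : ℂ := z ^ 2 ^ k with hy
      have h2 : z ^ 2 ^ (k + 1) - 1 = (y - 1) * (2 + (y - 1)) := by
        rw [pow_succ, pow_mul, ← hy]; ring
      have h3 : (3 / 2 : ℝ) ≤ ‖2 + (y - 1)‖ := by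
        have := norm_sub_norm_le (2 : ℂ) (-(y - 1))
        rw [norm_neg, sub_neg_eq_add] at this
        norm_num at this
        linarith
      rw [h2, norm_mul, pow_succ]
      nlinarith [norm_nonneg (y - 1), norm_nonneg (z - 1)]
  by_contra hz
  have hpos : 0 < ‖z - 1‖ := norm_pos_iff.2 (sub_ne_zero.2 hz)
  obtain ⟨k, hk⟩ := pow_unbounded_of_one_lt (1 / 2 / ‖z - 1‖) (by norm_num : (1 : ℝ) < 3 / 2)
  rw [div_lt_iff₀ hpos] at hk
  linarith [key k, h (2 ^ k)]

theorem addChar_eq_one_of_forall_mul {ψ : AddChar 𝔸[F] Circle} {a : 𝔸[F]}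
    (h : ∀ n : ℕ, ‖(ψ (n * a) : ℂ) - 1‖ ≤ 1 / 2) : ψ a = 1 := by
  refine Circle.ext (eq_one_of_forall_norm_pow_sub_one_le fun n => ?_)
  rw [← Circle.coe_pow, ← AddChar.map_nsmul_eq_pow, nsmul_eq_mul]
  exact h n

section Character

variable {ψ : AddChar 𝔸[F] Circle} (hψ : Continuous ψ) (hψF : ∀ x : F, ψ (algebraMap F 𝔸[F] x) = 1)

include hψ in
theorem exists_nhds_addChar_mul_close {C : Set 𝔸[F]} (hC : IsCompact C) :
    ∃ W ∈ nhds (0 : 𝔸[F]), ∀ w ∈ W, ∀ c ∈ C, ‖(ψ (w * c) : ℂ) - 1‖ ≤ 1 / 2 := by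
  have hc : Continuous fun p : 𝔸[F] × 𝔸[F] => ‖(ψ (p.1 * p.2) : ℂ) - 1‖ :=
    ((continuous_subtype_val.comp (hψ.comp (continuous_fst.mul continuous_snd))).sub
      continuous_const).norm
  have h := hC.eventually_forall_of_forall_eventually (x₀ := (0 : 𝔸[F]))
    (P := fun w c => ‖(ψ (w * c) : ℂ) - 1‖ ≤ 1 / 2) fun c _ => by
      have h0 : ‖(ψ ((0 : 𝔸[F]) * c) : ℂ) - 1‖ < 1 / 2 := by simp
      have h1 := hc.continuousAt.eventually_lt (x₀ := ((0 : 𝔸[F]), c)) continuousAt_const h0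
      exact h1.mono fun p hp => hp.le
  obtain ⟨W, hW, hWC⟩ := Filter.eventually_iff_exists_mem.1 h
  exact ⟨W, hW, hWC⟩

/-- If `x ↦ ψ(l x)` is trivial on `F` and close to `1` on representatives of `𝔸 / F`, then it is
trivial, because the circle has no small subgroups. -/
theorem addChar_eq_one_of_close {C : Set 𝔸[F]}
    (hC : ∀ a : 𝔸[F], ∃ q : F, a - algebraMap F 𝔸[F] q ∈ C)
    (l : 𝔸[F]) (hl : ∀ q : F, ψ (l * algebraMap F 𝔸[F] q) = 1)
    (h : ∀ c ∈ C, ‖(ψ (l * c) : ℂ) - 1‖ ≤ 1 / 2) (a : 𝔸[F]) : ψ (l * a) = 1 := by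
  refine addChar_eq_one_of_forall_mul fun n => ?_
  obtain ⟨q, hq⟩ := hC (n * a)
  have e : (n : 𝔸[F]) * (l * a) = l * (n * a - algebraMap F 𝔸[F] q) + l * algebraMap F 𝔸[F] q := by
    ring
  rw [e, AddChar.map_add_eq_mul, hl, mul_one]
  exact h _ hq

theorem infEmb_toMixed_mul (a : 𝔸[F]) (t : mixedEmbedding.mixedSpace F) :
    infEmb (toMixed a * t) = a * infEmb t := by
  refine Prod.ext ?_ (mul_zero a.2).symm
  change (InfiniteAdeleRing.ringEquiv_mixedSpace F).symm
    (InfiniteAdeleRing.ringEquiv_mixedSpace F a.1 * t) = a.1 * _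
  rw [map_mul, RingEquiv.symm_apply_apply]
  rfl

theorem toMixed_infEmb (t : mixedEmbedding.mixedSpace F) : toMixed (infEmb t) = t :=
  RingEquiv.apply_symm_apply (InfiniteAdeleRing.ringEquiv_mixedSpace F) t

include hψ hψF in
open scoped Classical in
/-- The pairing `(l, a) ↦ ψ(l a)` is nondegenerate. If `ψ` is trivial on `l 𝔸` with `l ≠ 0`, then
`l b - q` is small for some adele `b` and some `q ∈ F^×`; therefore `ψ` is trivial on
`(l b - q) 𝔸`, and on `q 𝔸 = 𝔸`. -/
theorem eq_zero_of_addChar_mul_eq_one (hne : ψ ≠ 1) {l : 𝔸[F]} (hl : ∀ a, ψ (l * a) = 1) :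
    l = 0 := by
  by_contra hl0
  obtain ⟨C, hC, hCF⟩ := exists_isCompact_add_rational (F := F)
  obtain ⟨W, hW, hWC⟩ := exists_nhds_addChar_mul_close hψ hC
  -- it suffices to find `q ≠ 0` in `F` such that `l * b - q` is close to `0` for some adele `b`
  suffices h : ∃ q : F, q ≠ 0 ∧ ∃ b : 𝔸[F], l * b - algebraMap F 𝔸[F] q ∈ W by
    obtain ⟨q, hq, b, hb⟩ := h
    refine hne (DFunLike.ext _ _ fun a => ?_)
    have h1 : ∀ q' : F, ψ ((l * b - algebraMap F 𝔸[F] q) * algebraMap F 𝔸[F] q') = 1 := fun q' => by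
      rw [sub_mul, mul_assoc, ← map_mul, AddChar.map_sub_eq_div, hl, hψF, div_one]
    have h2 := addChar_eq_one_of_close hCF _ h1 (fun c hc => hWC _ hb c hc)
      (algebraMap F 𝔸[F] q⁻¹ * a)
    rw [sub_mul, ← mul_assoc (algebraMap F 𝔸[F] q), ← map_mul, mul_inv_cancel₀ hq, map_one, one_mul,
      mul_assoc, AddChar.map_sub_eq_div, hl, one_div, inv_eq_one] at h2
    exact h2
  have hW' : W ∩ {b : 𝔸[F] | ‖toMixed (b - 0)‖ < 1 ∧ (b - 0).2 ∈ intBall F 1} ∈ nhds 0 :=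
    Filter.inter_mem hW (intBall_mem_nhds one_pos one_pos 0)
  -- multiples of `l` whose differences are large at one place, so that `q = 0` is excluded
  by_cases hinf : toMixed l = 0
  · have hfin : ∃ v, l.2 v ≠ 0 := by
      by_contra! h
      refine hl0 ?_
      rw [← infEmb_add_finEmb l, hinf, map_zero, zero_add,
        show l.2 = 0 from FiniteAdeleRing.ext _ h, map_zero]
    obtain ⟨v, hv⟩ := hfin
    obtain ⟨p, hp, hpv⟩ := exists_nat_valued_le {v} fun _ => 1
    have hpv : Valued.v (p : v.adicCompletion F) < 1 :=
      (hpv v (Finset.mem_singleton_self v)).trans_lt (by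
        rw [← WithZero.exp_zero, WithZero.exp_lt_exp]; norm_num)
    have hp0 : (p : v.adicCompletion F) ≠ 0 := natCast_ne_zero v hp
    let s : ℕ → 𝔸[F] := fun n => finEmb
      (RestrictedProduct.single (fun w : FinPl F => w.adicCompletionIntegers F) v
        ((l.2 v)⁻¹ * ((p : v.adicCompletion F) ^ (n + 1))⁻¹))
    have hs : ∀ n, (l * s n).2 v = ((p : v.adicCompletion F) ^ (n + 1))⁻¹ := fun n => by
      change l.2 v * (RestrictedProduct.single (fun w : FinPl F => w.adicCompletionIntegers F) v
        ((l.2 v)⁻¹ * ((p : v.adicCompletion F) ^ (n + 1))⁻¹) v) = _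
      rw [RestrictedProduct.single_eq_same, mul_inv_cancel_left₀ hv]
    obtain ⟨m, n, hmn, q, hq⟩ := exists_sub_sub_rational_mem (fun n => l * s n) hW'
    refine ⟨q, fun hq0 => ?_, s n - s m, by rw [mul_sub]; exact hq.1⟩
    have h1 := hq.2.2 v
    rw [hq0, map_zero, sub_zero, sub_zero, Nat.cast_one, map_one] at h1
    have e : (l * s n - l * s m).2 v =
        ((p : v.adicCompletion F) ^ (n + 1))⁻¹ - ((p : v.adicCompletion F) ^ (m + 1))⁻¹ := by
      rw [← hs, ← hs]; rfl
    have hval0 : 0 < Valued.v (p : v.adicCompletion F) :=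
      zero_lt_iff.2 ((Valuation.ne_zero_iff _).2 hp0)
    rw [e, Valuation.map_sub_eq_of_lt_left] at h1
    · rw [map_inv₀, map_pow, inv_le_one₀ (pow_pos hval0 _)] at h1
      exact absurd h1 (not_le.2 (pow_lt_one₀ zero_le hpv (Nat.succ_ne_zero n)))
    · rw [map_inv₀, map_inv₀, map_pow, map_pow, inv_lt_inv₀ (pow_pos hval0 _) (pow_pos hval0 _)]
      exact pow_lt_pow_right_of_lt_one₀ hval0 hpv (by omega)
  · obtain ⟨R, hR⟩ := exists_nat_gt (1 / ‖toMixed l‖)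
    have hpos : 0 < ‖toMixed l‖ := norm_pos_iff.2 hinf
    rw [div_lt_iff₀ hpos] at hR
    let s : ℕ → 𝔸[F] := fun n => infEmb ((n * R : ℕ) • (1 : mixedEmbedding.mixedSpace F))
    have hs : ∀ n, toMixed (l * s n) = (n * R : ℕ) • toMixed l := fun n => by
      rw [map_mul, toMixed_infEmb, mul_smul_comm, mul_one]
    obtain ⟨m, n, hmn, q, hq⟩ := exists_sub_sub_rational_mem (fun n => l * s n) hW'
    refine ⟨q, fun hq0 => ?_, s n - s m, by rw [mul_sub]; exact hq.1⟩
    have h1 := hq.2.1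
    obtain ⟨k, rfl⟩ := Nat.exists_eq_add_of_lt hmn
    rw [hq0, map_zero, sub_zero, sub_zero, map_sub, hs, hs,
      show (m + k + 1) * R = (k + 1) * R + m * R by ring, add_smul, add_sub_cancel_right,
      ← Nat.cast_smul_eq_nsmul ℝ, norm_smul, Real.norm_natCast] at h1
    push_cast at h1
    nlinarith [(Nat.cast_nonneg k : (0 : ℝ) ≤ k)]

include hψ hψF in
/-- The annihilator of `F` under the pairing `(ξ, x) ↦ ψ(ξ x)` is `F` itself. -/
theorem exists_rational_of_addChar_mul_eq_one (hne : ψ ≠ 1) {x : 𝔸[F]}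
    (hx : ∀ q : F, ψ (algebraMap F 𝔸[F] q * x) = 1) : ∃ q : F, algebraMap F 𝔸[F] q = x := by
  obtain ⟨C, hC, hCF⟩ := exists_isCompact_add_rational (F := F)
  obtain ⟨W, hW, hWC⟩ := exists_nhds_addChar_mul_close hψ hC
  obtain ⟨m, n, hmn, q, hq⟩ := exists_sub_sub_rational_mem (fun n : ℕ => (n : 𝔸[F]) * x) hW
  have h1 : ∀ q' : F,
      ψ (((n : 𝔸[F]) * x - m * x - algebraMap F 𝔸[F] q) * algebraMap F 𝔸[F] q') = 1 := by
    intro q'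
    have e : ((n : 𝔸[F]) * x - m * x - algebraMap F 𝔸[F] q) * algebraMap F 𝔸[F] q' =
        algebraMap F 𝔸[F] ((n - m) * q') * x - algebraMap F 𝔸[F] (q * q') := by
      simp only [map_mul, map_sub, map_natCast]; ring
    rw [e, AddChar.map_sub_eq_div, hx, hψF, div_one]
  have h2 := eq_zero_of_addChar_mul_eq_one hψ hψF hne
    (addChar_eq_one_of_close hCF _ h1 fun c hc => hWC _ hq c hc)
  have h0 : (n : F) - m ≠ 0 := sub_ne_zero.2 (Nat.cast_injective.ne hmn.ne')
  refine ⟨(n - m : F)⁻¹ * q, ?_⟩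
  rw [map_mul, ← sub_eq_zero.1 h2, ← sub_mul, ← mul_assoc,
    show (n : 𝔸[F]) - m = algebraMap F 𝔸[F] (n - m) by simp, ← map_mul, inv_mul_cancel₀ h0, map_one,
    one_mul]

end Character

/-! ### Absolutely convergent expansions in an orthonormal family of functions -/

section Expansion

open ComplexConjugate

variable {X ι : Type*} [TopologicalSpace X] [CompactSpace X] [MeasurableSpace X] [BorelSpace X]
  {ν : Measure X} [IsFiniteMeasure ν]

theorem integrable_of_continuous {f : X → ℂ} (hf : Continuous f) : Integrable f ν :=
  hf.integrable_of_hasCompactSupport (HasCompactSupport.of_compactSpace f)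

variable (ν) in
/-- Integration as a continuous linear functional on the continuous functions on a compact
space. -/
def integralLM : C(X, ℂ) →L[ℂ] ℂ :=
  LinearMap.mkContinuous
    { toFun := fun f => ∫ x, f x ∂ν
      map_add' := fun f g => integral_add (integrable_of_continuous f.continuous)
        (integrable_of_continuous g.continuous)
      map_smul' := fun c f => integral_const_mul c f } (ν.real Set.univ) fun f => by
    rw [mul_comm]
    exact norm_integral_le_of_norm_le_const (Filter.Eventually.of_forall f.norm_coe_le_norm)

theorem integralLM_apply (f : C(X, ℂ)) : integralLM ν f = ∫ x, f x ∂ν := rfl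

omit [MeasurableSpace X] [BorelSpace X] in
/-- The span of the functions `e i` is dense, by the Stone–Weierstrass theorem. -/
theorem dense_span_of_separatesPoints {e : ι → C(X, ℂ)} (h1 : ∃ i, e i = 1)
    (hmul : ∀ i j, ∃ k, e k = e i * e j) (hstar : ∀ i, ∃ k, e k = star (e i))
    (hsep : ∀ x y, x ≠ y → ∃ i, e i x ≠ e i y) :
    (Submodule.span ℂ (Set.range e)).topologicalClosure = ⊤ := by
  let A : StarSubalgebra ℂ C(X, ℂ) :=
    { toSubalgebra := Algebra.adjoin ℂ (Set.range e)
      star_mem' := by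
        change Algebra.adjoin ℂ (Set.range e) ≤ star (Algebra.adjoin ℂ (Set.range e))
        refine Algebra.adjoin_le ?_
        rintro - ⟨i, rfl⟩
        obtain ⟨k, hk⟩ := hstar i
        exact Algebra.subset_adjoin ⟨k, hk⟩ }
  have hA : Subalgebra.toSubmodule A.toSubalgebra = Submodule.span ℂ (Set.range e) := by
    refine Algebra.adjoin_eq_span_of_subset (R := ℂ) (s := Set.range e) ?_
    refine Set.Subset.trans ?_ Submodule.subset_span
    intro x hx
    refine Submonoid.closure_induction (fun _ => id) h1 ?_ hx
    rintro - - - - ⟨i, rfl⟩ ⟨j, rfl⟩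
    exact hmul i j
  have hsepA : A.SeparatesPoints := by
    intro x y hxy
    obtain ⟨i, hi⟩ := hsep x y hxy
    exact ⟨e i, ⟨e i, Algebra.subset_adjoin ⟨i, rfl⟩, rfl⟩, hi⟩
  rw [← hA]
  exact congrArg (Subalgebra.toSubmodule <| StarSubalgebra.toSubalgebra ·)
    (ContinuousMap.starSubalgebra_topologicalClosure_eq_top_of_separatesPoints A hsepA)

/-- A continuous function on a compact space is the sum of its expansion in an orthonormal family of
functions which is closed under products and conjugation and separates points, as soon as the
coefficients are absolutely summable. -/
theorem hasSum_of_summable_coefficients [ν.IsOpenPosMeasure] {e : ι → C(X, ℂ)} (h1 : ∃ i, e i = 1)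
    (hmul : ∀ i j, ∃ k, e k = e i * e j) (hstar : ∀ i, ∃ k, e k = star (e i))
    (hsep : ∀ x y, x ≠ y → ∃ i, e i x ≠ e i y) (hnorm : ∀ i, ‖e i‖ ≤ 1)
    (hself : ∀ i, ∫ x, e i x * conj (e i x) ∂ν = 1)
    (horth : ∀ i j, i ≠ j → ∫ x, e i x * conj (e j x) ∂ν = 0)
    (f : C(X, ℂ)) (hf : Summable fun i => ‖∫ x, f x * conj (e i x) ∂ν‖) (x : X) :
    HasSum (fun i => (∫ x, f x * conj (e i x) ∂ν) * e i x) (f x) := by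
  set c : ι → ℂ := fun i => ∫ x, f x * conj (e i x) ∂ν with hc
  have hs : Summable fun i => c i • e i := by
    refine Summable.of_norm_bounded hf fun i => ?_
    rw [norm_smul]
    exact mul_le_of_le_one_right (norm_nonneg _) (hnorm i)
  obtain ⟨g, hg⟩ := hs
  have hLc : ∀ q : C(X, ℂ), Continuous fun p : C(X, ℂ) => integralLM ν (p * star q) := fun q =>
    (integralLM ν).continuous.comp (continuous_id.mul continuous_const)
  have hcoef : ∀ j, integralLM ν ((f - g) * star (e j)) = 0 := by
    intro j
    let L : C(X, ℂ) →+ ℂ :=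
      (integralLM ν : C(X, ℂ) →+ ℂ).comp (AddMonoidHom.mulRight (star (e j)))
    have hL : HasSum (fun i => L (c i • e i)) (L g) := hg.map L (hLc (e j))
    have hLe : ∀ i, L (c i • e i) = c i * ∫ x, e i x * conj (e j x) ∂ν := fun i => by
      change integralLM ν (c i • e i * star (e j)) = _
      rw [smul_mul_assoc, map_smul]
      rfl
    have hL' : HasSum (fun i => L (c i • e i)) (c j) := by
      have h2 : c j = L (c j • e j) := by rw [hLe, hself, mul_one]
      rw [h2]
      refine hasSum_single j fun i hi => ?_
      rw [hLe, horth i j hi, mul_zero]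
    have h3 : integralLM ν (g * star (e j)) = c j := hL.unique hL'
    have h4 : integralLM ν (f * star (e j)) = c j := rfl
    rw [sub_mul, map_sub, h3, h4, sub_self]
  have hclosed : IsClosed {p : C(X, ℂ) | integralLM ν ((f - g) * star p) = 0} :=
    isClosed_eq ((integralLM ν).continuous.comp (continuous_const.mul continuous_star))
      continuous_const
  have hspan : (Submodule.span ℂ (Set.range e) : Set C(X, ℂ)) ⊆
      {p : C(X, ℂ) | integralLM ν ((f - g) * star p) = 0} := by
    intro p hp
    refine Submodule.span_induction (p := fun p _ => integralLM ν ((f - g) * star p) = 0)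
      ?_ ?_ ?_ ?_ hp
    · rintro - ⟨j, rfl⟩; exact hcoef j
    · simp
    · intro p q _ _ hp hq; rw [star_add, mul_add, map_add, hp, hq, add_zero]
    · intro a p _ hp; rw [star_smul, mul_smul_comm, map_smul, hp, smul_zero]
  have hall : integralLM ν ((f - g) * star (f - g)) = 0 := by
    have hmem : f - g ∈ (Submodule.span ℂ (Set.range e)).topologicalClosure := by
      rw [dense_span_of_separatesPoints h1 hmul hstar hsep]; trivial
    exact closure_minimal hspan hclosed hmem
  -- `f - g` is orthogonal to itself, hence zero
  have hzero : f = g := by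
    have h5 : ∫ x, ‖(f - g) x‖ ^ 2 ∂ν = 0 := by
      rw [integralLM_apply] at hall
      have h6 : ∀ x, ((f - g) * star (f - g)) x = ((‖(f - g) x‖ ^ 2 : ℝ) : ℂ) := fun x => by
        change (f - g) x * conj ((f - g) x) = _
        rw [Complex.mul_conj, Complex.normSq_eq_norm_sq]
      simp_rw [h6] at hall
      rw [integral_complex_ofReal] at hall
      exact_mod_cast hall
    have hcont : Continuous fun x => ‖(f - g) x‖ ^ 2 := ((f - g).continuous.norm).pow 2
    rw [integral_eq_zero_iff_of_nonneg (fun x => sq_nonneg _)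
      (hcont.integrable_of_hasCompactSupport (HasCompactSupport.of_compactSpace _)),
      Continuous.ae_eq_iff_eq ν hcont continuous_zero] at h5
    ext x
    have := congrFun h5 x
    simpa [sub_eq_zero] using this
  have hev : HasSum (fun i => c i * e i x) (g x) := (ContinuousMap.evalCLM ℂ x).hasSum hg
  have hfg : f x = g x := by rw [hzero]
  rw [hfg]
  exact hev

end Expansion

/-! ### Fourier series on `𝔸 / F` -/

/-- Invariance of a function on the adeles under translation by `F`. -/
def IsPeriodic {α : Type*} (f : 𝔸[F] → α) : Prop :=
  ∀ (a : 𝔸[F]) (q : F), f (a + algebraMap F 𝔸[F] q) = f a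

theorem exists_out_eq (a : 𝔸[F]) :
    ∃ q : F, ((a : AdeleQuot F)).out = a + algebraMap F 𝔸[F] q := by
  have h := QuotientAddGroup.mk_out_eq_add (AdeleRing.principalSubgroup (𝓞 F) F) a
  obtain ⟨⟨-, q, rfl⟩, hq⟩ := h
  exact ⟨q, hq⟩

theorem IsPeriodic.out {α : Type*} {f : 𝔸[F] → α} (hf : IsPeriodic f) (a : 𝔸[F]) :
    f ((a : AdeleQuot F)).out = f a := by
  obtain ⟨q, hq⟩ := exists_out_eq a
  rw [hq, hf]

theorem IsPeriodic.continuous_out {α : Type*} [TopologicalSpace α] {f : 𝔸[F] → α}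
    (hf : IsPeriodic f) (hc : Continuous f) : Continuous fun x : AdeleQuot F => f x.out := by
  refine isQuotientMap_quotient_mk'.continuous_iff.2 ?_
  exact hc.congr fun a => (hf.out a).symm

theorem IsPeriodic.integral_add {f : 𝔸[F] → ℂ} (hf : IsPeriodic f) (b : 𝔸[F]) :
    ∫ x : AdeleQuot F, f (x.out + b) ∂(adeleHaar F) =
      ∫ x : AdeleQuot F, f x.out ∂(adeleHaar F) := by
  rw [← integral_add_right_eq_self (fun x : AdeleQuot F => f x.out) (b : AdeleQuot F)]
  refine integral_congr_ae (Filter.Eventually.of_forall fun x => ?_)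
  dsimp only
  rw [← hf.out, QuotientAddGroup.mk_add, QuotientAddGroup.out_eq']

/-- Multiplication by `ξ ∈ F^×` is an automorphism of the compact group `𝔸 / F`, so it preserves the
Haar probability measure. -/
theorem integral_mul_rational {f : 𝔸[F] → ℂ} (hf : IsPeriodic f) (hc : Continuous f) (ξ : Fˣ) :
    ∫ x : AdeleQuot F, f (algebraMap F 𝔸[F] ξ * x.out) ∂(adeleHaar F) =
      ∫ x : AdeleQuot F, f x.out ∂(adeleHaar F) := by
  let H := AdeleRing.principalSubgroup (𝓞 F) F
  have hle : H ≤ H.comap (AddMonoidHom.mulLeft (algebraMap F 𝔸[F] ξ)) := by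
    rintro - ⟨q, rfl⟩
    exact ⟨ξ * q, map_mul _ _ _⟩
  let m : AdeleQuot F →+ AdeleQuot F :=
    QuotientAddGroup.map H H (AddMonoidHom.mulLeft (algebraMap F 𝔸[F] ξ)) hle
  have hm : ∀ a : 𝔸[F], m a = ((algebraMap F 𝔸[F] ξ * a : 𝔸[F]) : AdeleQuot F) := fun a => rfl
  have hmc : Continuous m := by
    refine isQuotientMap_quotient_mk'.continuous_iff.2 ?_
    exact QuotientAddGroup.continuous_mk.comp (continuous_const.mul continuous_id)
  have hms : Function.Surjective m := by
    intro x
    obtain ⟨a, rfl⟩ := QuotientAddGroup.mk_surjective x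
    refine ⟨((algebraMap F 𝔸[F] (ξ⁻¹ : Fˣ) * a : 𝔸[F]) : AdeleQuot F), ?_⟩
    rw [hm, ← mul_assoc, ← map_mul, Units.mul_inv, map_one, one_mul]
  have hmp := AddMonoidHom.measurePreserving (μ := adeleHaar F) (ν := adeleHaar F) hmc hms rfl
  have hfm : AEStronglyMeasurable (fun x : AdeleQuot F => f x.out)
      (Measure.map m (adeleHaar F)) := by
    rw [hmp.map_eq]
    exact (integrable_of_continuous (hf.continuous_out hc)).aestronglyMeasurable
  have h := integral_map hmc.measurable.aemeasurable hfm
  rw [hmp.map_eq] at h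
  rw [h]
  refine integral_congr_ae (Filter.Eventually.of_forall fun x => ?_)
  dsimp only
  conv_rhs => rw [← QuotientAddGroup.out_eq' x, hm, hf.out]

/-! ### Fourier coefficients and Fourier inversion -/

open ComplexConjugate

section Classical

open scoped Classical

/-- The Fourier coefficient `∫_{𝔸/F} f(x) conj(ψ(ξx)) dx`. -/
def fourierCoef (ψ : AddChar 𝔸[F] Circle) (f : 𝔸[F] → ℂ) (ξ : F) : ℂ :=
  ∫ x : AdeleQuot F, f x.out * conj (ψ (algebraMap F 𝔸[F] ξ * x.out) : ℂ) ∂(adeleHaar F)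

/-- The functions on `𝔸` which are invariant under `F` and under `N · Ô`, and smooth in the
archimedean variable. -/
structure IsNice (N : ℕ) (f : 𝔸[F] → ℂ) : Prop where
  periodic : IsPeriodic f
  fin : ∀ a, ∀ u ∈ intBall F N, f (a + finEmb u) = f a
  smooth : ∀ a, ContDiff ℝ ((⊤ : ℕ∞) : WithTop ℕ∞)
    fun t : mixedEmbedding.mixedSpace F => f (a + infEmb t)

/-- The derivative of `f` in the archimedean direction `α`. -/
def dirDeriv (α : mixedEmbedding.mixedSpace F) (f : 𝔸[F] → ℂ) : 𝔸[F] → ℂ := fun a =>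
  fderiv ℝ (fun t : mixedEmbedding.mixedSpace F => f (a + infEmb t)) 0 α

namespace IsNice

variable {N : ℕ} {f g : 𝔸[F] → ℂ}

theorem continuous (hf : IsNice N f) (hN : 0 < N) : Continuous f := by
  refine continuous_iff_continuousAt.2 fun a => ?_
  have h1 : Continuous fun b : 𝔸[F] => f (a + infEmb (toMixed (b - a))) :=
    (hf.smooth a).continuous.comp (continuous_toMixed.comp (continuous_id.sub continuous_const))
  refine h1.continuousAt.congr ?_
  refine Filter.mem_of_superset (intBall_mem_nhds hN one_pos a) fun b hb => ?_
  have e : a + infEmb (toMixed (b - a)) + finEmb (b - a).2 = b := by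
    rw [add_assoc, infEmb_add_finEmb]; ring
  change f (a + infEmb (toMixed (b - a))) = f b
  rw [← hf.fin _ _ hb.2, e]

theorem sub (hf : IsNice N f) (hg : IsNice N g) : IsNice N (fun a => f a - g a) where
  periodic a q := congrArg₂ _ (hf.periodic a q) (hg.periodic a q)
  fin a u hu := congrArg₂ _ (hf.fin a u hu) (hg.fin a u hu)
  smooth a := (hf.smooth a).sub (hg.smooth a)

theorem const_mul (hf : IsNice N f) (c : ℂ) : IsNice N (fun a => f a * c) where
  periodic a q := congrArg (· * c) (hf.periodic a q)
  fin a u hu := congrArg (· * c) (hf.fin a u hu)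
  smooth a := (hf.smooth a).mul contDiff_const

theorem dirDeriv_add_infEmb (α t : mixedEmbedding.mixedSpace F) (a : 𝔸[F]) :
    dirDeriv α f (a + infEmb t) =
      fderiv ℝ (fun t : mixedEmbedding.mixedSpace F => f (a + infEmb t)) t α := by
  have h := fderiv_comp_add_left (𝕜 := ℝ)
    (f := fun t : mixedEmbedding.mixedSpace F => f (a + infEmb t)) (x := 0) t
  rw [add_zero] at h
  rw [← h, dirDeriv]
  simp only [map_add, add_assoc]

theorem dirDeriv (hf : IsNice N f) (α : mixedEmbedding.mixedSpace F) :
    IsNice N (dirDeriv α f) where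
  periodic a q := by
    have : (fun t : mixedEmbedding.mixedSpace F => f (a + algebraMap F 𝔸[F] q + infEmb t)) =
        fun t => f (a + infEmb t) := funext fun t => by
      rw [add_right_comm, hf.periodic]
    rw [Metaplectic.dirDeriv, this]; rfl
  fin a u hu := by
    have : (fun t : mixedEmbedding.mixedSpace F => f (a + finEmb u + infEmb t)) =
        fun t => f (a + infEmb t) := funext fun t => by
      rw [add_right_comm, hf.fin _ u hu]
    rw [Metaplectic.dirDeriv, this]; rfl
  smooth a := by
    have h : ContDiff ℝ ((⊤ : ℕ∞) : WithTop ℕ∞)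
        (fderiv ℝ (fun t : mixedEmbedding.mixedSpace F => f (a + infEmb t))) :=
      (hf.smooth a).fderiv_right le_rfl
    have h' := h.clm_apply (contDiff_const (c := α))
    have e : (fun t => Metaplectic.dirDeriv α f (a + infEmb t)) = _ :=
      funext fun t => dirDeriv_add_infEmb α t a
    rwa [e]

theorem hasDerivAt_line (hf : IsNice N f) (α : mixedEmbedding.mixedSpace F) (a : 𝔸[F]) (s : ℝ) :
    HasDerivAt (fun s : ℝ => f (a + infEmb (s • α)))
      (Metaplectic.dirDeriv α f (a + infEmb (s • α))) s := by
  rw [dirDeriv_add_infEmb]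
  have h1 : HasDerivAt (fun s : ℝ => s • α) α s := by
    simpa using (hasDerivAt_id s).smul_const α
  exact (((hf.smooth a).differentiable (by simp)).differentiableAt.hasFDerivAt).comp_hasDerivAt s h1

end IsNice

variable {ψ : AddChar 𝔸[F] Circle} (hψ : Continuous ψ) (hψF : ∀ x : F, ψ (algebraMap F 𝔸[F] x) = 1)

theorem fourierCoef_const_mul (f : 𝔸[F] → ℂ) (c : ℂ) (ξ : F) :
    fourierCoef ψ (fun a => f a * c) ξ = fourierCoef ψ f ξ * c := by
  rw [fourierCoef, fourierCoef, ← integral_mul_const]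
  congr 1; funext x; ring

include hψF in
theorem isPeriodic_addChar (ξ : F) : IsPeriodic fun a => ψ (algebraMap F 𝔸[F] ξ * a) := by
  intro a q
  dsimp only
  rw [mul_add, ← map_mul, AddChar.map_add_eq_mul, hψF, mul_one]

include hψ hψF

omit hψF in
theorem continuous_addChar_mul (ξ : F) : Continuous fun a => (ψ (algebraMap F 𝔸[F] ξ * a) : ℂ) :=
  continuous_subtype_val.comp (hψ.comp (continuous_const.mul continuous_id))

theorem continuous_addChar_out (ξ : F) :
    Continuous fun x : AdeleQuot F => (ψ (algebraMap F 𝔸[F] ξ * x.out) : ℂ) :=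
  IsPeriodic.continuous_out (f := fun a : 𝔸[F] => (ψ (algebraMap F 𝔸[F] ξ * a) : ℂ))
    (fun a q => congrArg _ (isPeriodic_addChar hψF ξ a q)) (continuous_addChar_mul hψ ξ)

theorem integrable_mul_addChar {f : 𝔸[F] → ℂ} (hf : IsPeriodic f) (hc : Continuous f) (ξ : F) :
    Integrable (fun x : AdeleQuot F => f x.out * conj (ψ (algebraMap F 𝔸[F] ξ * x.out) : ℂ))
      (adeleHaar F) :=
  integrable_of_continuous ((hf.continuous_out hc).mul
    (Complex.continuous_conj.comp (continuous_addChar_out hψ hψF ξ)))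

theorem fourierCoef_sub {f g : 𝔸[F] → ℂ} (hf : IsPeriodic f) (hfc : Continuous f)
    (hg : IsPeriodic g) (hgc : Continuous g) (ξ : F) :
    fourierCoef ψ (fun a => f a - g a) ξ = fourierCoef ψ f ξ - fourierCoef ψ g ξ := by
  rw [fourierCoef, fourierCoef, fourierCoef, ← integral_sub
    (integrable_mul_addChar hψ hψF hf hfc ξ) (integrable_mul_addChar hψ hψF hg hgc ξ)]
  congr 1; funext x; ring

omit hψ in
theorem fourierCoef_translate {f : 𝔸[F] → ℂ} (hf : IsPeriodic f) (b : 𝔸[F]) (ξ : F) :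
    fourierCoef ψ (fun a => f (a + b)) ξ = ψ (algebraMap F 𝔸[F] ξ * b) * fourierCoef ψ f ξ := by
  have hp : IsPeriodic fun a => f a * conj (ψ (algebraMap F 𝔸[F] ξ * a) : ℂ) := fun a q =>
    congrArg₂ (fun (z : ℂ) (w : Circle) => z * conj (w : ℂ)) (hf a q) (isPeriodic_addChar hψF ξ a q)
  rw [fourierCoef, fourierCoef, ← hp.integral_add b, ← integral_const_mul]
  congr 1; funext x
  have h1 : (ψ (algebraMap F 𝔸[F] ξ * b) : ℂ) * conj (ψ (algebraMap F 𝔸[F] ξ * b) : ℂ) = 1 := by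
    rw [Complex.mul_conj, Circle.normSq_coe, Complex.ofReal_one]
  rw [mul_add, AddChar.map_add_eq_mul, Circle.coe_mul, map_mul (starRingEnd ℂ)]
  linear_combination (-f (x.out + b) * conj (ψ (algebraMap F 𝔸[F] ξ * x.out) : ℂ)) * h1

/-- Fourier inversion on `𝔸 / F`. The characters `x ↦ ψ(ξx)` separate points because the annihilator
of `F` is `F` itself. -/
theorem hasSum_fourierCoef (hne : ψ ≠ 1) {f : 𝔸[F] → ℂ} (hf : IsPeriodic f) (hc : Continuous f)
    (hs : Summable fun ξ => ‖fourierCoef ψ f ξ‖) (a : 𝔸[F]) :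
    HasSum (fun ξ : F => fourierCoef ψ f ξ * ψ (algebraMap F 𝔸[F] ξ * a)) (f a) := by
  let e : F → C(AdeleQuot F, ℂ) := fun ξ => ⟨_, continuous_addChar_out hψ hψF ξ⟩
  have he : ∀ ξ (x : AdeleQuot F), e ξ x = (ψ (algebraMap F 𝔸[F] ξ * x.out) : ℂ) := fun _ _ => rfl
  have hconj : ∀ ξ (x : AdeleQuot F), conj (e ξ x) = e (-ξ) x := fun ξ x => by
    rw [he, he, map_neg, neg_mul, AddChar.map_neg_eq_inv, Circle.coe_inv_eq_conj]
  have hmul : ∀ ξ η, e (ξ + η) = e ξ * e η := fun ξ η => ContinuousMap.ext fun x => by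
    rw [ContinuousMap.mul_apply, he, he, he, map_add, add_mul, AddChar.map_add_eq_mul,
      Circle.coe_mul]
  have h0 : e 0 = 1 := ContinuousMap.ext fun x => by simp [he]
  have hprod : ∀ ξ η (x : AdeleQuot F), e ξ x * conj (e η x) = e (ξ - η) x := fun ξ η x => by
    rw [hconj, sub_eq_add_neg, hmul, ContinuousMap.mul_apply]
  have key := hasSum_of_summable_coefficients (ν := adeleHaar F) (e := e) ⟨0, h0⟩
    (fun ξ η => ⟨ξ + η, hmul ξ η⟩)
    (fun ξ => ⟨-ξ, ContinuousMap.ext fun x => (hconj ξ x).symm⟩) ?_ ?_ ?_ ?_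
    ⟨_, hf.continuous_out hc⟩ hs (a : AdeleQuot F)
  · have h1 : ∀ ξ, e ξ (a : AdeleQuot F) = ψ (algebraMap F 𝔸[F] ξ * a) := fun ξ => by
      rw [he]
      exact congrArg _ ((isPeriodic_addChar hψF ξ).out a)
    simp only [h1] at key
    rw [← hf.out a]
    exact key
  · intro x y hxy
    by_contra! h
    refine hxy ?_
    have h2 : ∀ q : F, ψ (algebraMap F 𝔸[F] q * (y.out - x.out)) = 1 := fun q => by
      rw [mul_sub, AddChar.map_sub_eq_div, div_eq_one]
      exact Circle.ext (h q).symm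
    obtain ⟨q, hq⟩ := exists_rational_of_addChar_mul_eq_one hψ hψF hne h2
    rw [← QuotientAddGroup.out_eq' x, ← QuotientAddGroup.out_eq' y, eq_comm,
      QuotientAddGroup.eq_iff_sub_mem]
    exact ⟨q, hq⟩
  · intro ξ
    exact (ContinuousMap.norm_le _ zero_le_one).2 fun x => (Circle.norm_coe _).le
  · intro ξ
    simp [hprod, h0]
  · intro ξ η hξη
    simp only [hprod]
    have hξη' : ξ - η ≠ 0 := sub_ne_zero.2 hξη
    obtain ⟨b, hb⟩ : ∃ b, ψ (algebraMap F 𝔸[F] (ξ - η) * b) ≠ 1 := by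
      by_contra! h
      refine hne (DFunLike.ext _ _ fun a => ?_)
      have := h (algebraMap F 𝔸[F] (ξ - η)⁻¹ * a)
      rwa [← mul_assoc, ← map_mul, mul_inv_cancel₀ hξη', map_one, one_mul] at this
    have hp : IsPeriodic fun a => (ψ (algebraMap F 𝔸[F] (ξ - η) * a) : ℂ) :=
      fun a q => congrArg _ (isPeriodic_addChar hψF (ξ - η) a q)
    have h3 := hp.integral_add b
    simp only [mul_add, AddChar.map_add_eq_mul, Circle.coe_mul] at h3
    rw [integral_mul_const] at h3
    change ∫ x : AdeleQuot F, (ψ (algebraMap F 𝔸[F] (ξ - η) * x.out) : ℂ) ∂(adeleHaar F) = 0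
    by_contra hI
    exact hb (Circle.ext (mul_left_cancel₀ hI (h3.trans (mul_one _).symm)))

end Classical

/-! ### Absolute convergence of Fourier series -/

/-- A multiplicative function on `ℝ` which is differentiable at `0` is an exponential. -/
theorem eq_exp_of_hasDerivAt {u : ℝ → ℂ} {κ : ℂ} (h0 : u 0 = 1) (hu : HasDerivAt u κ 0)
    (hmul : ∀ s t, u (s + t) = u s * u t) (s : ℝ) : u s = Complex.exp (κ * s) := by
  have hd : ∀ s, HasDerivAt u (u s * κ) s := fun s => by
    have h1 : HasDerivAt (fun x => u s * u (x - s)) (u s * κ) s := by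
      refine HasDerivAt.const_mul _ ?_
      have h2 : HasDerivAt u κ (s - s) := by rwa [sub_self]
      exact HasDerivAt.comp_sub_const s s h2
    refine h1.congr_of_eventuallyEq (Filter.Eventually.of_forall fun x => ?_)
    dsimp only
    rw [← hmul, add_sub_cancel]
  have hexp : ∀ s : ℝ, HasDerivAt (fun x : ℝ => Complex.exp (-(κ * x)))
      (Complex.exp (-(κ * s)) * -(κ * 1)) s := fun s => by
    refine HasDerivAt.cexp (HasDerivAt.neg (HasDerivAt.const_mul _ ?_))
    exact Complex.ofRealCLM.hasDerivAt
  have hg : ∀ s, HasDerivAt (fun x : ℝ => u x * Complex.exp (-(κ * x))) 0 s := fun s => by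
    exact ((hd s).fun_mul (hexp s)).congr_deriv (by ring)
  have hconst := is_const_of_deriv_eq_zero (fun s => (hg s).differentiableAt)
    (fun s => (hg s).deriv) s 0
  simp only [Complex.ofReal_zero, mul_zero, neg_zero, Complex.exp_zero, h0, mul_one] at hconst
  rw [Complex.exp_neg, mul_inv_eq_one₀ (Complex.exp_ne_zero _)] at hconst
  exact hconst

theorem addChar_map_sum {ι A M : Type*} [AddCommMonoid A] [CommMonoid M] (ψ : AddChar A M)
    (s : Finset ι) (f : ι → A) : ψ (∑ i ∈ s, f i) = ∏ i ∈ s, ψ (f i) := by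
  classical
  induction s using Finset.induction_on with
  | empty => simp
  | insert i s hi ih => rw [Finset.sum_insert hi, Finset.prod_insert hi, AddChar.map_add_eq_mul, ih]

theorem summable_prod_inv_one_add_sq (ι : Type*) [Fintype ι] :
    Summable fun m : ι → ℤ => ∏ i, (1 + (2 * Real.pi * m i) ^ 2)⁻¹ := by
  classical
  have h1 : Summable fun n : ℤ => (1 + (2 * Real.pi * n) ^ 2)⁻¹ := by
    refine Summable.of_norm_bounded_eventually
      (Real.summable_one_div_int_pow (p := 2).2 (by norm_num)) ?_
    have : {n : ℤ | ¬ ‖(1 + (2 * Real.pi * n) ^ 2 : ℝ)⁻¹‖ ≤ 1 / (n : ℝ) ^ 2}.Finite := by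
      refine (Set.finite_singleton (0 : ℤ)).subset fun n hn => ?_
      by_contra hn0
      refine hn ?_
      have hn0 : (n : ℝ) ≠ 0 := Int.cast_ne_zero.2 hn0
      rw [norm_inv, one_div, Real.norm_of_nonneg (by positivity)]
      refine inv_anti₀ (by positivity) ?_
      have h3 : (1 : ℝ) ≤ (2 * Real.pi) ^ 2 := by nlinarith [Real.pi_gt_three]
      rw [mul_pow]
      nlinarith [sq_nonneg (n : ℝ)]
    exact this
  refine summable_of_sum_le (c := (∑' n : ℤ, (1 + (2 * Real.pi * n) ^ 2 : ℝ)⁻¹) ^ Fintype.card ι)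
    (fun m => Finset.prod_nonneg fun i _ => by positivity) fun u => ?_
  have hsub : u ⊆ Fintype.piFinset fun i => u.image (fun m => m i) := fun m hm =>
    Fintype.mem_piFinset.2 fun i => Finset.mem_image_of_mem _ hm
  refine (Finset.sum_le_sum_of_subset_of_nonneg hsub fun m _ _ =>
    Finset.prod_nonneg fun i _ => by positivity).trans ?_
  rw [← Finset.prod_univ_sum (fun i => u.image (fun m => m i))
    (fun _ n => (1 + (2 * Real.pi * (n : ℤ)) ^ 2 : ℝ)⁻¹), ← Finset.card_univ, ← Finset.prod_const]
  exact Finset.prod_le_prod (fun i _ => Finset.sum_nonneg fun n _ => by positivity) fun i _ =>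
    h1.sum_le_tsum _ fun n _ => by positivity

section Classical

open scoped Classical

variable {ψ : AddChar 𝔸[F] Circle} (hψ : Continuous ψ) (hψF : ∀ x : F, ψ (algebraMap F 𝔸[F] x) = 1)
  {N : ℕ} (hN : 0 < N) {f : 𝔸[F] → ℂ}

theorem infEmb_add_smul (α : mixedEmbedding.mixedSpace F) (s t : ℝ) :
    (infEmb ((s + t) • α) : 𝔸[F]) = infEmb (s • α) + infEmb (t • α) := by
  rw [add_smul, map_add]

include hψF in
theorem addChar_finEmb_eq_one_of_fourierCoef_ne_zero (hf : IsNice N f) {ξ : F}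
    (hξ : fourierCoef ψ f ξ ≠ 0) {u : FinAdele F} (hu : u ∈ intBall F N) :
    ψ (algebraMap F 𝔸[F] ξ * finEmb u) = 1 := by
  have h := fourierCoef_translate hψF hf.periodic (finEmb u) ξ
  simp only [hf.fin _ u hu] at h
  exact Circle.ext (mul_right_cancel₀ hξ (h.symm.trans (one_mul _).symm))

include hψ hψF hN

/-- The Fourier coefficients of the translates of `f` in the direction `α` are
`ψ(ξ s α) · fourierCoef ψ f ξ`, and may be differentiated under the integral. This gives the
differentiability of `s ↦ ψ(ξ s α)` whenever the coefficient does not vanish. -/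
theorem hasDerivAt_addChar_mul_fourierCoef (hf : IsNice N f) (α : mixedEmbedding.mixedSpace F)
    (ξ : F) : HasDerivAt
      (fun s : ℝ => (ψ (algebraMap F 𝔸[F] ξ * infEmb (s • α)) : ℂ) * fourierCoef ψ f ξ)
      (fourierCoef ψ (dirDeriv α f) ξ) 0 := by
  simp only [← fourierCoef_translate hψF hf.periodic]
  have hD := hf.dirDeriv α
  have hshift : ∀ {g : 𝔸[F] → ℂ} (_ : IsNice N g) (b : 𝔸[F]),
      IsPeriodic (fun a => g (a + b)) ∧ Continuous fun a => g (a + b) := fun hg b =>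
    ⟨fun a q => by
      dsimp only
      rw [add_right_comm]; exact hg.periodic _ q,
      (hg.continuous hN).comp (continuous_id.add continuous_const)⟩
  obtain ⟨B, hB⟩ :=
    (isCompact_range (hD.periodic.continuous_out (hD.continuous hN))).isBounded.exists_norm_le
  have hB' : ∀ a, ‖dirDeriv α f a‖ ≤ B := fun a => by
    rw [← hD.periodic.out a]
    exact hB _ ⟨_, rfl⟩
  have hD0 : fourierCoef ψ (dirDeriv α f) ξ = ∫ x : AdeleQuot F, dirDeriv α f (x.out +
      infEmb ((0 : ℝ) • α)) * conj (ψ (algebraMap F 𝔸[F] ξ * x.out) : ℂ) ∂(adeleHaar F) := by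
    simp only [zero_smul, map_zero, add_zero]
    rfl
  rw [hD0]
  refine (hasDerivAt_integral_of_dominated_loc_of_deriv_le (bound := fun _ => B) (s := Set.univ)
    (F := fun (s : ℝ) (x : AdeleQuot F) => f (x.out + infEmb (s • α)) *
      conj (ψ (algebraMap F 𝔸[F] ξ * x.out) : ℂ))
    (F' := fun (s : ℝ) (x : AdeleQuot F) => dirDeriv α f (x.out + infEmb (s • α)) *
      conj (ψ (algebraMap F 𝔸[F] ξ * x.out) : ℂ)) Filter.univ_mem ?_ ?_ ?_ ?_ ?_ ?_).2
  · exact Filter.Eventually.of_forall fun s => (integrable_mul_addChar hψ hψF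
      (hshift hf _).1 (hshift hf _).2 ξ).aestronglyMeasurable
  · exact integrable_mul_addChar hψ hψF (hshift hf _).1 (hshift hf _).2 ξ
  · exact (integrable_mul_addChar hψ hψF (hshift hD _).1 (hshift hD _).2 ξ).aestronglyMeasurable
  · refine Filter.Eventually.of_forall fun x s _ => ?_
    rw [norm_mul, RCLike.norm_conj]
    exact (mul_le_of_le_one_right (norm_nonneg _) (Circle.norm_coe _).le).trans (hB' _)
  · exact integrable_const B
  · exact Filter.Eventually.of_forall fun x s _ => (hf.hasDerivAt_line α x.out s).mul_const _

/-- The frequency of the character `s ↦ ψ(ξ s α)` of `ℝ` is an integer if `ψ(ξ α) = 1`. -/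
theorem exists_int_of_fourierCoef_ne_zero (hf : IsNice N f) {ξ : F} (hξ : fourierCoef ψ f ξ ≠ 0)
    {α : mixedEmbedding.mixedSpace F} (hα : ψ (algebraMap F 𝔸[F] ξ * infEmb α) = 1) :
    ∃ n : ℤ, ∀ s : ℝ, (ψ (algebraMap F 𝔸[F] ξ * infEmb (s • α)) : ℂ) =
      Complex.exp (2 * Real.pi * Complex.I * n * s) := by
  have h := (hasDerivAt_addChar_mul_fourierCoef hψ hψF hN hf α ξ).mul_const (fourierCoef ψ f ξ)⁻¹
  simp only [mul_assoc, mul_inv_cancel₀ hξ, mul_one] at h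
  have key := eq_exp_of_hasDerivAt (by simp) h fun s t => by
    rw [infEmb_add_smul, mul_add, AddChar.map_add_eq_mul, Circle.coe_mul]
  have h1 := key 1
  rw [one_smul, hα, Circle.coe_one, Complex.ofReal_one, mul_one, eq_comm,
    Complex.exp_eq_one_iff] at h1
  obtain ⟨n, hn⟩ := h1
  refine ⟨n, fun s => ?_⟩
  rw [key, hn]
  congr 1; ring

theorem fourierCoef_dirDeriv (hf : IsNice N f) {ξ : F} {α : mixedEmbedding.mixedSpace F} {n : ℤ}
    (hn : ∀ s : ℝ, (ψ (algebraMap F 𝔸[F] ξ * infEmb (s • α)) : ℂ) =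
      Complex.exp (2 * Real.pi * Complex.I * n * s)) :
    fourierCoef ψ (dirDeriv α f) ξ = 2 * Real.pi * Complex.I * n * fourierCoef ψ f ξ := by
  have h1 := hasDerivAt_addChar_mul_fourierCoef hψ hψF hN hf α ξ
  simp only [hn] at h1
  have h2 : HasDerivAt (fun s : ℝ => Complex.exp (2 * Real.pi * Complex.I * n * s))
      (Complex.exp (2 * Real.pi * Complex.I * n * (0 : ℝ)) * (2 * Real.pi * Complex.I * n * 1)) 0 :=
    HasDerivAt.cexp (HasDerivAt.const_mul _ Complex.ofRealCLM.hasDerivAt)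
  have h3 := h1.unique (h2.mul_const _)
  rw [h3]
  simp

/-- The operator `1 - D_α²` multiplies the Fourier coefficient by `1 + (2πn)²`. -/
theorem fourierCoef_sub_dirDeriv_dirDeriv (hf : IsNice N f) {ξ : F}
    {α : mixedEmbedding.mixedSpace F} {n : ℤ}
    (hn : ∀ s : ℝ, (ψ (algebraMap F 𝔸[F] ξ * infEmb (s • α)) : ℂ) =
      Complex.exp (2 * Real.pi * Complex.I * n * s)) :
    fourierCoef ψ (fun a => f a - dirDeriv α (dirDeriv α f) a) ξ =
      ((1 + (2 * Real.pi * n) ^ 2 : ℝ) : ℂ) * fourierCoef ψ f ξ := by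
  have h2 := (hf.dirDeriv α).dirDeriv α
  rw [fourierCoef_sub hψ hψF hf.periodic (hf.continuous hN) h2.periodic (h2.continuous hN),
    fourierCoef_dirDeriv hψ hψF hN (hf.dirDeriv α) hn, fourierCoef_dirDeriv hψ hψF hN hf hn]
  push_cast
  linear_combination (-(2 * Real.pi * n) ^ 2 * fourierCoef ψ f ξ) * Complex.I_sq

/-- The Fourier series of a function which is smooth in the archimedean variable and invariant
under an open subgroup of the finite adeles converges absolutely. -/
theorem IsNice.summable_fourierCoef (hne : ψ ≠ 1) (hf : IsNice N f) :
    Summable fun ξ => ‖fourierCoef ψ f ξ‖ := by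
  let b := mixedEmbedding.latticeBasis F
  let X : Set F := {ξ | fourierCoef ψ f ξ ≠ 0}
  -- if the coefficient at `ξ` does not vanish, then `t ↦ ψ(ξt)` is trivial on the lattice `N · 𝓞 F`
  have hα : ∀ ξ ∈ X, ∀ j, ψ (algebraMap F 𝔸[F] ξ * infEmb ((N : ℝ) • b j)) = 1 := by
    intro ξ hξ j
    let r : F := N * integralBasis F j
    have hr : infEmb ((N : ℝ) • b j) =
        algebraMap F 𝔸[F] r - finEmb (algebraMap F (FinAdele F) r) := by
      rw [eq_sub_iff_add_eq]
      have := infEmb_add_finEmb (algebraMap F 𝔸[F] r)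
      rw [toMixed_algebraMap] at this
      convert this using 3
      · rw [map_mul, map_natCast, Nat.cast_smul_eq_nsmul, nsmul_eq_mul]
        congr 1
        exact mixedEmbedding.latticeBasis_apply F j
      · rfl
    have hmem : algebraMap F (FinAdele F) r ∈ intBall F N := fun v => by
      rw [algebraMap_finAdele_apply, map_mul, map_mul, map_natCast, integralBasis_apply]
      exact (mul_le_mul' le_rfl (valued_int_le_one v _)).trans_eq (mul_one _)
    rw [hr, mul_sub, ← map_mul, AddChar.map_sub_eq_div, hψF,
      addChar_finEmb_eq_one_of_fourierCoef_ne_zero hψF hf hξ hmem, div_one]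
  have hn : ∀ ξ : X, ∀ j, ∃ n : ℤ, ∀ s : ℝ,
      (ψ (algebraMap F 𝔸[F] ξ * infEmb (s • ((N : ℝ) • b j))) : ℂ) =
        Complex.exp (2 * Real.pi * Complex.I * n * s) := fun ξ j =>
    exists_int_of_fourierCoef_ne_zero hψ hψF hN hf ξ.2 (hα ξ ξ.2 j)
  choose n hn using hn
  have hN0 : (N : ℝ) ≠ 0 := Nat.cast_ne_zero.2 hN.ne'
  -- the frequencies determine the character
  have hinj : Function.Injective n := by
    intro ξ η hξη
    have hchar : ∀ t : mixedEmbedding.mixedSpace F,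
        ψ (algebraMap F 𝔸[F] ξ * infEmb t) = ψ (algebraMap F 𝔸[F] η * infEmb t) := by
      intro t
      have ht : infEmb t = ∑ j, infEmb ((b.repr t j * (N : ℝ)⁻¹) • ((N : ℝ) • b j)) := by
        rw [← map_sum]
        congr 1
        conv_lhs => rw [← b.sum_repr t]
        refine Finset.sum_congr rfl fun j _ => ?_
        rw [smul_smul, mul_assoc, inv_mul_cancel₀ hN0, mul_one]
      rw [ht, Finset.mul_sum, Finset.mul_sum, addChar_map_sum, addChar_map_sum]
      refine Finset.prod_congr rfl fun j _ => Circle.ext ?_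
      rw [hn, hn, hξη]
    by_contra hne'
    have hne'' : (ξ : F) - η ≠ 0 := sub_ne_zero.2 fun h => hne' (Subtype.ext h)
    have hall : ∀ a : 𝔸[F], ψ (algebraMap F 𝔸[F] (ξ - η) * a) = 1 := by
      intro a
      obtain ⟨q, hq⟩ := exists_sub_integral (algebraMap F (FinAdele F) (N : F)⁻¹ * a.2)
      let c := a - algebraMap F 𝔸[F] (N * q)
      have hc : c.2 ∈ intBall F N := fun v => by
        have h0 := natCast_ne_zero v hN
        have e : c.2 v = (N : v.adicCompletion F) *
            (algebraMap F (FinAdele F) (N : F)⁻¹ * a.2 - algebraMap F (FinAdele F) q) v := by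
          change a.2 v - algebraMap F (v.adicCompletion F) (N * q) = N *
            (algebraMap F (v.adicCompletion F) (N : F)⁻¹ * a.2 v -
              algebraMap F (v.adicCompletion F) q)
          rw [map_inv₀, map_mul, map_natCast]
          field_simp
        rw [e, map_mul]
        exact (mul_le_mul' le_rfl (hq v)).trans_eq (mul_one _)
      have ea : a = algebraMap F 𝔸[F] (N * q) + (infEmb (toMixed c) + finEmb c.2) := by
        rw [infEmb_add_finEmb]; ring
      rw [ea, mul_add, mul_add, ← map_mul, AddChar.map_add_eq_mul, AddChar.map_add_eq_mul, hψF,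
        map_sub, sub_mul, sub_mul, AddChar.map_sub_eq_div, AddChar.map_sub_eq_div, hchar,
        addChar_finEmb_eq_one_of_fourierCoef_ne_zero hψF hf ξ.2 hc,
        addChar_finEmb_eq_one_of_fourierCoef_ne_zero hψF hf η.2 hc, div_self', div_one, one_mul,
        one_mul]
    refine hne (DFunLike.ext _ _ fun a => ?_)
    have := hall (algebraMap F 𝔸[F] ((ξ : F) - η)⁻¹ * a)
    rwa [← mul_assoc, ← map_mul, mul_inv_cancel₀ hne'', map_one, one_mul] at this
  -- apply the operator `∏ (1 - D_j ^ 2)`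
  have hop : ∀ s : Finset (Module.Free.ChooseBasisIndex ℤ (𝓞 F)), ∃ g : 𝔸[F] → ℂ, IsNice N g ∧
      ∀ ξ : X, fourierCoef ψ g ξ =
        ((∏ j ∈ s, (1 + (2 * Real.pi * n ξ j) ^ 2) : ℝ) : ℂ) * fourierCoef ψ f ξ := by
    intro s
    induction s using Finset.induction_on with
    | empty => exact ⟨f, hf, fun ξ => by simp⟩
    | insert j s hj ih =>
      obtain ⟨g, hg, hgc⟩ := ih
      refine ⟨_, hg.sub ((hg.dirDeriv ((N : ℝ) • b j)).dirDeriv ((N : ℝ) • b j)), fun ξ => ?_⟩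
      rw [fourierCoef_sub_dirDeriv_dirDeriv hψ hψF hN hg (hn ξ j), hgc, Finset.prod_insert hj,
        Complex.ofReal_mul, mul_assoc (Complex.ofReal _)]
  obtain ⟨g, hg, hgc⟩ := hop Finset.univ
  obtain ⟨B, hB⟩ :=
    (isCompact_range (hg.periodic.continuous_out (hg.continuous hN))).isBounded.exists_norm_le
  have hbound : ∀ ξ : F, ‖fourierCoef ψ g ξ‖ ≤ B := fun ξ => by
    have := norm_integral_le_of_norm_le_const (μ := adeleHaar F) (C := B)
      (f := fun x : AdeleQuot F => g x.out * conj (ψ (algebraMap F 𝔸[F] ξ * x.out) : ℂ))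
      (Filter.Eventually.of_forall fun x => by
        rw [norm_mul, RCLike.norm_conj]
        exact (mul_le_of_le_one_right (norm_nonneg _) (Circle.norm_coe _).le).trans (hB _ ⟨x, rfl⟩))
    rwa [probReal_univ, mul_one] at this
  have hX : Summable fun ξ : X => ‖fourierCoef ψ f ξ‖ := by
    refine Summable.of_nonneg_of_le (fun _ => norm_nonneg _) (fun ξ => ?_)
      (((summable_prod_inv_one_add_sq (Module.Free.ChooseBasisIndex ℤ (𝓞 F))).comp_injective
        hinj).mul_left B)
    have hpos : 0 < ∏ j, (1 + (2 * Real.pi * n ξ j) ^ 2) := Finset.prod_pos fun j _ => by positivity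
    have h1 := hbound ξ
    rw [hgc, norm_mul, Complex.norm_real, Real.norm_of_nonneg hpos.le] at h1
    rw [Function.comp_apply, Finset.prod_inv_distrib, ← div_eq_mul_inv, le_div_iff₀ hpos, mul_comm]
    exact h1
  refine (Function.Injective.summable_iff Subtype.val_injective fun ξ hξ => ?_).1 hX
  rw [Subtype.range_coe_subtype] at hξ
  simpa [X] using hξ

end Classical

/-! ### Smoothness of cusp forms along unipotent translates -/

section Conj

variable {R : Type*} [CommRing R]

theorem conj_nMat_apply (g : GL (Fin 2) R) (u : R) (i j : Fin 2) :
    (g⁻¹ * nMat u * g) i j =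
      (1 : Matrix (Fin 2) (Fin 2) R) i j + (g⁻¹ : GL (Fin 2) R) i 0 * u * g 1 j := by
  have h0 := congrArg Units.val (inv_mul_cancel g)
  have h := congrFun (congrFun h0 i) j
  rw [Units.val_mul, Matrix.mul_apply, Fin.sum_univ_two, Units.val_one] at h
  rw [← h, Units.val_mul, Units.val_mul, Matrix.mul_apply, Fin.sum_univ_two, Matrix.mul_apply,
    Matrix.mul_apply, Fin.sum_univ_two, Fin.sum_univ_two]
  simp [nMat]
  ring

end Conj

/-- The projection `𝔸 → 𝔸_f`. -/
def toFin : 𝔸[F] →+* FinAdele F := RingHom.snd (InfiniteAdeleRing F) (FinAdele F)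

section Classical

open scoped Classical

omit [NumberField F] in
/-- The exponential of a matrix of square zero. -/
theorem exp_eq_one_add_of_sq_eq_zero {X : LieG F} (h : X * X = 0) : NormedSpace.exp X = 1 + X := by
  rw [NormedSpace.exp_eq_tsum ℝ]
  dsimp only
  rw [tsum_eq_sum (s := Finset.range 2), Finset.sum_range_succ, Finset.sum_range_one]
  · simp
  · intro n hn
    rw [Finset.mem_range, not_lt] at hn
    obtain ⟨k, rfl⟩ := Nat.exists_eq_add_of_le' hn
    rw [pow_add, pow_two, h, mul_zero, smul_zero]

/-- The nilpotent matrix `g₀⁻¹ (0 t; 0 0) g₀` in the Lie algebra. -/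
def nilMat (g₀ : GL (Fin 2) 𝔸[F]) (t : mixedEmbedding.mixedSpace F) :
    Fin 2 → Fin 2 → mixedEmbedding.mixedSpace F :=
  fun i j => toMixed ((g₀⁻¹ : GL (Fin 2) 𝔸[F]) i 0) * toMixed (g₀ 1 j) * t

theorem nilMat_mul_nilMat (g₀ : GL (Fin 2) 𝔸[F]) (t : mixedEmbedding.mixedSpace F) :
    (Matrix.of (nilMat g₀ t) : LieG F) * Matrix.of (nilMat g₀ t) = 0 := by
  have h0 := congrArg Units.val (mul_inv_cancel g₀)
  have h := congrFun (congrFun h0 1) 0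
  rw [Units.val_mul, Matrix.mul_apply, Fin.sum_univ_two, Units.val_one,
    Matrix.one_apply_ne (by decide)] at h
  replace h := congrArg toMixed h
  rw [map_add, map_mul, map_mul, map_zero] at h
  ext1 i j
  rw [Matrix.mul_apply, Fin.sum_univ_two]
  simp only [Matrix.of_apply, nilMat, Matrix.zero_apply]
  linear_combination (toMixed ((g₀⁻¹ : GL (Fin 2) 𝔸[F]) i 0) * toMixed (g₀ 1 j) * t * t) * h

theorem ofMixed_expG_nilMat (g₀ : GL (Fin 2) 𝔸[F]) (t : mixedEmbedding.mixedSpace F) :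
    ofMixed (expG (Matrix.of (nilMat g₀ t))) = g₀⁻¹ * nMat (infEmb t) * g₀ := by
  have h1 : ((expG (Matrix.of (nilMat g₀ t)) : GL (Fin 2) (mixedEmbedding.mixedSpace F)) : LieG F) =
      1 + Matrix.of (nilMat g₀ t) := exp_eq_one_add_of_sq_eq_zero (nilMat_mul_nilMat g₀ t)
  apply Units.ext
  ext1 i j
  rw [conj_nMat_apply]
  have h2 : (g₀⁻¹ : GL (Fin 2) 𝔸[F]) i 0 * infEmb t * g₀ 1 j = infEmb (nilMat g₀ t i j) := by
    rw [nilMat, mul_assoc (toMixed _), infEmb_toMixed_mul, infEmb_toMixed_mul]; ring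
  have h3 : (ofMixed (expG (Matrix.of (nilMat g₀ t))) : Matrix (Fin 2) (Fin 2) 𝔸[F]) i j =
      ((InfiniteAdeleRing.ringEquiv_mixedSpace F).symm
        ((expG (Matrix.of (nilMat g₀ t)) : LieG F) i j),
          (1 : Matrix (Fin 2) (Fin 2) (FinAdele F)) i j) :=
    rfl
  rw [h2, h3, h1, Matrix.add_apply, map_add, Matrix.of_apply]
  by_cases hij : i = j
  · subst hij
    simp only [Matrix.one_apply_eq, map_one]
    exact Prod.ext rfl (add_zero (1 : FinAdele F)).symm
  · simp only [Matrix.one_apply_ne hij, map_zero]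
    exact Prod.ext rfl (add_zero (0 : FinAdele F)).symm

theorem sAdele_conj_nMat_infEmb (g₀ : GL (Fin 2) 𝔸[F]) (t : mixedEmbedding.mixedSpace F) :
    sAdele (g₀⁻¹ * nMat (infEmb t) * g₀) = 1 := by
  refine sAdele_eq_one_of_entry_eq_zero fun v => Or.inl ?_
  change evFin v ((g₀⁻¹ * nMat (infEmb t) * g₀) 1 0) = 0
  rw [conj_nMat_apply, Matrix.one_apply_ne (by decide), zero_add, map_mul, map_mul]
  have : evFin v (infEmb t) = 0 := rfl
  rw [this, mul_zero, zero_mul]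

variable {φ : MetaGL2 F → ℂ} (hφ : IsGenuineCuspForm φ) {g₀ : GL (Fin 2) 𝔸[F]} {e : 𝔸[F]ˣ}
  (hb : IsBase g₀ e)

include hφ hb

/-- An archimedean translation of `x` is right translation by the exponential of a nilpotent
element of the Lie algebra. -/
theorem IsGenuineCuspForm.elt_add_infEmb (y : 𝔸[F]ˣ) (x : 𝔸[F])
    (t : mixedEmbedding.mixedSpace F) :
    φ (elt g₀ y (x + infEmb t)) = φ (elt g₀ y x * expStar (Matrix.of (nilMat g₀ t))) := by
  rw [hφ.elt_add_adele hb, sAdele_conj_nMat_infEmb, expStar, ofMixed_expG_nilMat]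
  simp [rightTranslate]

theorem IsGenuineCuspForm.contDiff_elt (y : 𝔸[F]ˣ) (x : 𝔸[F]) :
    ContDiff ℝ ((⊤ : ℕ∞) : WithTop ℕ∞)
      fun t : mixedEmbedding.mixedSpace F => φ (elt g₀ y (x + infEmb t)) := by
  refine contDiff_iff_contDiffAt.2 fun t₀ => ?_
  have hX : ContDiff ℝ ((⊤ : ℕ∞) : WithTop ℕ∞)
      (fun t : mixedEmbedding.mixedSpace F => nilMat g₀ (t - t₀)) :=
    contDiff_pi.2 fun i => contDiff_pi.2 fun j => contDiff_const.mul
      (contDiff_id.sub contDiff_const)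
  have h0 : nilMat g₀ (t₀ - t₀) = 0 := by
    funext i j
    simp [nilMat]
  have h1 := hφ.smooth.2 (elt g₀ y (x + infEmb t₀))
  rw [← h0] at h1
  have h2 := ContDiffAt.comp t₀ h1 hX.contDiffAt
  refine h2.congr_of_eventuallyEq (Filter.Eventually.of_forall fun t => ?_)
  dsimp only [Function.comp]
  rw [← hφ.elt_add_infEmb hb, add_assoc, ← map_add, add_sub_cancel]

omit hφ hb in
theorem continuous_nMat {R : Type*} [CommRing R] [TopologicalSpace R] [IsTopologicalRing R] :
    Continuous (nMat : R → GL (Fin 2) R) := by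
  refine Units.continuous_iff.2 ⟨continuous_matrix fun i j => ?_, continuous_matrix fun i j => ?_⟩
  · fin_cases i <;> fin_cases j
    exacts [continuous_const, continuous_id, continuous_const, continuous_const]
  · fin_cases i <;> fin_cases j
    exacts [continuous_const, continuous_neg, continuous_const, continuous_const]

omit hφ hb in
theorem ofFin_conj_nMat (g₀ : GL (Fin 2) 𝔸[F]) (u : FinAdele F) :
    ofFin ((Matrix.GeneralLinearGroup.map (toFin) g₀)⁻¹ *
      nMat u * Matrix.GeneralLinearGroup.map (toFin) g₀) =
      g₀⁻¹ * nMat (finEmb u) * g₀ := by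
  set c := Matrix.GeneralLinearGroup.map (toFin) g₀ with hc
  have hci : ∀ i j, (c⁻¹ : GL (Fin 2) (FinAdele F)) i j = ((g₀⁻¹ : GL (Fin 2) 𝔸[F]) i j).2 :=
    fun i j => by rw [hc, ← map_inv]; rfl
  apply Units.ext
  ext1 i j
  rw [conj_nMat_apply]
  have h3 : (ofFin (c⁻¹ * nMat u * c) : Matrix (Fin 2) (Fin 2) 𝔸[F]) i j =
      ((1 : Matrix (Fin 2) (Fin 2) (InfiniteAdeleRing F)) i j, (c⁻¹ * nMat u * c) i j) := rfl
  have h4 : (g₀⁻¹ : GL (Fin 2) 𝔸[F]) i 0 * finEmb u * g₀ 1 j =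
      finEmb ((c⁻¹ : GL (Fin 2) (FinAdele F)) i 0 * u * c 1 j) := by
    rw [hci]
    refine Prod.ext ?_ rfl
    change ((g₀⁻¹ : GL (Fin 2) 𝔸[F]) i 0).1 * 0 * (g₀ 1 j).1 = 0
    rw [mul_zero, zero_mul]
  rw [h3, h4, conj_nMat_apply]
  by_cases hij : i = j
  · subst hij
    simp only [Matrix.one_apply_eq]
    exact Prod.ext (add_zero (1 : InfiniteAdeleRing F)).symm rfl
  · simp only [Matrix.one_apply_ne hij]
    exact Prod.ext (add_zero (0 : InfiniteAdeleRing F)).symm rfl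

/-- The functions `x ↦ φ(z(y)^* n(x)^* g₀^*)` are nice, with a level independent of `y`. -/
theorem IsGenuineCuspForm.exists_isNice :
    ∃ N : ℕ, 0 < N ∧ ∀ y : 𝔸[F]ˣ, IsNice N fun x => φ (elt g₀ y x) := by
  obtain ⟨U, hU, hUφ⟩ := hφ.smooth.1
  set c := Matrix.GeneralLinearGroup.map (toFin) g₀ with hc
  have hcont : Continuous fun u : FinAdele F => c⁻¹ * nMat u * c :=
    (continuous_const.mul continuous_nMat).mul continuous_const
  have h0 : {u : FinAdele F | c⁻¹ * nMat u * c ∈ U} ∈ nhds 0 := by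
    refine (hU.preimage hcont).mem_nhds ?_
    change c⁻¹ * nMat 0 * c ∈ U
    rw [nMat_zero, mul_one, inv_mul_cancel]
    exact U.one_mem
  obtain ⟨N, hN, hNU⟩ := exists_intBall_subset h0
  have hN2 : 0 < 2 * N := by omega
  refine ⟨2 * N, hN2, fun y => ⟨fun a q => hφ.elt_add_rational hb y a q, fun a u hu => ?_,
    fun a => hφ.contDiff_elt hb y a⟩⟩
  -- translation by `finEmb u` may introduce a sign; it cancels as `u` is twice an element of
  -- `N · Ô`
  have hsgn : ∀ a, ∀ u ∈ intBall F N, φ (elt g₀ y (a + finEmb u)) =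
      ((sAdele (g₀⁻¹ * nMat (finEmb u) * g₀) : ℤˣ) : ℤ) * φ (elt g₀ y a) := fun a u hu => by
    rw [hφ.elt_add_adele hb, ← ofFin_conj_nMat, hUφ _ (hNU hu)]
  let u' : FinAdele F := algebraMap F (FinAdele F) 2⁻¹ * u
  have hu2 : u = u' + u' := by
    rw [← two_mul, ← map_ofNat (algebraMap F (FinAdele F)) 2, ← mul_assoc, ← map_mul,
      mul_inv_cancel₀ two_ne_zero, map_one, one_mul]
  have hu' : u' ∈ intBall F N := fun v => by
    have h2 : ((2 : ℕ) : v.adicCompletion F) ≠ 0 := natCast_ne_zero v two_pos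
    have h3 := hu v
    have h4 : u v = ((2 : ℕ) : v.adicCompletion F) * u' v := by
      change u v = ((2 : ℕ) : v.adicCompletion F) * (algebraMap F (v.adicCompletion F) 2⁻¹ * u v)
      rw [map_inv₀, map_ofNat, Nat.cast_ofNat]
      rw [Nat.cast_ofNat] at h2
      rw [mul_inv_cancel_left₀ h2]
    rw [h4, Nat.cast_mul, map_mul, map_mul] at h3
    exact (mul_le_mul_iff_right₀ (zero_lt_iff.2 ((Valuation.ne_zero_iff _).2 h2))).1 h3
  rw [hu2, map_add, ← add_assoc, hsgn _ _ hu', hsgn _ _ hu', ← mul_assoc, sgn_mul_self, one_mul]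

end Classical

/-! ### Compactness of `𝔸ˣ / Fˣ (𝔸ˣ)²` -/

open scoped nonZeroDivisors

theorem valued_algebraMap_eq_exp_neg_count (v : FinPl F) {x : F} (hx : x ≠ 0) :
    Valued.v (algebraMap F (v.adicCompletion F) x) =
      WithZero.exp (-(FractionalIdeal.count F v (FractionalIdeal.spanSingleton (𝓞 F)⁰ x))) := by
  classical
  have h0 : Valued.v (algebraMap F (v.adicCompletion F) x) = v.valuation F x :=
    HeightOneSpectrum.valuedAdicCompletion_eq_valuation' v x
  obtain ⟨n, d, hd, rfl⟩ := IsFractionRing.div_surjective (A := 𝓞 F) x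
  have hd0 : d ≠ 0 := nonZeroDivisors.ne_zero hd
  have hn0 : n ≠ 0 := by rintro rfl; simp at hx
  have hne : FractionalIdeal.spanSingleton (𝓞 F)⁰ 
      (algebraMap (𝓞 F) F n / algebraMap (𝓞 F) F d) ≠ 0 :=
    FractionalIdeal.spanSingleton_ne_zero_iff.2 hx
  rw [h0, FractionalIdeal.count_well_defined F v hne (a := d) (J := Ideal.span {n}), map_div₀,
    HeightOneSpectrum.valuation_of_algebraMap, HeightOneSpectrum.valuation_of_algebraMap,
    HeightOneSpectrum.intValuation_if_neg _ hn0, HeightOneSpectrum.intValuation_if_neg _ hd0,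
    ← WithZero.exp_sub]
  · congr 1; ring
  · rw [FractionalIdeal.coeIdeal_span_singleton, FractionalIdeal.spanSingleton_mul_spanSingleton,
      div_eq_mul_inv, mul_comm]

/-- The fractional ideal attached to an idele. -/
def ideleIdeal (a : 𝔸[F]ˣ) : FractionalIdeal (𝓞 F)⁰ F :=
  ∏ᶠ v : FinPl F, (v.asIdeal : FractionalIdeal (𝓞 F)⁰ F) ^
    (-WithZero.log (Valued.v (evFin v (a : 𝔸[F]))))

theorem valued_idele_ne_zero (a : 𝔸[F]ˣ) (v : FinPl F) : Valued.v (evFin v (a : 𝔸[F])) ≠ 0 :=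
  (Valuation.ne_zero_iff _).2 (evFin_ne_zero v a)

theorem ideleIdeal_ne_zero (a : 𝔸[F]ˣ) : ideleIdeal a ≠ 0 := by
  refine finprod_induction (fun I : FractionalIdeal (𝓞 F)⁰ F => I ≠ 0) one_ne_zero
    (fun _ _ => mul_ne_zero) fun v => zpow_ne_zero _ ?_
  exact FractionalIdeal.coeIdeal_ne_zero.2 v.ne_bot

theorem count_ideleIdeal (a : 𝔸[F]ˣ) (v : FinPl F) :
    FractionalIdeal.count F v (ideleIdeal a) = -WithZero.log (Valued.v (evFin v (a : 𝔸[F]))) := by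
  refine FractionalIdeal.count_finprod F v
    (fun v : FinPl F => -WithZero.log (Valued.v (evFin v (a : 𝔸[F])))) ?_
  refine (idele_finite_valued_ne_one a).subset fun w hw h => hw ?_
  change -WithZero.log (Valued.v (evFin w (a : 𝔸[F]))) = 0
  rw [h, WithZero.log_one, neg_zero]

/-- Finiteness of the class number, for ideles: there are finitely many ideles which represent all
ideles up to `Fˣ` and up to integral units at the finite places. -/
theorem exists_finite_representatives : ∃ Y : Set 𝔸[F]ˣ, Y.Finite ∧ ∀ a : 𝔸[F]ˣ, ∃ y ∈ Y,
    ∃ x : Fˣ, ∀ v : FinPl F, Valued.v (evFin v ((a * (y * principal x)⁻¹ : 𝔸[F]ˣ) : 𝔸[F])) = 1 := by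
  let Q := (FractionalIdeal (𝓞 F)⁰ F)ˣ ⧸ (toPrincipalIdeal (𝓞 F) F).range
  have hQ : Finite Q := Finite.of_equiv _ (ClassGroup.equiv (R := 𝓞 F) F).toEquiv
  let cl : 𝔸[F]ˣ → Q := fun a => QuotientGroup.mk (Units.mk0 _ (ideleIdeal_ne_zero a))
  let rep : Q → 𝔸[F]ˣ := Function.invFun cl
  refine ⟨Set.range rep, Set.finite_range rep, fun a => ⟨_, ⟨cl a, rfl⟩, ?_⟩⟩
  have h : cl (rep (cl a)) = cl a := Function.invFun_eq ⟨a, rfl⟩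
  obtain ⟨x, hx⟩ := QuotientGroup.eq.1 h
  refine ⟨x, fun v => ?_⟩
  have h1 := congrArg Units.val (eq_inv_mul_iff_mul_eq.1 hx)
  rw [Units.val_mul, coe_toPrincipalIdeal, Units.val_mk0, Units.val_mk0] at h1
  have h2 := congrArg (FractionalIdeal.count F v) h1
  rw [FractionalIdeal.count_mul F v (ideleIdeal_ne_zero _)
    (FractionalIdeal.spanSingleton_ne_zero_iff.2 x.ne_zero), count_ideleIdeal,
    count_ideleIdeal] at h2
  have h3 := valued_algebraMap_eq_exp_neg_count v x.ne_zero
  have h4 : Valued.v (evFin v ((rep (cl a) * principal x : 𝔸[F]ˣ) : 𝔸[F])) =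
      Valued.v (evFin v (a : 𝔸[F])) := by
    have h5 : evFin v ((principal x : 𝔸[F]ˣ) : 𝔸[F]) = algebraMap F (v.adicCompletion F) x := rfl
    rw [Units.val_mul, map_mul, map_mul, h5, h3, ← WithZero.exp_log (valued_idele_ne_zero a v),
      ← WithZero.exp_log (valued_idele_ne_zero (rep (cl a)) v), ← WithZero.exp_add]
    congr 1
    linarith
  have h6 := congrArg (fun b : 𝔸[F]ˣ => Valued.v (evFin v (b : 𝔸[F])))
    (inv_mul_cancel_right a (rep (cl a) * principal x))
  rw [Units.val_mul, map_mul, map_mul, h4] at h6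
  exact (mul_eq_right₀ (valued_idele_ne_zero a v)).1 h6

section Classical

open scoped Classical

/-- The idele with given archimedean component, and finite component `1`. -/
def infIdele : (mixedEmbedding.mixedSpace F)ˣ →* 𝔸[F]ˣ :=
  (MulEquiv.prodUnits (M := InfiniteAdeleRing F) (N := FinAdele F)).symm.toMonoidHom.comp
    ((MonoidHom.inl (InfiniteAdeleRing F)ˣ (FinAdele F)ˣ).comp
      (Units.map (InfiniteAdeleRing.ringEquiv_mixedSpace F).symm.toRingHom.toMonoidHom))

theorem toMixed_infIdele (t : (mixedEmbedding.mixedSpace F)ˣ) :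
    toMixed (infIdele t : 𝔸[F]) = t :=
  RingEquiv.apply_symm_apply (InfiniteAdeleRing.ringEquiv_mixedSpace F) t

theorem evFin_infIdele (t : (mixedEmbedding.mixedSpace F)ˣ) (v : FinPl F) :
    evFin v (infIdele t : 𝔸[F]) = 1 := rfl

omit [NumberField F] in
theorem mixedSpace_isUnit_iff {t : mixedEmbedding.mixedSpace F} :
    IsUnit t ↔ (∀ w, t.1 w ≠ 0) ∧ ∀ w, t.2 w ≠ 0 := by
  rw [Prod.isUnit_iff, Pi.isUnit_iff, Pi.isUnit_iff]
  simp only [isUnit_iff_ne_zero]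

/-- Multiplication by the square of an archimedean idele makes all archimedean absolute values equal
to `1`. -/
theorem exists_norm_mul_sq_eq_one (c : 𝔸[F]ˣ) : ∃ t : 𝔸[F]ˣ,
    (∀ v : FinPl F, evFin v (t : 𝔸[F]) = 1) ∧
    ‖toMixed ((c * t ^ 2 : 𝔸[F]ˣ) : 𝔸[F])‖ ≤ 1 ∧
      ‖toMixed (((c * t ^ 2)⁻¹ : 𝔸[F]ˣ) : 𝔸[F])‖ ≤ 1 := by
  set m := toMixed (c : 𝔸[F]) with hm
  have hmu : IsUnit m := c.isUnit.map toMixed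
  obtain ⟨h1, h2⟩ := mixedSpace_isUnit_iff.1 hmu
  let t : mixedEmbedding.mixedSpace F :=
    (fun w => (Real.sqrt ‖m.1 w‖)⁻¹, fun w => (((Real.sqrt ‖m.2 w‖)⁻¹ : ℝ) : ℂ))
  have hs1 : ∀ w, Real.sqrt ‖m.1 w‖ ≠ 0 := fun w => (Real.sqrt_pos.2 (norm_pos_iff.2 (h1 w))).ne'
  have hs2 : ∀ w, Real.sqrt ‖m.2 w‖ ≠ 0 := fun w => (Real.sqrt_pos.2 (norm_pos_iff.2 (h2 w))).ne'
  have ht : IsUnit t := mixedSpace_isUnit_iff.2 ⟨fun w => inv_ne_zero (hs1 w),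
    fun w => Complex.ofReal_ne_zero.2 (inv_ne_zero (hs2 w))⟩
  have hcomp : ∀ z : mixedEmbedding.mixedSpace F,
      (∀ w, ‖z.1 w‖ = 1) → (∀ w, ‖z.2 w‖ = 1) → ‖z‖ ≤ 1 :=
    fun z hz1 hz2 => max_le ((pi_norm_le_iff_of_nonneg zero_le_one).2 fun w => (hz1 w).le)
      ((pi_norm_le_iff_of_nonneg zero_le_one).2 fun w => (hz2 w).le)
  set b : 𝔸[F]ˣ := c * infIdele ht.unit ^ 2 with hb
  have hbm : toMixed (b : 𝔸[F]) = m * t ^ 2 := by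
    rw [hb, Units.val_mul, Units.val_pow_eq_pow_val, map_mul, map_pow, toMixed_infIdele]
    rfl
  have hb1 : ∀ w, ‖(toMixed (b : 𝔸[F])).1 w‖ = 1 := fun w => by
    rw [hbm]
    change ‖m.1 w * ((Real.sqrt ‖m.1 w‖)⁻¹) ^ 2‖ = 1
    rw [norm_mul, norm_pow, norm_inv, Real.norm_of_nonneg (Real.sqrt_nonneg _), inv_pow,
      Real.sq_sqrt (norm_nonneg _), mul_inv_cancel₀ (norm_ne_zero_iff.2 (h1 w))]
  have hb2 : ∀ w, ‖(toMixed (b : 𝔸[F])).2 w‖ = 1 := fun w => by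
    rw [hbm]
    change ‖m.2 w * (((Real.sqrt ‖m.2 w‖)⁻¹ : ℝ) : ℂ) ^ 2‖ = 1
    rw [norm_mul, norm_pow, Complex.norm_real, norm_inv, Real.norm_of_nonneg (Real.sqrt_nonneg _),
      inv_pow, Real.sq_sqrt (norm_nonneg _), mul_inv_cancel₀ (norm_ne_zero_iff.2 (h2 w))]
  have hbi : toMixed (b : 𝔸[F]) * toMixed ((b⁻¹ : 𝔸[F]ˣ) : 𝔸[F]) = 1 := by
    rw [← map_mul, Units.mul_inv, map_one]
  refine ⟨infIdele ht.unit, fun v => evFin_infIdele _ v, hcomp _ hb1 hb2, hcomp _ (fun w => ?_)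
    fun w => ?_⟩
  · have h3 := congrArg norm (congrFun (congrArg Prod.fst hbi) w)
    change ‖(toMixed (b : 𝔸[F])).1 w * (toMixed ((b⁻¹ : 𝔸[F]ˣ) : 𝔸[F])).1 w‖ = ‖(1 : ℝ)‖ at h3
    rwa [norm_mul, hb1, one_mul, norm_one] at h3
  · have h3 := congrArg norm (congrFun (congrArg Prod.snd hbi) w)
    change ‖(toMixed (b : 𝔸[F])).2 w * (toMixed ((b⁻¹ : 𝔸[F]ˣ) : 𝔸[F])).2 w‖ = ‖(1 : ℂ)‖ at h3
    rwa [norm_mul, hb2, one_mul, norm_one] at h3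

theorem isCompact_unit_ideles : IsCompact {u : 𝔸[F]ˣ |
    (‖toMixed (u : 𝔸[F])‖ ≤ 1 ∧ ∀ v, Valued.v (evFin v (u : 𝔸[F])) ≤ 1) ∧
    (‖toMixed ((u⁻¹ : 𝔸[F]ˣ) : 𝔸[F])‖ ≤ 1 ∧
      ∀ v, Valued.v (evFin v ((u⁻¹ : 𝔸[F]ˣ) : 𝔸[F])) ≤ 1)} := by
  have hK : IsCompact {a : 𝔸[F] | ‖toMixed a‖ ≤ 1 ∧ ∀ v, Valued.v (evFin v a) ≤ 1} := by
    have h := ((isCompact_closedBall (0 : mixedEmbedding.mixedSpace F) 1).prod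
      (isCompact_valued_le_one (F := F))).image
      ((continuous_infEmb.comp continuous_fst).add (continuous_finEmb.comp continuous_snd))
    convert h using 1
    ext a
    constructor
    · rintro ⟨ha, ha'⟩
      exact ⟨(toMixed a, a.2), ⟨mem_closedBall_zero_iff.2 ha, ha'⟩, infEmb_add_finEmb a⟩
    · rintro ⟨⟨t, u⟩, ⟨ht, hu⟩, rfl⟩
      refine ⟨?_, fun v => ?_⟩
      · change ‖toMixed (infEmb t + finEmb u)‖ ≤ 1
        have : toMixed (finEmb u) = 0 := map_zero (InfiniteAdeleRing.ringEquiv_mixedSpace F)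
        rw [map_add, toMixed_infEmb, this, add_zero]
        exact mem_closedBall_zero_iff.1 ht
      · have : evFin v (infEmb t + finEmb u) = u v := zero_add _
        change Valued.v (evFin v (infEmb t + finEmb u)) ≤ 1
        rw [this]
        exact hu v
  have h1 : T2Space (FinAdele F) := inferInstanceAs (T2Space (RestrictedProduct
    (fun v : FinPl F => v.adicCompletion F)
    (fun v : FinPl F => (v.adicCompletionIntegers F : Set (v.adicCompletion F))) Filter.cofinite))
  have h2 : T2Space (InfiniteAdeleRing F) :=
    inferInstanceAs (T2Space ((v : InfinitePlace F) → v.Completion))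
  have h3 : T2Space 𝔸[F] := inferInstanceAs (T2Space (InfiniteAdeleRing F × FinAdele F))
  have h4 := (Units.isClosedEmbedding_embedProduct (α := 𝔸[F])).isCompact_preimage
    (hK.prod (hK.image MulOpposite.continuous_op))
  convert h4 using 1
  ext u
  refine and_congr Iff.rfl ⟨fun h => ⟨_, h, rfl⟩, ?_⟩
  rintro ⟨b, hb, hbu⟩
  have : b = ((u⁻¹ : 𝔸[F]ˣ) : 𝔸[F]) := MulOpposite.op_injective hbu
  rwa [this] at hb

instance : BorelSpace (IdeleQuot F) := ⟨rfl⟩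

instance : CompactSpace (IdeleQuot F) := by
  obtain ⟨Y, hY, h⟩ := exists_finite_representatives (F := F)
  refine ⟨?_⟩
  have hc : IsCompact (⋃ y ∈ Y, (fun u : 𝔸[F]ˣ => ((y * u : 𝔸[F]ˣ) : IdeleQuot F)) '' _) :=
    hY.isCompact_biUnion fun y _ => isCompact_unit_ideles.image
      (QuotientGroup.continuous_mk.comp (continuous_const.mul continuous_id))
  convert hc
  refine (Set.eq_univ_of_forall fun z => ?_).symm
  obtain ⟨a, rfl⟩ := QuotientGroup.mk_surjective z
  obtain ⟨y, hy, x, hx⟩ := h a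
  obtain ⟨t, ht, ht1, ht2⟩ := exists_norm_mul_sq_eq_one (a * (y * principal x)⁻¹)
  -- `a` agrees with `y * u` modulo `F^× (𝔸^×)²`, with `u` in the compact set of unit ideles
  refine Set.mem_biUnion hy
    ⟨a * (y * principal x)⁻¹ * t ^ 2, ⟨⟨ht1, fun v => ?_⟩, ht2, fun v => ?_⟩, ?_⟩
  · rw [Units.val_mul, Units.val_pow_eq_pow_val, map_mul, map_pow, ht, one_pow, mul_one, hx]
  · have h1 := evFin_ne_zero v (a * (y * principal x)⁻¹ * t ^ 2)
    have h2 : Valued.v (evFin v ((a * (y * principal x)⁻¹ * t ^ 2 : 𝔸[F]ˣ) : 𝔸[F])) = 1 := by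
      rw [Units.val_mul, Units.val_pow_eq_pow_val, map_mul, map_pow, ht, one_pow, mul_one, hx]
    have h3 : evFin v ((a * (y * principal x)⁻¹ * t ^ 2 : 𝔸[F]ˣ) : 𝔸[F]) *
        evFin v (((a * (y * principal x)⁻¹ * t ^ 2)⁻¹ : 𝔸[F]ˣ) : 𝔸[F]) = 1 := by
      rw [← map_mul, Units.mul_inv, map_one]
    have h4 := congrArg Valued.v h3
    rw [map_mul, h2, one_mul, map_one] at h4
    exact h4.le
  · refine QuotientGroup.eq.2 ?_
    have e : (y * (a * (y * principal x)⁻¹ * t ^ 2))⁻¹ * a = principal x * (t⁻¹) ^ 2 := by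
      generalize hc : a * (y * principal x)⁻¹ = c
      have ha : a = c * (y * principal x) := by rw [← hc, inv_mul_cancel_right]
      rw [inv_mul_eq_iff_eq_mul, ha]
      ext1
      simp only [Units.val_mul, Units.val_pow_eq_pow_val]
      linear_combination (-(c : 𝔸[F]) * y * (principal x : 𝔸[F]ˣ) *
        ((t : 𝔸[F]) * (t⁻¹ : 𝔸[F]ˣ) + 1)) * t.mul_inv
    rw [e]
    exact mul_mem (Subgroup.mem_sup_left ⟨x, rfl⟩) (Subgroup.mem_sup_right ⟨t⁻¹, rfl⟩)

end Classical

theorem ideleHaar_spec : (ideleHaar F).IsHaarMeasure ∧ IsProbabilityMeasure (ideleHaar F) := by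
  have h : ∃ ν : Measure (IdeleQuot F), ν.IsHaarMeasure ∧ IsProbabilityMeasure ν :=
    ⟨Measure.haarMeasure ⊤, inferInstance, ⟨by
      simpa using Measure.haarMeasure_self (K₀ := (⊤ : TopologicalSpace.PositiveCompacts
        (IdeleQuot F)))⟩⟩
  rw [ideleHaar, dif_pos h]
  exact h.choose_spec

instance : (ideleHaar F).IsHaarMeasure := ideleHaar_spec.1

instance : IsProbabilityMeasure (ideleHaar F) := ideleHaar_spec.2

/-! ### Fourier inversion for locally constant functions on a compact abelian group -/

section FiniteInversion

variable {G : Type*} [CommGroup G] [TopologicalSpace G] [IsTopologicalGroup G] [CompactSpace G]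
  [MeasurableSpace G] [BorelSpace G] {ν : Measure G} [ν.IsHaarMeasure] [IsProbabilityMeasure ν]
  {H : Subgroup G} (hH : IsOpen (H : Set G))

include hH

omit [CompactSpace G] [MeasurableSpace G] [BorelSpace G] in
theorem continuous_of_forall_mul_eq {X : Type*} [TopologicalSpace X] {g : G → X}
    (hg : ∀ y, ∀ h ∈ H, g (y * h) = g y) : Continuous g := by
  refine continuous_iff_continuousAt.2 fun y => ?_
  refine continuousAt_const.congr (Filter.mem_of_superset (x := (fun z => y⁻¹ * z) ⁻¹' H) ?_ ?_)
    (f := fun _ => g y)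
  · refine (hH.preimage (continuous_const.mul continuous_id)).mem_nhds ?_
    change y⁻¹ * y ∈ H
    rw [inv_mul_cancel]
    exact H.one_mem
  · intro z hz
    have := hg y _ hz
    rw [mul_inv_cancel_left] at this
    exact this.symm

omit hH [CompactSpace G] [IsProbabilityMeasure ν] in
theorem integral_mul_inv_eq_zero {g : G → ℂ} (hg : ∀ y, ∀ h ∈ H, g (y * h) = g y) (χ : G →* ℂˣ)
    {h : G} (hh : h ∈ H) (hχ : χ h ≠ 1) : ∫ y, g y * ((χ y)⁻¹ : ℂˣ) ∂ν = 0 := by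
  have h1 := integral_mul_right_eq_self (μ := ν) (fun y => g y * ((χ y)⁻¹ : ℂˣ)) h
  simp only [hg _ h hh, map_mul, mul_inv, Units.val_mul, ← mul_assoc] at h1
  rw [integral_mul_const] at h1
  by_contra h0
  have h2 := mul_left_cancel₀ h0 (h1.trans (mul_one _).symm)
  exact hχ (inv_eq_one.1 (Units.ext h2))

omit [MeasurableSpace G] [BorelSpace G] in
theorem finite_quotient_of_isOpen : Finite (G ⧸ H) :=
  have := QuotientGroup.discreteTopology hH
  finite_of_compact_of_discrete

/-- Fourier inversion at the identity for a function which is invariant under an open subgroup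
`H`: only the finitely many characters of `G ⧸ H` contribute. -/
theorem sum_integral_mul_inv [Fintype (G ⧸ H →* ℂˣ)] {g : G → ℂ}
    (hg : ∀ y, ∀ h ∈ H, g (y * h) = g y) :
    ∑ χ : G ⧸ H →* ℂˣ, ∫ y, g y * ((χ (y : G ⧸ H))⁻¹ : ℂˣ) ∂ν = g 1 := by
  classical
  have hfin := finite_quotient_of_isOpen hH
  -- orthogonality of the characters of the finite group `G ⧸ H`
  have horth : ∀ d : G ⧸ H, d ≠ 1 → ∑ χ : G ⧸ H →* ℂˣ, (((χ d)⁻¹ : ℂˣ) : ℂ) = 0 := by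
    intro d hd
    have : NeZero (Monoid.exponent (G ⧸ H)) := ⟨Monoid.exponent_ne_zero_of_finite⟩
    obtain ⟨χ₀, h0⟩ := CommGroup.exists_apply_ne_one_of_hasEnoughRootsOfUnity (G ⧸ H) ℂ hd
    have h1 : ∑ χ : G ⧸ H →* ℂˣ, (((χ d)⁻¹ : ℂˣ) : ℂ) =
        ∑ χ : G ⧸ H →* ℂˣ, ((((χ * χ₀) d)⁻¹ : ℂˣ) : ℂ) :=
      (Fintype.sum_equiv (Equiv.mulRight χ₀) _ _ fun χ => rfl).symm
    simp only [MonoidHom.mul_apply, mul_inv, Units.val_mul] at h1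
    rw [← Finset.sum_mul] at h1
    by_contra h2
    exact h0 (inv_eq_one.1 (Units.ext (mul_left_cancel₀ h2 (h1.symm.trans (mul_one _).symm))))
  have hχ : ∀ (χ : G ⧸ H →* ℂˣ) (y : G), ∀ h ∈ H, χ ((y * h : G) : G ⧸ H) = χ (y : G ⧸ H) :=
    fun χ y h hh => by
      rw [QuotientGroup.mk_mul, (QuotientGroup.eq_one_iff h).2 hh, mul_one]
  have hint : ∀ (g : G → ℂ) (_ : ∀ y, ∀ h ∈ H, g (y * h) = g y) (χ : G ⧸ H →* ℂˣ),
      Integrable (fun y => g y * ((χ (y : G ⧸ H))⁻¹ : ℂˣ)) ν := fun g hg χ =>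
    integrable_of_continuous (continuous_of_forall_mul_eq hH fun y h hh => by
      rw [hg y h hh, hχ χ y h hh])
  set n : ℂ := (Fintype.card (G ⧸ H →* ℂˣ) : ℂ) with hn
  have hsum : ∀ (g : G → ℂ) (_ : ∀ y, ∀ h ∈ H, g (y * h) = g y),
      ∑ χ : G ⧸ H →* ℂˣ, ∫ y, g y * ((χ (y : G ⧸ H))⁻¹ : ℂˣ) ∂ν =
        g 1 * ∫ y, (if y ∈ H then n else 0) ∂ν := fun g hg => by
    rw [← integral_finsetSum _ fun χ _ => hint g hg χ, ← integral_const_mul]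
    congr 1
    funext y
    rw [← Finset.mul_sum]
    by_cases hy : y ∈ H
    · have h1 := hg 1 y hy
      rw [one_mul] at h1
      simp [hy, (QuotientGroup.eq_one_iff y).2 hy, h1, hn]
    · rw [horth _ (fun h => hy ((QuotientGroup.eq_one_iff y).1 h)), if_neg hy, mul_zero, mul_zero]
  have hone : ∑ χ : G ⧸ H →* ℂˣ, ∫ y, (1 : ℂ) * ((χ (y : G ⧸ H))⁻¹ : ℂˣ) ∂ν = 1 := by
    rw [Finset.sum_eq_single 1]
    · simp
    · intro χ _ hne
      obtain ⟨h, hh⟩ : ∃ h : G, χ (h : G ⧸ H) ≠ 1 := by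
        by_contra! h
        refine hne (MonoidHom.ext fun d => ?_)
        obtain ⟨y, rfl⟩ := QuotientGroup.mk_surjective d
        exact h y
      exact integral_mul_inv_eq_zero (H := ⊤) (g := fun _ => (1 : ℂ)) (fun _ _ _ => rfl)
        (χ.comp (QuotientGroup.mk' H)) (Subgroup.mem_top h) hh
    · simp
  have h1 := hsum (fun _ => 1) fun _ _ _ => rfl
  rw [hone, one_mul] at h1
  rw [hsum g hg, ← h1, mul_one]

/-- Fourier inversion at the identity, for a summable family of functions on `G` which are invariant
under an open subgroup `H`, and over any set of characters which contains those trivial on `H`. -/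
theorem summable_and_tsum_integral_mul_inv {X ι : Type*} {χ : X → G →* ℂˣ}
    (hχ : Function.Injective χ) (hχH : ∀ θ : G →* ℂˣ, (∀ h ∈ H, θ h = 1) → ∃ μ, χ μ = θ)
    {c : ι → G → ℂ} (hc : ∀ ξ y, ∀ h ∈ H, c ξ (y * h) = c ξ y)
    (hs : ∀ y, Summable fun ξ => ‖c ξ y‖) {u : ι → ℂ} (hu : ∀ ξ, ‖u ξ‖ = 1) :
    Summable (fun p : X × ι => (∫ y, c p.2 y * ((χ p.1 y)⁻¹ : ℂˣ) ∂ν) * u p.2) ∧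
      ∑' μ, ∑' ξ, (∫ y, c ξ y * ((χ μ y)⁻¹ : ℂˣ) ∂ν) * u ξ = ∑' ξ, c ξ 1 * u ξ := by
  classical
  have hfin : Finite (G ⧸ H) := finite_quotient_of_isOpen hH
  have : Fintype (G ⧸ H) := Fintype.ofFinite _
  have : NeZero (Monoid.exponent (G ⧸ H)) := ⟨Monoid.exponent_ne_zero_of_finite⟩
  have : Finite (G ⧸ H →* ℂˣ) := Finite.of_equiv _
    (CommGroup.monoidHom_mulEquiv_of_hasEnoughRootsOfUnity (G ⧸ H) ℂ).some.symm.toEquiv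
  have : Fintype (G ⧸ H →* ℂˣ) := Fintype.ofFinite _
  choose Θ hΘ using fun θ : G ⧸ H →* ℂˣ => hχH (θ.comp (QuotientGroup.mk' H)) fun h hh => by
    rw [MonoidHom.comp_apply, QuotientGroup.mk'_apply, (QuotientGroup.eq_one_iff h).2 hh, map_one]
  have hχΘ : ∀ θ y, χ (Θ θ) y = θ (y : G ⧸ H) := fun θ y => by rw [hΘ]; rfl
  have hΘinj : Function.Injective Θ := fun θ θ' h => MonoidHom.ext fun d => by
    obtain ⟨y, rfl⟩ := QuotientGroup.mk_surjective d
    rw [← hχΘ, ← hχΘ, h]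
  have hzero : ∀ μ, μ ∉ Set.range Θ → ∀ ξ, ∫ y, c ξ y * ((χ μ y)⁻¹ : ℂˣ) ∂ν = 0 := by
    intro μ hμ ξ
    obtain ⟨h, hh, hne'⟩ : ∃ h ∈ H, χ μ h ≠ 1 := by
      by_contra! hall
      refine hμ ⟨QuotientGroup.lift H (χ μ) hall, hχ ?_⟩
      rw [hΘ]
      rfl
    exact integral_mul_inv_eq_zero (hc ξ) (χ μ) hh hne'
  -- a bound for the coefficients which does not depend on the character
  obtain ⟨B, hB, hcB⟩ : ∃ B : ι → ℝ, Summable B ∧ ∀ ξ y, ‖c ξ y‖ ≤ B ξ := by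
    refine ⟨fun ξ => ∑ d : G ⧸ H, ‖c ξ d.out‖, summable_sum fun d _ => hs _, fun ξ y => ?_⟩
    have h1 : c ξ y = c ξ ((y : G ⧸ H)).out := by
      obtain ⟨h, hh⟩ := QuotientGroup.mk_out_eq_mul H y
      rw [hh, hc _ _ _ h.2]
    rw [h1]
    exact Finset.single_le_sum (f := fun d : G ⧸ H => ‖c ξ d.out‖) (fun _ _ => norm_nonneg _)
      (Finset.mem_univ _)
  have hθnorm : ∀ (θ : G ⧸ H →* ℂˣ) (d : G ⧸ H), ‖(((θ d)⁻¹ : ℂˣ) : ℂ)‖ = 1 := fun θ d => by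
    rw [← map_inv]
    refine Complex.norm_eq_one_of_pow_eq_one (n := Nat.card (G ⧸ H)) ?_ Nat.card_pos.ne'
    rw [← Units.val_pow_eq_pow_val, ← map_pow, pow_card_eq_one', map_one, Units.val_one]
  have hbound : ∀ θ ξ, ‖(∫ y, c ξ y * ((χ (Θ θ) y)⁻¹ : ℂˣ) ∂ν) * u ξ‖ ≤ B ξ := fun θ ξ => by
    rw [norm_mul, hu, mul_one]
    refine (norm_integral_le_of_norm_le_const (C := B ξ)
      (Filter.Eventually.of_forall fun y => ?_)).trans_eq ?_
    · rw [norm_mul, hχΘ, hθnorm, mul_one]; exact hcB ξ y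
    · rw [probReal_univ, mul_one]
  have hsummable : ∀ θ, Summable fun ξ => (∫ y, c ξ y * ((χ (Θ θ) y)⁻¹ : ℂˣ) ∂ν) * u ξ := fun θ =>
    Summable.of_norm_bounded hB (hbound θ)
  constructor
  · have hi : Function.Injective (Prod.map Θ (id : ι → ι)) := hΘinj.prodMap Function.injective_id
    refine (hi.summable_iff ?_).1 ?_
    · rintro ⟨μ, ξ⟩ hp
      dsimp only
      rw [hzero μ (fun ⟨θ, hθ⟩ => hp ⟨(θ, ξ), Prod.ext hθ rfl⟩), zero_mul]
    · refine Summable.of_norm_bounded (g := fun p : (G ⧸ H →* ℂˣ) × ι => B p.2) ?_ fun p =>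
        hbound p.1 p.2
      refine (summable_prod_of_nonneg fun p =>
        (norm_nonneg (c p.2 1)).trans (hcB p.2 1)).2 ⟨fun _ => hB, ?_⟩
      exact summable_of_hasFiniteSupport (Set.toFinite _)
  · rw [← hΘinj.tsum_eq (f := fun μ => ∑' ξ, (∫ y, c ξ y * ((χ μ y)⁻¹ : ℂˣ) ∂ν) * u ξ),
      tsum_fintype, ← Summable.tsum_finsetSum fun θ _ => hsummable θ]
    · refine tsum_congr fun ξ => ?_
      rw [← Finset.sum_mul]
      simp only [hχΘ]
      rw [sum_integral_mul_inv hH (hc ξ)]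
    · intro μ hμ
      by_contra hr
      refine hμ ?_
      simp only [hzero μ hr, zero_mul, tsum_zero]

end FiniteInversion

/-! ### Comparison of genuine characters -/

theorem GenuineChar.ext_zStar {μ μ' : GenuineChar F}
    (h : ∀ y, μ.toFun (zStar y) = μ'.toFun (zStar y)) : μ = μ' := by
  have : μ.toFun = μ'.toFun := by
    funext z
    obtain ⟨⟨g, ε⟩, y, hy⟩ := z
    obtain rfl : g = zMat y := hy
    change μ.toFun (zEl y ε) = μ'.toFun (zEl y ε)
    rw [μ.apply_zEl, μ'.apply_zEl, h]
  cases μ; cases μ'; congr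

/-- The quotient of two genuine characters, as a character of the idele group. -/
def ratioChar (μ μ₀ : GenuineChar F) : 𝔸[F]ˣ →* ℂˣ where
  toFun y := μ.toFun (zStar y) / μ₀.toFun (zStar y)
  map_one' := by
    have h : ∀ μ : GenuineChar F, μ.toFun (zStar 1) = 1 := fun μ => by
      have := μ.map_zStar_mul 1 1
      rwa [mul_one, hil_one_left, map_one, one_mul, left_eq_mul] at this
    rw [h, h, div_one]
  map_mul' a b := by
    rw [μ.map_zStar_mul, μ₀.map_zStar_mul, mul_div_mul_left_eq_div, mul_div_mul_comm]

theorem ratioChar_apply (μ μ₀ : GenuineChar F) (y : 𝔸[F]ˣ) :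
    ratioChar μ μ₀ y = μ.toFun (zStar y) / μ₀.toFun (zStar y) := rfl

/-- The idele `y` attached to an element `(z(y), ε)` of `Z̃(𝔸)`. -/
def zCoord (z : MetaZ F) : 𝔸[F]ˣ := z.2.choose

theorem zMat_injective {R : Type*} [CommRing R] : Function.Injective (zMat : Rˣ → GL (Fin 2) R) :=
  fun a b h => Units.ext (by
    have := congrArg (fun g : GL (Fin 2) R => g 0 0) h
    simpa [zMat] using this)

theorem zCoord_zEl (y : 𝔸[F]ˣ) (ε : ℤˣ) : zCoord (zEl y ε) = y :=
  (zMat_injective (zEl y ε).2.choose_spec).symm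

theorem zCoord_mul (a b : MetaZ F) : zCoord (a * b) = zCoord a * zCoord b := by
  refine zMat_injective ?_
  have ha : a.1.mat = zMat (zCoord a) := a.2.choose_spec
  have hb : b.1.mat = zMat (zCoord b) := b.2.choose_spec
  have hab : (a * b).1.mat = zMat (zCoord (a * b)) := (a * b).2.choose_spec
  rw [← hab, ← zMat_mul, ← ha, ← hb]
  rfl

/-- The product of a genuine character and a continuous character of the idele group. -/
def GenuineChar.mulChar (μ : GenuineChar F) (χ : 𝔸[F]ˣ →* ℂˣ) (hχ : Continuous χ) :
    GenuineChar F where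
  toFun z := μ.toFun z * χ (zCoord z)
  map_mul' a b := by rw [μ.map_mul', zCoord_mul, map_mul, mul_mul_mul_comm]
  genuine' a ε := by rw [μ.genuine', zCoord_mul, zCoord_zEl, mul_one, mul_assoc]
  continuous' := by
    simp only [zStar, zCoord_zEl]
    exact μ.continuous'.mul hχ

theorem GenuineChar.mulChar_zStar (μ : GenuineChar F) (χ : 𝔸[F]ˣ →* ℂˣ) (hχ : Continuous χ)
    (y : 𝔸[F]ˣ) : (μ.mulChar χ hχ).toFun (zStar y) = μ.toFun (zStar y) * χ y := by
  change μ.toFun (zStar y) * χ (zCoord (zEl y 1)) = _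
  rw [zCoord_zEl]

theorem sq_mem_ratSquares (y : 𝔸[F]ˣ) : y ^ 2 ∈ ratSquares F := Subgroup.mem_sup_right ⟨y, rfl⟩

theorem principal_mem_ratSquares (q : Fˣ) : principal q ∈ ratSquares F :=
  Subgroup.mem_sup_left ⟨q, rfl⟩

section Omega

variable {V : Submodule ℂ (MetaGL2 F → ℂ)} {μ₀ : GenuineChar F} (h₀ : μ₀ ∈ Omega V)

include h₀

theorem mulChar_mem_Omega (χ : 𝔸[F]ˣ →* ℂˣ) (hχ : Continuous χ) (hr : ∀ y ∈ ratSquares F, χ y = 1) :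
    μ₀.mulChar χ hχ ∈ Omega V := by
  refine ⟨fun q => ?_, fun y ε φ hφ => ?_⟩
  · rw [μ₀.mulChar_zStar, h₀.1, one_mul]
    exact hr _ (principal_mem_ratSquares q)
  · have : (μ₀.mulChar χ hχ).toFun (zEl (y ^ 2) ε) = μ₀.toFun (zEl (y ^ 2) ε) := by
      rw [(μ₀.mulChar χ hχ).apply_zEl, μ₀.apply_zEl, μ₀.mulChar_zStar,
        hr _ (sq_mem_ratSquares y), mul_one]
    rw [this]
    exact h₀.2 y ε φ hφ

theorem ratioChar_sq (hV : V ≠ ⊥) {μ : GenuineChar F} (h : μ ∈ Omega V) (y : 𝔸[F]ˣ) :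
    ratioChar μ μ₀ (y ^ 2) = 1 := by
  obtain ⟨φ, hφ, hne⟩ := (Submodule.ne_bot_iff V).1 hV
  obtain ⟨g, hg⟩ := Function.ne_iff.1 hne
  have h1 := congrFun ((h₀.2 y 1 φ hφ).symm.trans (h.2 y 1 φ hφ)) g
  rw [Pi.smul_apply, Pi.smul_apply, smul_eq_mul, smul_eq_mul] at h1
  have h2 := mul_right_cancel₀ hg h1
  rw [ratioChar_apply, div_eq_one]
  exact (Units.ext h2).symm

theorem ratioChar_eq_one (hV : V ≠ ⊥) {μ : GenuineChar F} (h : μ ∈ Omega V) {y : 𝔸[F]ˣ}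
    (hy : y ∈ ratSquares F) : ratioChar μ μ₀ y = 1 := by
  obtain ⟨-, ⟨q, rfl⟩, -, ⟨t, rfl⟩, rfl⟩ := Subgroup.mem_sup.1 hy
  have h1 : ratioChar μ μ₀ (principal q) = 1 := by rw [ratioChar_apply, h.1, h₀.1, div_one]
  rw [map_mul]
  exact (congrArg₂ _ h1 (ratioChar_sq h₀ hV h t)).trans (mul_one 1)

end Omega

/-! ### The dependence of cusp forms on the centre -/

/-- The function `y ↦ φ(z(y)^* n(x)^* g₀^*) μ₀(z(y)^*)⁻¹`, which descends to
`𝔸ˣ / Fˣ (𝔸ˣ)²`. -/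
def normForm (φ : MetaGL2 F → ℂ) (μ₀ : GenuineChar F) (g₀ : GL (Fin 2) 𝔸[F]) (y : 𝔸[F]ˣ)
    (x : 𝔸[F]) : ℂ :=
  φ (elt g₀ y x) * (((μ₀.toFun (zStar y))⁻¹ : ℂˣ) : ℂ)

/-- The idele with given finite component, and archimedean component `1`. -/
def finIdele : (FinAdele F)ˣ →* 𝔸[F]ˣ :=
  (MulEquiv.prodUnits (M := InfiniteAdeleRing F) (N := FinAdele F)).symm.toMonoidHom.comp
    (MonoidHom.inr (InfiniteAdeleRing F)ˣ (FinAdele F)ˣ)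

theorem continuous_finIdele : Continuous (finIdele : (FinAdele F)ˣ →* 𝔸[F]ˣ) := by
  refine Units.continuous_iff.2 ⟨?_, ?_⟩
  · exact (continuous_const (y := (1 : InfiniteAdeleRing F))).prodMk
      (Units.continuous_val (M := FinAdele F))
  · exact (continuous_const (y := (1 : InfiniteAdeleRing F))).prodMk
      (Units.continuous_val.comp (continuous_inv (G := (FinAdele F)ˣ)))

theorem infIdele_mul_finIdele (u : 𝔸[F]ˣ) :
    infIdele (Units.map toMixed.toMonoidHom u) * finIdele (Units.map toFin.toMonoidHom u) = u := by
  ext1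
  refine Prod.ext ?_ (one_mul (u : 𝔸[F]).2)
  change (InfiniteAdeleRing.ringEquiv_mixedSpace F).symm
    (InfiniteAdeleRing.ringEquiv_mixedSpace F (u : 𝔸[F]).1) * 1 = (u : 𝔸[F]).1
  rw [RingEquiv.symm_apply_apply, mul_one]

theorem zStar_finIdele (b : (FinAdele F)ˣ) : (zStar (finIdele b)).1 = gstar (ofFin (zMat b)) := by
  change (⟨zMat (finIdele b), 1⟩ : MetaGL2 F) = ⟨ofFin (zMat b), 1⟩
  congr 1
  apply Units.ext
  ext i j
  fin_cases i <;> fin_cases j <;> rfl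

section UnitBall

theorem mul_sub_one_mem_intBall {N : ℕ} {b b' : FinAdele F} (hb : b - 1 ∈ intBall F N)
    (hb' : b' - 1 ∈ intBall F N) : b * b' - 1 ∈ intBall F N := by
  have h1 : ∀ v, Valued.v (b v) ≤ 1 := fun v => by
    have e : b v = (b - 1) v + 1 := by
      change b v = b v - 1 + 1
      ring
    rw [e]
    exact valued_add_le ((hb v).trans (valued_natCast_le_one v N)) (by rw [map_one])
  have e : b * b' - 1 = (b' - 1) * b + (b - 1) := by ring
  rw [e]
  exact (intBall F N).add_mem (mul_mem_intBall hb' h1) hb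

theorem pow_sub_one_mem_intBall {N : ℕ} {b : FinAdele F} (hb : b - 1 ∈ intBall F N) (n : ℕ) :
    b ^ n - 1 ∈ intBall F N := by
  induction n with
  | zero => rw [pow_zero, sub_self]; exact (intBall F N).zero_mem
  | succ n ih => rw [pow_succ]; exact mul_sub_one_mem_intBall ih hb

theorem exists_unit_intBall_subset {S : Set (FinAdele F)ˣ} (hS : S ∈ nhds 1) :
    ∃ N : ℕ, 0 < N ∧ ∀ b : (FinAdele F)ˣ, (b : FinAdele F) - 1 ∈ intBall F N →
      ((b⁻¹ : (FinAdele F)ˣ) : FinAdele F) - 1 ∈ intBall F N → b ∈ S := by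
  rw [Units.isEmbedding_embedProduct.isInducing.nhds_eq_comap, Filter.mem_comap] at hS
  obtain ⟨T, hT, hTS⟩ := hS
  rw [map_one] at hT
  obtain ⟨A, hA, B, hB, hAB⟩ := mem_nhds_prod_iff.1 hT
  have hshift : ∀ A ∈ nhds (1 : FinAdele F), ∃ N : ℕ, 0 < N ∧ ∀ b : FinAdele F,
      b - 1 ∈ intBall F N → b ∈ A := by
    intro A hA
    have hc : Continuous fun b : FinAdele F => b + 1 := continuous_id.add continuous_const
    have h1 : (fun b : FinAdele F => b + 1) ⁻¹' A ∈ nhds 0 :=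
      hc.continuousAt.preimage_mem_nhds (by rw [zero_add]; exact hA)
    obtain ⟨N, hN, hNA⟩ := exists_intBall_subset h1
    refine ⟨N, hN, fun b hb => ?_⟩
    have := hNA hb
    rwa [Set.mem_preimage, sub_add_cancel] at this
  obtain ⟨N₁, hN₁, h1⟩ := hshift A hA
  obtain ⟨N₂, hN₂, h2⟩ := hshift _ (MulOpposite.continuous_op.continuousAt.preimage_mem_nhds hB)
  refine ⟨N₁ * N₂, Nat.mul_pos hN₁ hN₂, fun b hb hb' => hTS
    (hAB ⟨h1 _ fun v => ?_, h2 _ fun v => ?_⟩)⟩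
  · refine (hb v).trans ?_
    rw [Nat.cast_mul, map_mul]
    exact mul_le_of_le_one_right' (valued_natCast_le_one v N₂)
  · refine (hb' v).trans ?_
    rw [Nat.cast_mul, map_mul]
    exact mul_le_of_le_one_left' (valued_natCast_le_one v N₁)

end UnitBall

section NormForm

variable {φ : MetaGL2 F → ℂ} (hφ : IsGenuineCuspForm φ) {g₀ : GL (Fin 2) 𝔸[F]} {e : 𝔸[F]ˣ}
  (hb : IsBase g₀ e) (μ₀ : GenuineChar F)

include hφ hb

theorem normForm_mul (y t : 𝔸[F]ˣ) (x : 𝔸[F]) :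
    normForm φ μ₀ g₀ (y * t) x = rightTranslate (zStar t).1 φ (elt g₀ y x) *
      (((μ₀.toFun (zStar y))⁻¹ : ℂˣ) : ℂ) * (((μ₀.toFun (zStar t))⁻¹ : ℂˣ) : ℂ) := by
  have hs : (((sgnC (hil y t))⁻¹ : ℂˣ) : ℂ) = ((hil y t : ℤˣ) : ℤ) := by
    rw [← map_inv, Int.units_inv_eq_self, coe_sgnC]
  rw [normForm, hφ.elt_mul_idele hb μ₀.hil_cocycle, μ₀.map_zStar_mul, mul_inv, mul_inv,
    Units.val_mul, Units.val_mul, hs]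
  linear_combination (rightTranslate (zStar t).1 φ (elt g₀ y x) *
    (((μ₀.toFun (zStar y))⁻¹ : ℂˣ) : ℂ) * (((μ₀.toFun (zStar t))⁻¹ : ℂˣ) : ℂ)) *
    sgn_mul_self (hil y t)

theorem normForm_mul_of_eigen {t : 𝔸[F]ˣ} {c : ℂ}
    (ht : rightTranslate (zStar t).1 φ = c • φ) (y : 𝔸[F]ˣ) (x : 𝔸[F]) :
    normForm φ μ₀ g₀ (y * t) x =
      c * (((μ₀.toFun (zStar t))⁻¹ : ℂˣ) : ℂ) * normForm φ μ₀ g₀ y x := by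
  rw [normForm_mul hφ hb, ht, normForm, Pi.smul_apply, smul_eq_mul]
  ring

theorem normForm_mul_principal (hq : ∀ q : Fˣ, μ₀.toFun (zStar (principal q)) = 1)
    (y : 𝔸[F]ˣ) (x : 𝔸[F]) (q : Fˣ) :
    normForm φ μ₀ g₀ (y * principal q) x = normForm φ μ₀ g₀ y x := by
  have hs : (((sgnC (hil y (principal q)))⁻¹ : ℂˣ) : ℂ) = ((hil y (principal q) : ℤˣ) : ℤ) := by
    rw [← map_inv, Int.units_inv_eq_self, coe_sgnC]
  rw [normForm, normForm, hφ.elt_mul_rational hb μ₀.hil_cocycle, μ₀.map_zStar_mul, hq, mul_one,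
    mul_inv, Units.val_mul, hs]
  linear_combination (φ (elt g₀ y x) * (((μ₀.toFun (zStar y))⁻¹ : ℂˣ) : ℂ)) *
    sgn_mul_self (hil y (principal q))

open scoped Classical in
/-- The functions `normForm` are invariant under an open subgroup of the idele group which contains
`F^× (𝔸^×)²`. At the archimedean places this holds because ideles close to `1` are squares. -/
theorem exists_isOpen_stabilizer (hq : ∀ q : Fˣ, μ₀.toFun (zStar (principal q)) = 1)
    (hsq : ∀ t : 𝔸[F]ˣ, rightTranslate (zStar (t ^ 2)).1 φ =
      ((μ₀.toFun (zStar (t ^ 2)) : ℂˣ) : ℂ) • φ) :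
    ∃ H : Subgroup 𝔸[F]ˣ, IsOpen (H : Set 𝔸[F]ˣ) ∧ ratSquares F ≤ H ∧
      ∀ y, ∀ h ∈ H, normForm φ μ₀ g₀ (y * h) = normForm φ μ₀ g₀ y := by
  let H : Subgroup 𝔸[F]ˣ :=
    { carrier := {h | ∀ y, normForm φ μ₀ g₀ (y * h) = normForm φ μ₀ g₀ y}
      one_mem' := fun y => by rw [mul_one]
      mul_mem' := fun {a b} ha hb y => by rw [← mul_assoc, hb, ha]
      inv_mem' := fun {a} ha y => by
        have := ha (y * a⁻¹)
        rwa [inv_mul_cancel_right, eq_comm] at this }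
  have hH : ∀ {h}, h ∈ H ↔ ∀ y, normForm φ μ₀ g₀ (y * h) = normForm φ μ₀ g₀ y := Iff.rfl
  have hsqH : ∀ t : 𝔸[F]ˣ, t ^ 2 ∈ H := fun t => hH.2 fun y => funext fun x => by
    rw [normForm_mul_of_eigen hφ hb μ₀ (hsq t), Units.mul_inv, one_mul]
  refine ⟨H, ?_, ?_, fun y h hh => hH.1 hh y⟩
  swap
  · refine sup_le ?_ ?_
    · rintro - ⟨q, rfl⟩
      exact hH.2 fun y => funext fun x => normForm_mul_principal hφ hb μ₀ hq y x q
    · rintro - ⟨t, rfl⟩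
      exact hsqH t
  by_cases hzero : ∀ y x, normForm φ μ₀ g₀ y x = 0
  · have : H = ⊤ := eq_top_iff.2 fun h _ => hH.2 fun y => funext fun x => by rw [hzero, hzero]
    rw [this]
    exact isOpen_univ
  push Not at hzero
  obtain ⟨y₀, x₀, hne⟩ := hzero
  obtain ⟨U, hU, hUφ⟩ := hφ.smooth.1
  -- finite ideles close to `1` act by a character; its values on a small subgroup are close to `1`,
  -- so they equal `1`
  set m : (FinAdele F)ˣ → ℂ := fun b => (((μ₀.toFun (zStar (finIdele b)))⁻¹ : ℂˣ) : ℂ) with hm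
  have hact : ∀ b : (FinAdele F)ˣ, zMat b ∈ U → ∀ y x,
      normForm φ μ₀ g₀ (y * finIdele b) x = m b * normForm φ μ₀ g₀ y x := fun b hbU y x => by
    have : rightTranslate (zStar (finIdele b)).1 φ = (1 : ℂ) • φ := by
      rw [one_smul, zStar_finIdele, hUφ _ hbU]
    rw [normForm_mul_of_eigen hφ hb μ₀ this, one_mul]
  have hpowU : ∀ b : (FinAdele F)ˣ, zMat b ∈ U → ∀ n : ℕ, zMat (b ^ n) ∈ U := fun b hbU n => by
    induction n with
    | zero => rw [pow_zero, zMat_one]; exact U.one_mem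
    | succ n ih => rw [pow_succ, ← zMat_mul]; exact U.mul_mem ih hbU
  have hpow : ∀ b : (FinAdele F)ˣ, zMat b ∈ U → ∀ n : ℕ, m (b ^ n) = m b ^ n := fun b hbU n => by
    have key : ∀ n : ℕ, normForm φ μ₀ g₀ (y₀ * finIdele b ^ n) x₀ =
        m b ^ n * normForm φ μ₀ g₀ y₀ x₀ := fun n => by
      induction n with
      | zero => rw [pow_zero, pow_zero, mul_one, one_mul]
      | succ n ih => rw [pow_succ, ← mul_assoc, hact b hbU, ih, pow_succ]; ring
    refine mul_right_cancel₀ hne ?_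
    rw [← key, ← map_pow, hact _ (hpowU b hbU n)]
  have hmc : Continuous m :=
    Units.continuous_val.comp ((μ₀.continuous'.comp continuous_finIdele).inv)
  have hm1 : m 1 = 1 := by
    have := hpow 1 (by rw [zMat_one]; exact U.one_mem) 0
    rwa [pow_zero, pow_zero] at this
  have hzc : Continuous (zMat : (FinAdele F)ˣ → GL (Fin 2) (FinAdele F)) := by
    refine Units.continuous_iff.2 ⟨continuous_matrix fun i j => ?_, continuous_matrix fun i j => ?_⟩
    · fin_cases i <;> fin_cases j
      exacts [Units.continuous_val, continuous_const, continuous_const, Units.continuous_val]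
    · have := Units.continuous_val.comp (continuous_inv (G := (FinAdele F)ˣ))
      fin_cases i <;> fin_cases j
      exacts [this, continuous_const, continuous_const, this]
  have hS : {b : (FinAdele F)ˣ | zMat b ∈ U ∧ ‖m b - 1‖ < 1 / 2} ∈ nhds 1 := by
    refine ((hU.preimage hzc).inter
      (isOpen_lt (hmc.sub continuous_const).norm continuous_const)).mem_nhds ⟨?_, ?_⟩
    · change zMat 1 ∈ U
      rw [zMat_one]; exact U.one_mem
    · change ‖m 1 - 1‖ < 1 / 2
      rw [hm1, sub_self, norm_zero]; norm_num
  obtain ⟨N, hN, hNS⟩ := exists_unit_intBall_subset hS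
  have hmem : ∀ b : (FinAdele F)ˣ, (b : FinAdele F) - 1 ∈ intBall F N →
      ((b⁻¹ : (FinAdele F)ˣ) : FinAdele F) - 1 ∈ intBall F N → finIdele b ∈ H := fun b h1 h2 => by
    have hbn : ∀ n : ℕ, zMat (b ^ n) ∈ U ∧ ‖m (b ^ n) - 1‖ < 1 / 2 := fun n => by
      refine hNS _ ?_ ?_
      · rw [Units.val_pow_eq_pow_val]; exact pow_sub_one_mem_intBall h1 n
      · rw [← inv_pow, Units.val_pow_eq_pow_val]; exact pow_sub_one_mem_intBall h2 n
    have hbU : zMat b ∈ U := by simpa using (hbn 1).1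
    have hmb : m b = 1 := eq_one_of_forall_norm_pow_sub_one_le fun n => by
      rw [← hpow b hbU]; exact (hbn n).2.le
    exact hH.2 fun y => funext fun x => by rw [hact b hbU, hmb, one_mul]
  refine Subgroup.isOpen_of_mem_nhds H (g := 1) ?_
  have hball := intBall_mem_nhds (F := F) hN one_pos 1
  have hn1 : (fun u : 𝔸[F]ˣ => (u : 𝔸[F])) ⁻¹'
      {b : 𝔸[F] | ‖toMixed (b - 1)‖ < 1 ∧ (b - 1).2 ∈ intBall F N} ∈ nhds 1 :=
    Units.continuous_val.continuousAt.preimage_mem_nhds hball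
  have hn2 : (fun u : 𝔸[F]ˣ => ((u⁻¹ : 𝔸[F]ˣ) : 𝔸[F])) ⁻¹'
      {b : 𝔸[F] | ‖toMixed (b - 1)‖ < 1 ∧ (b - 1).2 ∈ intBall F N} ∈ nhds 1 :=
    (Units.continuous_val.comp continuous_inv).continuousAt.preimage_mem_nhds
      (by rw [Function.comp_apply, inv_one]; exact hball)
  refine Filter.mem_of_superset (Filter.inter_mem hn1 hn2) fun u hu => ?_
  rw [SetLike.mem_coe, ← infIdele_mul_finIdele u]
  refine H.mul_mem ?_ (hmem _ hu.1.2 hu.2.2)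
  -- the archimedean component is close to `1`, hence a square
  set t := Units.map toMixed.toMonoidHom u with ht
  have htv : (t : mixedEmbedding.mixedSpace F) = toMixed (u : 𝔸[F]) := rfl
  have hnorm : ‖(t : mixedEmbedding.mixedSpace F) - 1‖ < 1 := by
    have := hu.1.1
    rwa [map_sub, map_one, ← htv] at this
  have hpos : ∀ w, 0 < (t : mixedEmbedding.mixedSpace F).1 w := fun w => by
    have h1 : ‖((t : mixedEmbedding.mixedSpace F) - 1).1 w‖ < 1 :=
      ((norm_le_pi_norm _ w).trans (norm_fst_le _)).trans_lt hnorm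
    have h2 : |(t : mixedEmbedding.mixedSpace F).1 w - 1| < 1 := h1
    linarith [(abs_lt.1 h2).1]
  let s : mixedEmbedding.mixedSpace F :=
    (fun w => Real.sqrt ((t : mixedEmbedding.mixedSpace F).1 w),
      fun w => ((t : mixedEmbedding.mixedSpace F).2 w) ^ (2⁻¹ : ℂ))
  have hs2 : s ^ 2 = t := by
    refine Prod.ext (funext fun w => ?_) (funext fun w => ?_)
    · exact Real.sq_sqrt (hpos w).le
    · change (((t : mixedEmbedding.mixedSpace F).2 w) ^ (2⁻¹ : ℂ)) ^ 2 = _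
      rw [← Complex.cpow_nat_mul]
      norm_num
  have hs : IsUnit s := (isUnit_pow_iff two_ne_zero).1 (hs2 ▸ t.isUnit)
  have hst : t = hs.unit ^ 2 := Units.ext hs2.symm
  rw [hst, map_pow]
  exact hsqH _

end NormForm

/-! ### Whittaker functions as Fourier coefficients -/

section Whittaker

variable {φ : MetaGL2 F → ℂ} (hφ : IsGenuineCuspForm φ) {g₀ : GL (Fin 2) 𝔸[F]} {e : 𝔸[F]ˣ}
  (hb : IsBase g₀ e) (μ₀ : GenuineChar F)
  {ψ : AddChar 𝔸[F] Circle} (hψ : Continuous ψ) (hψF : ∀ x : F, ψ (algebraMap F 𝔸[F] x) = 1)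

include hφ hb

theorem IsGenuineCuspForm.continuous_elt (y : 𝔸[F]ˣ) : Continuous fun x => φ (elt g₀ y x) := by
  obtain ⟨N, hN, h⟩ := hφ.exists_isNice hb
  exact (h y).continuous hN

include hψ hψF

/-- The inner integral of `W_φ^{μ^ξ}(a(ξ)^* g₀^*)`. The signs by which
`φ(z(y)^* n(x)^* a(ξ)^* g₀^*)` and `μ^ξ(z(y)^*)` deviate from `φ(z(y)^* n(ξ⁻¹x)^* g₀^*)` and
`μ(z(y)^*)` are equal and cancel. -/
theorem whittaker_inner_integral_eq (μ : GenuineChar F) (ξ : Fˣ) (y : 𝔸[F]ˣ) :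
    ∫ x : AdeleQuot F, φ ((zStar y).1 * gstar (nMat x.out) *
        (gstar (aMat (principal ξ)) * gstar g₀)) * conj (ψ x.out : ℂ)
        * (((twist μ.toFun ξ (zStar y))⁻¹ : ℂˣ) : ℂ) ∂(adeleHaar F) =
      fourierCoef ψ (fun x => φ (elt g₀ y x)) ξ * (((μ.toFun (zStar y))⁻¹ : ℂˣ) : ℂ) := by
  have hper : IsPeriodic fun x => φ (elt g₀ y x) * conj (ψ (algebraMap F 𝔸[F] ξ * x) : ℂ) :=
    fun a q => congrArg₂ (fun (z : ℂ) (w : Circle) => z * conj (w : ℂ))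
      (hφ.elt_add_rational hb y a q) (isPeriodic_addChar hψF ξ a q)
  have hcont : Continuous fun x => φ (elt g₀ y x) * conj (ψ (algebraMap F 𝔸[F] ξ * x) : ℂ) :=
    (hφ.continuous_elt hb y).mul (Complex.continuous_conj.comp (continuous_addChar_mul hψ ξ))
  have h1 : ∀ x : 𝔸[F], φ ((zStar y).1 * gstar (nMat x) *
      (gstar (aMat (principal ξ)) * gstar g₀)) * conj (ψ x : ℂ) =
      ((hil y (principal ξ) : ℤˣ) : ℤ) * (φ (elt g₀ y (algebraMap F 𝔸[F] (ξ⁻¹ : Fˣ) * x)) *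
        conj (ψ (algebraMap F 𝔸[F] ξ * (algebraMap F 𝔸[F] (ξ⁻¹ : Fˣ) * x)) : ℂ)) := fun x => by
    have hx : algebraMap F 𝔸[F] ξ * (algebraMap F 𝔸[F] (ξ⁻¹ : Fˣ) * x) = x := by
      rw [← mul_assoc, ← map_mul, Units.mul_inv, map_one, one_mul]
    have h2 := hφ.elt_aMat hb μ.hil_cocycle ξ y (algebraMap F 𝔸[F] (ξ⁻¹ : Fˣ) * x)
    rw [show ((principal ξ : 𝔸[F]ˣ) : 𝔸[F]) = algebraMap F 𝔸[F] ξ from rfl, hx] at h2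
    rw [h2, hx, mul_assoc]
  have hs : (((sgnC (hil y (principal ξ)))⁻¹ : ℂˣ) : ℂ) = ((hil y (principal ξ) : ℤˣ) : ℤ) := by
    rw [← map_inv, Int.units_inv_eq_self, coe_sgnC]
  rw [integral_mul_const]
  simp only [h1]
  rw [integral_const_mul, integral_mul_rational hper hcont, twist_zStar, mul_inv, Units.val_mul, hs,
    fourierCoef]
  linear_combination ((∫ x : AdeleQuot F, φ (elt g₀ y x.out) *
    conj (ψ (algebraMap F 𝔸[F] ξ * x.out) : ℂ) ∂(adeleHaar F)) *
    (((μ.toFun (zStar y))⁻¹ : ℂˣ) : ℂ)) * sgn_mul_self (hil y (principal ξ))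

/-- The Whittaker function `W_φ^{μ^ξ}(a(ξ)^* g₀^*)` is the coefficient at the character `μ / μ₀` of
`𝔸^× / F^× (𝔸^×)²` of the `ξ`-th Fourier coefficient of `normForm φ μ₀ g₀ y`. -/
theorem whittaker_eq_integral_fourierCoef (μ : GenuineChar F) (ξ : Fˣ) :
    whittaker ψ φ (twist μ.toFun ξ) (gstar (aMat (principal ξ)) * gstar g₀) =
      ∫ y : IdeleQuot F, fourierCoef ψ (normForm φ μ₀ g₀ y.out) ξ *
        (((ratioChar μ μ₀ y.out)⁻¹ : ℂˣ) : ℂ) ∂(ideleHaar F) := by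
  rw [whittaker]
  congr 1
  funext y
  rw [whittaker_inner_integral_eq hφ hb hψ hψF]
  have h1 : fourierCoef ψ (normForm φ μ₀ g₀ y.out) (ξ : F) =
      fourierCoef ψ (fun x => φ (elt g₀ y.out x)) ξ * (((μ₀.toFun (zStar y.out))⁻¹ : ℂˣ) : ℂ) :=
    fourierCoef_const_mul _ _ _
  rw [h1, mul_assoc, ← Units.val_mul, ratioChar_apply]
  congr 2
  rw [inv_div, mul_div_assoc', inv_mul_cancel, one_div]

omit hψ hψF in
/-- The constant term vanishes by cuspidality. -/
theorem integral_elt_eq_zero (y : 𝔸[F]ˣ) :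
    ∫ x : AdeleQuot F, φ (elt g₀ y x.out) ∂(adeleHaar F) = 0 := by
  have := hφ.cuspidal ((zStar y).1 * gstar g₀)
  simpa only [← hb.elt_eq_nMat_mul] using this

omit hψ hψF in
/-- A Fourier coefficient at a trivial character is a constant term. The character is trivial for
`ξ = 0`, and for all `ξ` if `ψ = 1`. -/
theorem fourierCoef_normForm_eq_zero (y : 𝔸[F]ˣ) {ξ : F}
    (hξ : ∀ x, ψ (algebraMap F 𝔸[F] ξ * x) = 1) : fourierCoef ψ (normForm φ μ₀ g₀ y) ξ = 0 := by
  have h1 : fourierCoef ψ (normForm φ μ₀ g₀ y) ξ =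
      fourierCoef ψ (fun x => φ (elt g₀ y x)) ξ * (((μ₀.toFun (zStar y))⁻¹ : ℂˣ) : ℂ) :=
    fourierCoef_const_mul _ _ _
  rw [h1, fourierCoef]
  simp only [hξ, Circle.coe_one, map_one, mul_one]
  rw [integral_elt_eq_zero hφ hb, zero_mul]

end Whittaker

theorem exists_out_idele_eq (a : 𝔸[F]ˣ) :
    ∃ r ∈ ratSquares F, ((a : IdeleQuot F)).out = a * r := by
  obtain ⟨r, hr⟩ := QuotientGroup.mk_out_eq_mul (ratSquares F) a
  exact ⟨r, r.2, hr⟩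

/-! ### `Ω(ω_π)` as a torsor -/

section OmegaChar

variable {V : Submodule ℂ (MetaGL2 F → ℂ)} {μ₀ : GenuineChar F} (h₀ : μ₀ ∈ Omega V) (hV : V ≠ ⊥)

/-- The quotient of two elements of `Ω(ω_π)`, as a character of `𝔸^× / F^× (𝔸^×)²`. -/
def omegaRatio (μ : Omega V) : IdeleQuot F →* ℂˣ :=
  QuotientGroup.lift (ratSquares F) (ratioChar μ.1 μ₀) fun _ hy => ratioChar_eq_one h₀ hV μ.2 hy

theorem omegaRatio_out (μ : Omega V) (y : IdeleQuot F) :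
    omegaRatio h₀ hV μ y = ratioChar μ.1 μ₀ y.out := by
  conv_lhs => rw [← QuotientGroup.out_eq' y]
  rfl

theorem omegaRatio_injective : Function.Injective (omegaRatio h₀ hV) := fun μ μ' h =>
  Subtype.ext <| GenuineChar.ext_zStar fun y => by
    have h1 : ratioChar μ.1 μ₀ y = ratioChar μ'.1 μ₀ y :=
      DFunLike.congr_fun h (y : IdeleQuot F)
    rw [ratioChar_apply, ratioChar_apply] at h1
    exact div_left_injective h1

/-- `Ω(ω_π)` is a torsor under the characters of `𝔸^× / F^× (𝔸^×)²`; a character which is trivial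
on an open subgroup is continuous. -/
theorem exists_omegaRatio_eq {H : Subgroup (IdeleQuot F)} (hH : IsOpen (H : Set (IdeleQuot F)))
    (θ : IdeleQuot F →* ℂˣ) (hθ : ∀ h ∈ H, θ h = 1) : ∃ μ, omegaRatio h₀ hV μ = θ := by
  have hc : Continuous (θ.comp (QuotientGroup.mk' (ratSquares F))) :=
    (continuous_of_forall_mul_eq (g := θ) hH fun y h hh => by
      rw [map_mul, hθ h hh, mul_one]).comp continuous_quot_mk
  refine ⟨⟨μ₀.mulChar _ hc, mulChar_mem_Omega h₀ _ _ fun y hy => ?_⟩, ?_⟩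
  · exact (congrArg θ ((QuotientGroup.eq_one_iff y).2 hy)).trans (map_one θ)
  · refine MonoidHom.ext fun y => ?_
    rw [omegaRatio_out, ratioChar_apply, μ₀.mulChar_zStar, mul_div_cancel_left]
    exact congrArg θ (QuotientGroup.out_eq' y)

end OmegaChar

/-! ### The expansion in Whittaker functions -/

section Expansion

variable {V : Submodule ℂ (MetaGL2 F → ℂ)} (hV : IsCuspidalRep V) {φ : MetaGL2 F → ℂ} (hφV : φ ∈ V)
  {g₀ : GL (Fin 2) 𝔸[F]} {e : 𝔸[F]ˣ} (hb : IsBase g₀ e)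
  {ψ : AddChar 𝔸[F] Circle} (hψ : Continuous ψ) (hψF : ∀ x : F, ψ (algebraMap F 𝔸[F] x) = 1)

include hV hφV hb hψ hψF

theorem whittaker_eq_zero_of_eq_one (h1 : ψ = 1) (μ : GenuineChar F) (ξ : Fˣ) :
    whittaker ψ φ (twist μ.toFun ξ) (gstar (aMat (principal ξ)) * gstar g₀) = 0 := by
  have hφ := hV.cuspForm φ hφV
  rw [whittaker_eq_integral_fourierCoef hφ hb μ hψ hψF]
  simp only [fourierCoef_normForm_eq_zero hφ hb μ _ (ξ := (ξ : F)) (ψ := ψ)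
    fun x => by rw [h1]; rfl]
  simp

/-- The Fourier expansion of a cusp form along `n(x)`, in terms of Whittaker functions. -/
theorem whittaker_expansion (hne : ψ ≠ 1) (hΩ : (Omega V).Nonempty) (x₀ : 𝔸[F]) :
    Summable (fun p : Omega V × Fˣ =>
      whittaker ψ φ (twist p.1.1.toFun p.2) (gstar (aMat (principal p.2)) * gstar g₀) *
        (ψ (algebraMap F 𝔸[F] (p.2 : F) * x₀) : ℂ)) ∧
    ∑' μ : Omega V, ∑' ξ : Fˣ,
      whittaker ψ φ (twist μ.1.toFun ξ) (gstar (aMat (principal ξ)) * gstar g₀) *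
        (ψ (algebraMap F 𝔸[F] (ξ : F) * x₀) : ℂ) = φ (elt g₀ 1 x₀) := by
  classical
  have hφ := hV.cuspForm φ hφV
  obtain ⟨μ₀, h₀⟩ := hΩ
  obtain ⟨H, hHo, hHr, hH⟩ := exists_isOpen_stabilizer hφ hb μ₀ h₀.1 fun t => h₀.2 t 1 φ hφV
  let H' : Subgroup (IdeleQuot F) := H.map (QuotientGroup.mk' (ratSquares F))
  have hH'o : IsOpen (H' : Set (IdeleQuot F)) := QuotientGroup.isOpenMap_coe _ hHo
  -- the Fourier coefficients as functions on the quotient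
  obtain ⟨c, hcdef⟩ : ∃ c : Fˣ → IdeleQuot F → ℂ,
      ∀ ξ y, c ξ y = fourierCoef ψ (normForm φ μ₀ g₀ y.out) ξ := ⟨_, fun _ _ => rfl⟩
  have hc : ∀ ξ (a : 𝔸[F]ˣ), c ξ (a : IdeleQuot F) = fourierCoef ψ (normForm φ μ₀ g₀ a) ξ := by
    intro ξ a
    obtain ⟨r, hr, hra⟩ := exists_out_idele_eq a
    rw [hcdef, hra, hH a r (hHr hr)]
  have hcinv : ∀ ξ y, ∀ h ∈ H', c ξ (y * h) = c ξ y := by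
    rintro ξ y - ⟨h, hh, rfl⟩
    obtain ⟨a, rfl⟩ := QuotientGroup.mk_surjective y
    have h1 : c ξ ((a * h : 𝔸[F]ˣ) : IdeleQuot F) = c ξ (a : IdeleQuot F) := by
      rw [hc, hc, hH a h hh]
    exact h1
  have hW : ∀ (μ : Omega V) (ξ : Fˣ), whittaker ψ φ (twist μ.1.toFun ξ)
      (gstar (aMat (principal ξ)) * gstar g₀) =
        ∫ y : IdeleQuot F, c ξ y * ((omegaRatio h₀ hV.ne_bot μ y)⁻¹ : ℂˣ) ∂(ideleHaar F) :=
      fun μ ξ => by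
    rw [whittaker_eq_integral_fourierCoef hφ hb μ₀ hψ hψF]
    simp only [omegaRatio_out, hcdef]
  obtain ⟨N, hN, hnice⟩ := hφ.exists_isNice hb
  have hnice' : ∀ y, IsNice N (normForm φ μ₀ g₀ y) := fun y => (hnice y).const_mul _
  have hs : ∀ y, Summable fun ξ : Fˣ => ‖c ξ y‖ := fun y => by
    simp only [hcdef]
    exact ((hnice' _).summable_fourierCoef hψ hψF hN hne).comp_injective Units.val_injective
  have hmain := summable_and_tsum_integral_mul_inv (ν := ideleHaar F) hH'o
    (omegaRatio_injective h₀ hV.ne_bot) (exists_omegaRatio_eq h₀ hV.ne_bot hH'o) hcinv hs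
    (u := fun ξ : Fˣ => (ψ (algebraMap F 𝔸[F] (ξ : F) * x₀) : ℂ)) fun _ => Circle.norm_coe _
  simp only [hW]
  refine ⟨hmain.1, hmain.2.trans ?_⟩
  have hc1 : ∀ ξ, c ξ 1 = fourierCoef ψ (normForm φ μ₀ g₀ 1) ξ := fun ξ => hc ξ 1
  simp only [hc1]
  have h2 := hasSum_fourierCoef hψ hψF hne (hnice' 1).periodic ((hnice' 1).continuous hN)
    ((hnice' 1).summable_fourierCoef hψ hψF hN hne) x₀
  have h3 := Function.Injective.tsum_eq (g := (Units.val : Fˣ → F)) Units.val_injective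
    (f := fun ξ : F => fourierCoef ψ (normForm φ μ₀ g₀ 1) ξ * ψ (algebraMap F 𝔸[F] ξ * x₀)) ?_
  · rw [h3, h2.tsum_eq, normForm]
    have h4 : μ₀.toFun (zStar 1) = 1 := by rw [← h₀.1 1, principal_one]
    rw [h4, inv_one, Units.val_one, mul_one]
  · -- the term at `0` vanishes by cuspidality
    intro ξ hξ
    by_contra hr
    have h0 : ξ = 0 := by
      by_contra hne0
      exact hr ⟨Units.mk0 ξ hne0, rfl⟩
    refine hξ ?_
    dsimp only
    rw [fourierCoef_normForm_eq_zero hφ hb μ₀ 1 (fun x => by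
      rw [h0, map_zero, zero_mul, AddChar.map_zero_eq_one]), zero_mul]

end Expansion

/-! ### The local characters at the places in `S` -/

/-- The embedding of the infinite adeles into the adeles. -/
def infAdele : InfiniteAdeleRing F →+ 𝔸[F] where
  toFun x := (x, 0)
  map_zero' := rfl
  map_add' _ _ := Prod.ext rfl (add_zero _).symm

open scoped Classical in
theorem addChar_infAdele (ψ : AddChar 𝔸[F] Circle) (x : InfiniteAdeleRing F) :
    ψ (infAdele x) = ∏ v, psiInf ψ v (x v) := by
  have e : x = ∑ v, (show InfiniteAdeleRing F from Pi.single v (x v)) :=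
    (Finset.univ_sum_single (M := fun w : InfinitePlace F => w.Completion) x).symm
  have e' := (congrArg infAdele e).trans (map_sum infAdele _ _)
  rw [e', addChar_map_sum]
  rfl

open scoped Classical in
/-- The finite adele with component `x` at `v` and zero elsewhere. -/
def finSingle (v : FinPl F) (x : v.adicCompletion F) : FinAdele F :=
  RestrictedProduct.single (fun w : FinPl F => w.adicCompletionIntegers F) v x

theorem evFin_finEmb_finSingle_same (v : FinPl F) (x : v.adicCompletion F) :
    evFin v (finEmb (finSingle v x)) = x := by
  classical
  exact RestrictedProduct.single_eq_same
    (fun w : FinPl F => w.adicCompletionIntegers F) v x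

theorem evFin_finEmb_finSingle_of_ne {v w : FinPl F} (h : w ≠ v) (x : v.adicCompletion F) :
    evFin w (finEmb (finSingle v x)) = 0 := by
  classical
  exact RestrictedProduct.single_eq_of_ne
    (fun w : FinPl F => w.adicCompletionIntegers F) x h

theorem addChar_finEmb (ψ : AddChar 𝔸[F] Circle) (u : FinAdele F) (s : Finset (FinPl F))
    (hs : ∀ v ∉ s, u v = 0) : ψ (finEmb u) = ∏ v ∈ s, psiFin ψ v (u v) := by
  have e : finEmb u = ∑ v ∈ s, finEmb (finSingle v (u v)) := by
    rw [← map_sum]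
    refine congrArg _ (FiniteAdeleRing.ext _ fun v => ?_)
    change u v = evFin v (finEmb (∑ w ∈ s, finSingle w (u w)))
    rw [map_sum, map_sum]
    by_cases hv : v ∈ s
    · rw [Finset.sum_eq_single v, evFin_finEmb_finSingle_same]
      · exact fun w _ hw => evFin_finEmb_finSingle_of_ne hw.symm _
      · exact fun h => absurd hv h
    · rw [Finset.sum_eq_zero, hs v hv]
      exact fun w hw => evFin_finEmb_finSingle_of_ne (ne_of_mem_of_not_mem hw hv).symm _
  rw [e, addChar_map_sum]
  rfl

open scoped Classical in
/-- The product of the local characters is the value of `ψ` at the adele with components `-ξ ζ_v⁻¹`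
at the places in `S`, and `0` elsewhere. -/
theorem psiS_eq (ψ : AddChar 𝔸[F] Circle) (ζ : 𝔸[F]) (ξ : F) :
    psiS ψ ζ ξ = ψ (algebraMap F 𝔸[F] ξ * -invS ζ) := by
  obtain ⟨x, u, hxu⟩ : ∃ (x : InfiniteAdeleRing F) (u : FinAdele F),
      algebraMap F 𝔸[F] ξ * -invS ζ = (x, u) := ⟨_, _, rfl⟩
  have hinf : ∀ v, x v =
      if v ∈ SInf ζ then -(algebraMap F v.Completion ξ) * (evInf v ζ)⁻¹ else 0 := by
    intro v
    have h : algebraMap F v.Completion ξ * -(if v ∈ SInf ζ then (evInf v ζ)⁻¹ else 0) = x v :=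
      congrArg (evInf v) hxu
    rw [← h]
    split_ifs <;> ring
  have hfin : ∀ v, u v =
      if v ∈ SFin ζ then -(algebraMap F (v.adicCompletion F) ξ) * (evFin v ζ)⁻¹ else 0 := by
    intro v
    have h : algebraMap F (v.adicCompletion F) ξ *
        -(if v ∈ SFin ζ then (evFin v ζ)⁻¹ else 0) = u v := congrArg (evFin v) hxu
    rw [← h]
    split_ifs <;> ring
  have hS : (SFin ζ).Finite := by
    have h : {v : FinPl F | ζ.2 v ∉ v.adicCompletionIntegers F}.Finite := ζ.2.2
    exact h.subset fun v hv hv' => not_le.2 (show 1 < Valued.v (evFin v ζ) from hv)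
      (show Valued.v (evFin v ζ) ≤ 1 from hv')
  have h1 : ∏ᶠ v ∈ SInf ζ, psiInf ψ v (-(algebraMap F v.Completion ξ) * (evInf v ζ)⁻¹) =
      ψ (infAdele x) := by
    rw [addChar_infAdele, ← finprod_eq_prod_of_fintype]
    refine finprod_congr fun v => ?_
    rw [hinf]
    by_cases hv : v ∈ SInf ζ
    · simp only [hv, finprod_true, if_true]
    · simp only [hv, finprod_false, if_false, psiInf, Pi.single_zero]
      exact (AddChar.map_zero_eq_one ψ).symm
  have h2 : ∏ᶠ v ∈ SFin ζ, psiFin ψ v (-(algebraMap F (v.adicCompletion F) ξ) * (evFin v ζ)⁻¹) =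
      ψ (finEmb u) := by
    rw [addChar_finEmb ψ u hS.toFinset fun v hv => by
        rw [hfin, if_neg fun h => hv (hS.mem_toFinset.2 h)],
      finprod_mem_eq_finite_toFinset_prod _ hS]
    refine Finset.prod_congr rfl fun v hv => ?_
    rw [hfin, if_pos (hS.mem_toFinset.1 hv)]
  have h3 : algebraMap F 𝔸[F] ξ * -invS ζ = infAdele x + finEmb u :=
    hxu.trans (Prod.ext (add_zero x).symm (zero_add u).symm)
  rw [psiS, h1, h2, h3, AddChar.map_add_eq_mul ψ]

end Metaplectic

end

theorem proposition4p1 (F : Type*) [Field F] [NumberField F]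
    (V : Submodule ℂ (Metaplectic.MetaGL2 F → ℂ)) (hV : Metaplectic.IsCuspidalRep V)
    (φ : Metaplectic.MetaGL2 F → ℂ) (hφ : φ ∈ V) (hN : Metaplectic.IsNInvariant φ)
    (ψ : AddChar 𝔸[F] Circle) (hψ : Continuous ψ)
    (hψF : ∀ x : F, ψ (algebraMap F 𝔸[F] x) = 1)
    (ζ : 𝔸[F]) :
    Summable (fun p : Metaplectic.Omega V × Fˣ =>
      Metaplectic.whittaker ψ φ (Metaplectic.twist p.1.1.toFun p.2)
        (Metaplectic.gstar (Metaplectic.aMat (Metaplectic.principal p.2))) *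
      (ψ (algebraMap F 𝔸[F] (p.2 : F) * ζ) : ℂ)) ∧
    Summable (fun p : Metaplectic.Omega V × Fˣ =>
      Metaplectic.whittaker ψ φ (Metaplectic.twist p.1.1.toFun p.2)
        (Metaplectic.gstar (Metaplectic.aMat (Metaplectic.principal p.2)) *
          Metaplectic.varsigma (Metaplectic.wMat F) * Metaplectic.hEl ζ) *
      (Metaplectic.psiS ψ ζ (p.2 : F) : ℂ)) ∧
    ∑' μ : Metaplectic.Omega V, ∑' ξ : Fˣ,
      Metaplectic.whittaker ψ φ (Metaplectic.twist μ.1.toFun ξ)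
        (Metaplectic.gstar (Metaplectic.aMat (Metaplectic.principal ξ))) *
      (ψ (algebraMap F 𝔸[F] (ξ : F) * ζ) : ℂ) =
    ∑' μ : Metaplectic.Omega V, ∑' ξ : Fˣ,
      Metaplectic.whittaker ψ φ (Metaplectic.twist μ.1.toFun ξ)
        (Metaplectic.gstar (Metaplectic.aMat (Metaplectic.principal ξ)) *
          Metaplectic.varsigma (Metaplectic.wMat F) * Metaplectic.hEl ζ) *
      (Metaplectic.psiS ψ ζ (ξ : F) : ℂ) := by
  have hcusp := hV.cuspForm φ hφ
  simp only [Metaplectic.gstar_aMat_mul_wMat_mul_hEl, Metaplectic.psiS_eq]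
  have hb₁ := Metaplectic.isBase_one (F := F)
  have hb₂ := Metaplectic.isBase_wMat_mul_hMat ζ
  -- for trivial `ψ` all Whittaker functions are integrals of constant terms
  by_cases hψ1 : ψ = 1
  · have hz₁ := Metaplectic.whittaker_eq_zero_of_eq_one hV hφ hb₁ hψ hψF hψ1
    have hz₂ := Metaplectic.whittaker_eq_zero_of_eq_one hV hφ hb₂ hψ hψF hψ1
    simp only [Metaplectic.gstar_aMat_mul_one] at hz₁
    simp only [hz₁, hz₂, zero_mul, tsum_zero]
    exact ⟨summable_zero, summable_zero, trivial⟩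
  rcases (Metaplectic.Omega V).eq_empty_or_nonempty with hΩ | hΩ
  · have : IsEmpty (Metaplectic.Omega V) := Set.isEmpty_coe_sort.2 hΩ
    exact ⟨summable_empty, summable_empty, by rw [tsum_empty, tsum_empty]⟩
  obtain ⟨hs₁, ht₁⟩ := Metaplectic.whittaker_expansion hV hφ hb₁ hψ hψF hψ1 hΩ ζ
  obtain ⟨hs₂, ht₂⟩ :=
    Metaplectic.whittaker_expansion hV hφ hb₂ hψ hψF hψ1 hΩ (-Metaplectic.invS ζ)
  simp only [Metaplectic.gstar_aMat_mul_one] at hs₁ ht₁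
  exact ⟨hs₁, hs₂, ht₁.trans ((hcusp.elt_wMat_mul_hMat hN ζ).symm.trans ht₂.symm)⟩
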